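/- Fix $d\ge 1$ and $\beta>0$. **Notation.** $\Gamma$ is the space of locally finite subsets of $\mathbb R^d$ with the vague topology, and $\Gamma_0$ the space of finite subsets, with the topology of the disjoint union over $m\ge0$ of the quotients of $\{x\in(\mathbb R^d)^m : x_i\ne x_j \text{ for } i\neq j\}$ under permutations; both carry their Borel $\sigma$-fields. $\sharp\eta$ is the number of points of $\eta$. For $\Lambda\subset\mathbb R^d$, $p_\Lambda(\gamma)=\gamma\cap\Lambda$ and $\Gamma_\Lambda$ is the set of configurations contained in $\Lambda$. The Lebesgue–Poisson measure on $\Gamma_0$ is $$\lambda(A)=\sum_{m\ge0}\frac1{m!}\int_{(\mathbb R^d)^m}1_A(\{x_1,\dots,x_m\})\,dx_1\cdots dx_m .$$ A probability measure $\mu$ on $\Gamma$ is *locally absolutely continuous* if $\mu\circ p_\Lambda^{-1}\ll\lambda|_{\Gamma_\Lambda}$ for every open bounded $\Lambda$. Its correlation functional $\rho_\mu:\Gamma_0\to[0,\infty]$ is then defined $\lambda$-a.e. by $$\rho_\mu(\eta)=\int_{\Gamma_\Lambda}\frac{d(\mu\circ p_\Lambda^{-1})}{d\lambda}(\gamma\cup\eta)\,d\lambda(\gamma)\qquad(\eta\in\Gamma_\Lambda,\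 \Lambda \text{ open bounded}),$$ which up to $\lambda$-null sets does not depend on $\Lambda$. Inequalities between functions on $\Gamma_0$ are understood $\lambda$-a.e. For $f:\Gamma_0\to\mathbb R$ put $Kf(\gamma)=\sum_{\eta\subset\gamma,\ \eta\in\Gamma_0}f(\eta)$. A function $G$ on $\Gamma$ is a *cylinder function* if $G=G\circ p_\Lambda$ for some bounded measurable $\Lambda$. Weak-* convergence in $L^\infty(\Gamma_0;\lambda)$ is that of the dual of $L^1(\Gamma_0;\lambda)$. *Velocity marked objects.* $\Gamma^v$ (resp. $\Gamma^v_0$) is the space of sets $\gamma\subset\mathbb R^d\times\mathbb R^d$ of pairs (position, velocity) with pairwise distinct positions which form a locally finite (resp. finite) set. $\Gamma^v$ has the topology generated by the maps $\gamma\mapsto\sum_{(x,v)\in\gamma}f(x,v)$ with $f$ bounded, continuous and of spatially bounded support; $\Gamma_0^v$ has the analogous disjoint union topology. $p_\Lambda$ and $\Gamma^v_\Lambda$ refer to the positions. $\lambda^v$ is the Lebesgue–Poisson measure with $dx$ replaced by $(2\pi/\beta)^{-d/2}e^{-\beta v^2/2}\,d(x,v)$; local absolute continuity, $\rho^v$,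 $K$ and cylinder functions are defined as before. For a probability measure $\mu$ on $\Gamma$, $\mu^v$ is the measure on $\Gamma^v$ under which the positions have law $\mu$ and the velocities are independent of each other and of the positions, with density $(2\pi/\beta)^{-d/2}e^{-\beta v^2/2}$. For locally absolutely continuous $\mu$ it is the measure with $\frac{d(\mu^v\circ p_\Lambda^{-1})}{d\lambda^v}(\{(x_1,v_1),\dots,(x_k,v_k)\})=\frac{d(\mu\circ p_\Lambda^{-1})}{d\lambda}(\{x_1,\dots,x_k\})$ on $\Gamma^v_\Lambda$ for all open bounded $\Lambda$. **Statement.** Let $\mu_n$, $n\in\mathbb N$, be locally absolutely continuous probability measures on $\Gamma$ converging weakly to a probability measure $\mu$ on $\Gamma$. **(A)** Let $\xi>0$ and suppose $\rho_{\mu_n}(\eta)\le\xi^{\sharp\eta}$ for all $n$. Then: 1. For every $f\in L^1(\Gamma_0;\xi^{\sharp\cdot}\lambda)$ the sum defining $Kf$ converges absolutely a.s., and $Kf$ is integrable, with respect to all $\mu_n$ and $\mu$; $\mu_n(Kf)\to\mu(Kf)$; and there are bounded continuous cylinder functions $G_k:\Gamma\to\mathbb R$ with $\sup_n\|G_k-Kf\|_{L^1(\mu_n)}\to0$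 and $\|G_k-Kf\|_{L^1(\mu)}\to0$ as $k\to\infty$. 2. $\mu$ is locally absolutely continuous and $\rho_\mu(\eta)\le\xi^{\sharp\eta}$. 3. $\rho_{\mu_n}/\xi^{\sharp\cdot}\to\rho_\mu/\xi^{\sharp\cdot}$ weak-* in $L^\infty(\Gamma_0;\lambda)$. Under the same hypotheses 1–3 also hold with $\Gamma,\Gamma_0,\lambda,\mu_n,\mu,\rho$ replaced by $\Gamma^v,\Gamma^v_0,\lambda^v,\mu_n^v,\mu^v,\rho^v$. **(B)** Let $\zeta\ge1$, let $\tilde h_n\in L^\infty(\Gamma_0;\lambda)$ be uniformly bounded and weak-* convergent to $\tilde h\in L^\infty(\Gamma_0;\lambda)$, and suppose $\rho_{\mu_n}(\eta)\le\zeta^{\sharp\eta}\tilde h_n(\eta)$ for all $n$. Then: 1. $\mu$ is locally absolutely continuous and $\rho_\mu(\eta)\le\zeta^{\sharp\eta}\tilde h(\eta)$. 2. If $\overline h:\Gamma_0\to\mathbb R$ is measurable with $\tilde h_n\le\overline h$ for all $n$ and $\tilde h\le\overline h$, then for every measurable $f:\Gamma_0\to\mathbb R$ integrable with respect to $\zeta^{\sharp\cdot}\,\overline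 h\,\lambda$ all assertions of (A)1 about $Kf$ hold. The same is true in the velocity marked case: if $\zeta\ge1$, if $\tilde h_n\in L^\infty(\Gamma^v_0;\lambda^v)$ are uniformly bounded and weak-* convergent to $\tilde h$, and if $\rho^v_{\mu_n^v}(\eta)\le\zeta^{\sharp\eta}\tilde h_n(\eta)$ for all $n$, then 1 and 2 hold with $\Gamma,\Gamma_0,\lambda,\mu_n,\mu,\rho$ replaced by $\Gamma^v,\Gamma^v_0,\lambda^v,\mu^v_n,\mu^v,\rho^v$. -/

import Mathlib

open MeasureTheory Filter Topology Set
open scoped ENNReal BoundedContinuousFunction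

noncomputable section

namespace RuelleLimit

/-- Position space `ℝ^d`. -/
abbrev E (d : ℕ) : Type := EuclideanSpace ℝ (Fin d)

/-! Everything is developed for a space `X` of (possibly marked) points with a position map
`π : X → ℝ^d` and an intensity measure `σ` on `X`. The unmarked case is `X = ℝ^d`, `π = id`,
`σ = dx`; the velocity marked case is `X = ℝ^d × ℝ^d`, `π = Prod.fst`,
`σ = (2π/β)^{-d/2} e^{-β v²/2} d(x,v)`. -/

section General

variable {d : ℕ} {X : Type}

/-- Locally finite configurations of points whose positions are pairwise distinct. -/
def Config (π : X → E d) : Type :=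
  {γ : Set X // InjOn π γ ∧ ∀ L : Set (E d), IsCompact L → (γ ∩ π ⁻¹' L).Finite}

/-- Finite configurations (the space `Γ₀`). -/
def FinConfig (π : X → E d) : Type :=
  {η : Set X // InjOn π η ∧ η.Finite}

/-- The pairing `⟨f, γ⟩ = ∑_{x ∈ γ} f x`. -/
def pairing (π : X → E d) (f : X → ℝ) (γ : Config π) : ℝ := ∑' x : γ.1, f x

/-- The topology generated by the maps `⟨f, ·⟩`, for `f` bounded and continuous with spatially
bounded support; for `π = id` it is the vague topology. -/
instance [TopologicalSpace X] (π : X → E d) : TopologicalSpace (Config π) :=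
  ⨅ f : {f : X →ᵇ ℝ // ∃ L : Set (E d), IsCompact L ∧ ∀ x, f x ≠ 0 → π x ∈ L},
    TopologicalSpace.induced (pairing π f.1) inferInstance

instance [TopologicalSpace X] (π : X → E d) : MeasurableSpace (Config π) := borel _

instance [TopologicalSpace X] (π : X → E d) : BorelSpace (Config π) := ⟨rfl⟩

/-- The `n`-tuples of points with pairwise distinct positions. -/
def offDiag (π : X → E d) (n : ℕ) : Set (Fin n → X) := {x | Function.Injective (π ∘ x)}

/-- `(x₁, …, xₙ) ↦ {x₁, …, xₙ}`. -/
def sym (π : X → E d) (n : ℕ) (x : offDiag π n) : FinConfig π :=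
  ⟨range x.1, by
    rintro _ ⟨i, rfl⟩ _ ⟨j, rfl⟩ h
    exact congrArg x.1 (x.2 h), finite_range _⟩

/-- `Γ₀` is the disjoint union of the quotients of the spaces `offDiag π n`. -/
instance [TopologicalSpace X] (π : X → E d) : TopologicalSpace (FinConfig π) :=
  ⨆ n : ℕ, TopologicalSpace.coinduced (sym π n) inferInstance

instance [TopologicalSpace X] (π : X → E d) : MeasurableSpace (FinConfig π) := borel _

instance [TopologicalSpace X] (π : X → E d) : BorelSpace (FinConfig π) := ⟨rfl⟩

/-- The number `♯η` of points. -/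
def card (π : X → E d) (η : FinConfig π) : ℕ := η.1.ncard

/-- The finite configurations with all positions in `Λ`. -/
def FinConfigIn (π : X → E d) (Λ : Set (E d)) : Set (FinConfig π) := {η | η.1 ⊆ π ⁻¹' Λ}

/-- The projection `γ ↦ γ ∩ Λ`, with values in `Γ`. -/
def restr (π : X → E d) (Λ : Set (E d)) (γ : Config π) : Config π :=
  ⟨γ.1 ∩ π ⁻¹' Λ, γ.2.1.mono inter_subset_left, fun L hL =>
    (γ.2.2 L hL).subset (inter_subset_inter_left _ inter_subset_left)⟩

/-- The projection `p_Λ : γ ↦ γ ∩ Λ` for bounded `Λ`, with values in `Γ₀`. -/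
def localConfig (π : X → E d) (Λ : Set (E d)) (hΛ : Bornology.IsBounded Λ) (γ : Config π) :
    FinConfig π :=
  ⟨γ.1 ∩ π ⁻¹' Λ, γ.2.1.mono inter_subset_left,
    (γ.2.2 (closure Λ) hΛ.isCompact_closure).subset
      (inter_subset_inter_right _ (preimage_mono subset_closure))⟩

/-- The `K`-transform `Kf(γ) = ∑_{η ⊂ γ, η finite} f(η)`. -/
def KTransform (π : X → E d) (f : FinConfig π → ℝ) (γ : Config π) : ℝ :=
  ∑' η : {η : FinConfig π // η.1 ⊆ γ.1}, f η.1

variable [TopologicalSpace X] [MeasurableSpace X]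

/-- The Lebesgue-Poisson measure with intensity measure `σ`:
`λ(A) = ∑ₙ (1/n!) ∫ 1_A({x₁, …, xₙ}) σ(dx₁) ⋯ σ(dxₙ)`. -/
def lebesguePoisson (π : X → E d) (σ : Measure X) : Measure (FinConfig π) :=
  Measure.sum fun n : ℕ => ((n.factorial : ℝ≥0∞)⁻¹) •
    ((Measure.pi fun _ : Fin n => σ).comap (Subtype.val : offDiag π n → Fin n → X)).map (sym π n)

/-- The image measure `μ ∘ p_Λ⁻¹` on `Γ₀`. -/
def localLaw (π : X → E d) (μ : Measure (Config π)) (Λ : Set (E d))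
    (hΛ : Bornology.IsBounded Λ) : Measure (FinConfig π) :=
  μ.map (localConfig π Λ hΛ)

/-- Local absolute continuity with respect to the Lebesgue-Poisson measure. -/
def LocallyAC (π : X → E d) (σ : Measure X) (μ : Measure (Config π)) : Prop :=
  ∀ (Λ : Set (E d)) (hΛ : Bornology.IsBounded Λ), IsOpen Λ →
    localLaw π μ Λ hΛ ≪ (lebesguePoisson π σ).restrict (FinConfigIn π Λ)

/-- The density of `μ ∘ p_Λ⁻¹` with respect to the restriction of `λ` to `Γ_Λ`. -/
def localDensity (π : X → E d) (σ : Measure X) (μ : Measure (Config π)) (Λ : Set (E d))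
    (hΛ : Bornology.IsBounded Λ) : FinConfig π → ℝ≥0∞ :=
  (localLaw π μ Λ hΛ).rnDeriv ((lebesguePoisson π σ).restrict (FinConfigIn π Λ))

open Classical in
/-- `g(γ ∪ η)`, set to `0` if `γ ∪ η` does not have pairwise distinct positions (which cannot
happen for `π = id`, and happens for a `λ`-null set of `γ` in the velocity marked case). -/
def evalUnion (π : X → E d) (g : FinConfig π → ℝ≥0∞) (γ η : FinConfig π) : ℝ≥0∞ :=
  if h : InjOn π (γ.1 ∪ η.1) then g ⟨γ.1 ∪ η.1, h, γ.2.2.union η.2.2⟩ else 0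

/-- `∫_{Γ_Λ} (d(μ ∘ p_Λ⁻¹)/dλ)(γ ∪ η) dλ(γ)`. -/
def correlationOn (π : X → E d) (σ : Measure X) (μ : Measure (Config π)) (Λ : Set (E d))
    (hΛ : Bornology.IsBounded Λ) (η : FinConfig π) : ℝ≥0∞ :=
  ∫⁻ γ in FinConfigIn π Λ, evalUnion π (localDensity π σ μ Λ hΛ) γ η ∂(lebesguePoisson π σ)

/-- `ρ` is the correlation functional of `μ`: for every open bounded `Λ` it is given on `Γ_Λ`
(up to a `λ`-null set) by `∫_{Γ_Λ} (d(μ ∘ p_Λ⁻¹)/dλ)(γ ∪ η) dλ(γ)`. -/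
def IsCorrelationFunctional (π : X → E d) (σ : Measure X) (μ : Measure (Config π))
    (ρ : FinConfig π → ℝ≥0∞) : Prop :=
  ∀ (Λ : Set (E d)) (hΛ : Bornology.IsBounded Λ), IsOpen Λ →
    ρ =ᵐ[(lebesguePoisson π σ).restrict (FinConfigIn π Λ)] correlationOn π σ μ Λ hΛ

/-- The least natural number `k` such that all positions of `η` lie in the open ball of radius `k`
around `0`. -/
def radius (π : X → E d) (η : FinConfig π) : ℕ :=
  sInf {k : ℕ | η ∈ FinConfigIn π (Metric.ball 0 k)}

/-- The correlation functional `ρ_μ`. For locally absolutely continuous `μ`, the value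
`correlationOn π σ μ Λ hΛ η` is for almost every `η` the same for every open bounded `Λ` that
contains the positions of `η`; we use the smallest ball of integer radius. -/
def correlation (π : X → E d) (σ : Measure X) (μ : Measure (Config π)) (η : FinConfig π) : ℝ≥0∞ :=
  correlationOn π σ μ (Metric.ball 0 (radius π η)) Metric.isBounded_ball η

/-- The (improved) Ruelle bound `ρ_μ(η) ≤ ξ^{♯η} h(η)` for almost every `η`, as an inequality of
extended real numbers; `h = 1` is the usual Ruelle bound. -/
def RuelleBound (π : X → E d) (σ : Measure X) (μ : Measure (Config π)) (ξ : ℝ)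
    (h : FinConfig π → ℝ) : Prop :=
  ∀ᵐ η ∂(lebesguePoisson π σ),
    ((correlation π σ μ η : ℝ≥0∞) : EReal) ≤ ((ξ ^ card π η * h η : ℝ) : EReal)

/-- The measure `ξ^{♯η} h(η) λ(dη)`. -/
def weighted (π : X → E d) (σ : Measure X) (ξ : ℝ) (h : FinConfig π → ℝ) :
    Measure (FinConfig π) :=
  (lebesguePoisson π σ).withDensity fun η => ENNReal.ofReal (ξ ^ card π η * h η)

/-- The function `ρ_μ(η) / ξ^{♯η}`. -/
def normalizedCorrelation (π : X → E d) (σ : Measure X) (μ : Measure (Config π)) (ξ : ℝ)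
    (η : FinConfig π) : ℝ :=
  (correlation π σ μ η).toReal / ξ ^ card π η

/-- Bounded continuous cylinder functions: those depending only on `γ ∩ Λ` for some bounded
measurable `Λ`. -/
def IsCylinder (π : X → E d) (G : Config π →ᵇ ℝ) : Prop :=
  ∃ Λ : Set (E d), Bornology.IsBounded Λ ∧ MeasurableSet Λ ∧ ∀ γ, G γ = G (restr π Λ γ)

/-- The sums defining `Kf` converge absolutely a.s., `Kf` is integrable,
`μₙ(Kf) → μ(Kf)`, and `Kf` is approximated by a sequence of bounded continuous cylinder functions
in `L¹(μₙ)`, uniformly in `n`, and in `L¹(μ)`. -/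
def KConvergence (π : X → E d) (μs : ℕ → Measure (Config π)) (μ : Measure (Config π))
    (f : FinConfig π → ℝ) : Prop :=
  (∀ n, ∀ᵐ γ ∂(μs n), Summable fun η : {η : FinConfig π // η.1 ⊆ γ.1} => |f η.1|) ∧
  (∀ᵐ γ ∂μ, Summable fun η : {η : FinConfig π // η.1 ⊆ γ.1} => |f η.1|) ∧
  (∀ n, Integrable (KTransform π f) (μs n)) ∧
  Integrable (KTransform π f) μ ∧
  Tendsto (fun n => ∫ γ, KTransform π f γ ∂(μs n)) atTop (𝓝 (∫ γ, KTransform π f γ ∂μ)) ∧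
  ∃ G : ℕ → (Config π →ᵇ ℝ), (∀ k, IsCylinder π (G k)) ∧
    Tendsto (fun k => ⨆ n, eLpNorm (fun γ => G k γ - KTransform π f γ) 1 (μs n)) atTop (𝓝 0) ∧
    Tendsto (fun k => eLpNorm (fun γ => G k γ - KTransform π f γ) 1 μ) atTop (𝓝 0)

end General

/-- Weak-* convergence in `L^∞(m)`, seen as the dual of `L¹(m)`. -/
def WeakStarTendsto {Ω : Type} [MeasurableSpace Ω] (m : Measure Ω) (h : ℕ → Ω → ℝ)
    (hlim : Ω → ℝ) : Prop :=
  (∀ n, MemLp (h n) ∞ m) ∧ MemLp hlim ∞ m ∧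
  ∀ φ : Ω → ℝ, Integrable φ m →
    Tendsto (fun n => ∫ ω, φ ω * h n ω ∂m) atTop (𝓝 (∫ ω, φ ω * hlim ω ∂m))

/-! The unmarked and the velocity marked case. -/

/-- The position map in the unmarked case. -/
abbrev pos (d : ℕ) : E d → E d := id

/-- The position map in the velocity marked case. -/
abbrev posV (d : ℕ) : E d × E d → E d := Prod.fst

/-- The intensity measure in the unmarked case. -/
abbrev leb (d : ℕ) : Measure (E d) := volume

/-- The Gaussian measure `(2π/β)^{-d/2} e^{-β v²/2} dv` on the space of velocities. -/
def gaussian (d : ℕ) (β : ℝ) : Measure (E d) :=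
  volume.withDensity fun v =>
    ENNReal.ofReal ((√(2 * Real.pi / β) ^ d)⁻¹ * Real.exp (-(β * ‖v‖ ^ 2 / 2)))

/-- The intensity measure in the velocity marked case. -/
def lebV (d : ℕ) (β : ℝ) : Measure (E d × E d) := (volume : Measure (E d)).prod (gaussian d β)

/-- Attach the velocity `V x` to every `x ∈ γ`. -/
def attach {d : ℕ} (γ : Config (pos d)) (V : E d → E d) : Config (posV d) :=
  ⟨(fun x => (x, V x)) '' γ.1, by
    rintro _ ⟨x, -, rfl⟩ _ ⟨y, -, rfl⟩ h
    have h' : x = y := h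
    rw [h'], by
    intro L hL
    refine ((γ.2.2 L hL).image fun x => (x, V x)).subset ?_
    rintro _ ⟨⟨x, hx, rfl⟩, hxL⟩
    exact ⟨x, ⟨hx, hxL⟩, rfl⟩⟩

/-- The law of `γ` with independent Gaussian velocities attached to its points. -/
def markLaw {d : ℕ} (β : ℝ) (γ : Config (pos d)) : Measure (Config (posV d)) :=
  (Measure.infinitePi fun _ : E d => gaussian d β).map (attach γ)

/-- The measure `μ^v` on `Γ^v`: the positions are distributed according to `μ`, the velocities are
independent of each other and of the positions, and Gaussian. -/
def marked {d : ℕ} (β : ℝ) (μ : Measure (Config (pos d))) : Measure (Config (posV d)) :=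
  μ.bind (markLaw β)

/-- The projection of a finite marked configuration to its positions. -/
def positions {d : ℕ} (η : FinConfig (posV d)) : FinConfig (pos d) :=
  ⟨Prod.fst '' η.1, injOn_id _, η.2.2.image _⟩

/-- The property that characterizes `ν = μ^v`: for open bounded `Λ`,
`d(ν ∘ (p_Λ^v)⁻¹)/dλ^v ({(x₁,v₁),…,(x_k,v_k)}) = d(μ ∘ p_Λ⁻¹)/dλ ({x₁,…,x_k})` on `Γ_Λ^v`. -/
def HasMarkedDensities {d : ℕ} (β : ℝ) (μ : Measure (Config (pos d)))
    (ν : Measure (Config (posV d))) : Prop :=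
  ∀ (Λ : Set (E d)) (hΛ : Bornology.IsBounded Λ), IsOpen Λ →
    localLaw (posV d) ν Λ hΛ =
      ((lebesguePoisson (posV d) (lebV d β)).restrict (FinConfigIn (posV d) Λ)).withDensity
        fun η => localDensity (pos d) (leb d) μ Λ hΛ (positions η)

/-- Conclusions for a uniform Ruelle bound with constant `ξ`. The clauses with
`IsCorrelationFunctional` say that the correlation functionals are well defined, i.e. given by the
defining integral for every open bounded `Λ`. -/
def RuelleConclusion {d : ℕ} {X : Type} [TopologicalSpace X] [MeasurableSpace X] (π : X → E d)
    (σ : Measure X) (μs : ℕ → Measure (Config π)) (μ : Measure (Config π)) (ξ : ℝ) : Prop :=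
  (∀ f : FinConfig π → ℝ, Integrable f (weighted π σ ξ fun _ => 1) → KConvergence π μs μ f) ∧
  (∀ n, IsCorrelationFunctional π σ (μs n) (correlation π σ (μs n))) ∧
  (LocallyAC π σ μ ∧ IsCorrelationFunctional π σ μ (correlation π σ μ) ∧
    RuelleBound π σ μ ξ fun _ => 1) ∧
  WeakStarTendsto (lebesguePoisson π σ) (fun n => normalizedCorrelation π σ (μs n) ξ)
    (normalizedCorrelation π σ μ ξ)

/-- Conclusions for an improved Ruelle bound with constant `ζ` and functions `h n → hlim`. -/
def ImprovedRuelleConclusion {d : ℕ} {X : Type} [TopologicalSpace X] [MeasurableSpace X]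
    (π : X → E d) (σ : Measure X) (μs : ℕ → Measure (Config π)) (μ : Measure (Config π)) (ζ : ℝ)
    (h : ℕ → FinConfig π → ℝ) (hlim : FinConfig π → ℝ) : Prop :=
  (∀ n, IsCorrelationFunctional π σ (μs n) (correlation π σ (μs n))) ∧
  (LocallyAC π σ μ ∧ IsCorrelationFunctional π σ μ (correlation π σ μ) ∧
    RuelleBound π σ μ ζ hlim) ∧
  ∀ hbar : FinConfig π → ℝ, Measurable hbar →
    (∀ n, ∀ᵐ η ∂(lebesguePoisson π σ), h n η ≤ hbar η) →
    (∀ᵐ η ∂(lebesguePoisson π σ), hlim η ≤ hbar η) →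
    ∀ f : FinConfig π → ℝ, Measurable f → Integrable f (weighted π σ ζ hbar) →
      KConvergence π μs μ f

end RuelleLimit

end

open RuelleLimit

noncomputable section

set_option linter.unusedSectionVars false

namespace RuelleLimit

/-! ### Topology and Borel structure of the space of finite configurations -/

section FiniteConfigurations

variable {d : ℕ} {X : Type} {π : X → E d}

/-! The object that carries the proof is the correlation measure `corrMeasure μ` on `Γ₀`: the mean,
under `μ`, of the counting measure on the finite subconfigurations of `γ`. It is defined for every
`μ`, with no absolute continuity, and `∫ f d(corrMeasure μ) = μ(Kf)` whenever `|f|` is integrable.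
Minlos' identity shows that for locally absolutely continuous `μ` it has density `ρ_μ` with respect
to `λ` (`corrMeasure_eq_withDensity`). Conversely, absolute continuity of `corrMeasure μ` forces
local absolute continuity of `μ`, because `γ ∩ Λ` is itself one of the finite subconfigurations of
`γ` (`locallyAC_of_corrMeasure`). A Ruelle bound therefore yields a domination `corrMeasure μ ≤ ν`,
with `ν = ξ^♯ λ` or `ν = C ζ^♯ λ`, and such a domination makes sense for the limit before anything
is known about its densities.

Domination survives weak limits (`corrMeasure_le_of_tendsto`). If `φ` is continuous on `Γ₀` and
vanishes off the configurations in some ball, then `Kφ` is continuous on `Γ`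
(`continuous_KTransform`): a locally finite `γ` leaves a thin annulus outside the ball empty, so `γ
↦ γ ∩ B_r` is continuous at `γ` for a suitable larger radius `r`. Applying weak convergence to
truncations of `Kφ` with `φ ↑ 1_U`, `U` open, bounds the correlation measure of the limit on open
sets, and outer regularity of `ν` does the rest.

Convergence for all integrable `f` rests on an approximation that is uniform over all measures with
dominated correlation measure (`exists_cylinder_approx`). Cut `f` down to a bounded function with
bounded support, replace it by a continuous `g`, and clamp `Kg` at height `M`. The first two errors
are `L¹` errors on `Γ₀`, since `μ|Kf| ≤ ∫ |f| d(corrMeasure μ)`. The clamping error is at most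
`μ(|Kg|²)/M`, and the second moment is finite uniformly: `|Kg|` is at most a constant times `2^N`,
with `N` the number of points in a ball, and `4^N = K(3^♯)`. This gives convergence of the
correlation measures against every `ν`-integrable function (`corrTendsto_of_tendsto`), hence weak-*
convergence of the normalized densities, and comparison with the weak-* convergent `h n` gives the
improved bound for the limit.

The marked case needs no weak convergence on `Γ^v`. Averaging over the velocities turns a function
on `Γ₀^v` into one on `Γ₀` (`markInt`), and `corrMeasure (marked β μ)` tests `f` as `corrMeasure μ`
tests `markInt β f` (`lintegral_corrMeasure_marked`), so dominations and limits transfer directly.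
-/

theorem exists_sym_eq (η : FinConfig π) : ∃ n, ∃ x : offDiag π n, sym π n x = η := by
  have := η.2.2.to_subtype
  obtain ⟨n, ⟨e⟩⟩ := Finite.exists_equiv_fin η.1
  refine ⟨n, ⟨fun i => (e.symm i).1, ?_⟩, ?_⟩
  · intro i j h
    exact e.symm.injective (Subtype.ext (η.2.1 (e.symm i).2 (e.symm j).2 h))
  · refine Subtype.ext ?_
    ext x
    simp only [sym, mem_range]
    constructor
    · rintro ⟨i, rfl⟩
      exact (e.symm i).2
    · intro hx
      exact ⟨e ⟨x, hx⟩, by simp⟩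

theorem offDiag.injective {n : ℕ} (x : offDiag π n) : Function.Injective x.1 :=
  Function.Injective.of_comp x.2

theorem card_sym {n : ℕ} (x : offDiag π n) : card π (sym π n x) = n := by
  have := Nat.card_range_of_injective (offDiag.injective x)
  simpa [card, sym, Set.ncard] using this

/-- Permuting the points of an off-diagonal tuple. -/
def permute {n : ℕ} (x : offDiag π n) (e : Equiv.Perm (Fin n)) : offDiag π n :=
  ⟨x.1 ∘ e, x.2.comp e.injective⟩

theorem sym_permute {n : ℕ} (x : offDiag π n) (e : Equiv.Perm (Fin n)) :
    sym π n (permute x e) = sym π n x :=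
  Subtype.ext (e.surjective.range_comp x.1)

theorem exists_permute_of_sym_eq {n : ℕ} {x y : offDiag π n} (h : sym π n x = sym π n y) :
    ∃ e : Equiv.Perm (Fin n), y = permute x e := by
  have hr : range x.1 = range y.1 := congrArg Subtype.val h
  let e : Fin n ≃ Fin n := (Equiv.ofInjective y.1 (offDiag.injective y)).trans
    ((Equiv.setCongr hr.symm).trans (Equiv.ofInjective x.1 (offDiag.injective x)).symm)
  refine ⟨e, Subtype.ext (funext fun i => ?_)⟩
  have := Equiv.apply_ofInjective_symm (offDiag.injective x)
    ((Equiv.setCongr hr.symm) (Equiv.ofInjective y.1 (offDiag.injective y) i))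
  exact this.symm

/-- The only ambiguity in representing a configuration by a tuple is a permutation, because the
number of points is determined. -/
theorem exists_lift {α : Type*} (g : ∀ n, offDiag π n → α)
    (hg : ∀ n x e, g n (permute x e) = g n x) :
    ∃ ψ : FinConfig π → α, ∀ n x, ψ (sym π n x) = g n x := by
  choose N x hx using fun η : FinConfig π => exists_sym_eq η
  refine ⟨fun η => g (N η) (x η), fun n y => ?_⟩
  have key : ∀ m (x' : offDiag π m), sym π m x' = sym π n y → g m x' = g n y := by
    intro m x' h
    obtain rfl : m = n := by rw [← card_sym x', h, card_sym]
    obtain ⟨e, rfl⟩ := exists_permute_of_sym_eq h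
    exact (hg _ _ e).symm
  exact key _ _ (hx _)

variable [TopologicalSpace X]

theorem continuous_sym (n : ℕ) : Continuous (sym π n) :=
  continuous_iSup_rng (i := n) continuous_coinduced_rng

theorem isOpen_finConfig_iff {U : Set (FinConfig π)} :
    IsOpen U ↔ ∀ n, IsOpen (sym π n ⁻¹' U) := by
  rw [isOpen_iSup_iff]
  exact forall_congr' fun n => isOpen_coinduced

theorem continuous_finConfig_iff {Y : Type*} [TopologicalSpace Y] {g : FinConfig π → Y} :
    Continuous g ↔ ∀ n, Continuous (g ∘ sym π n) := by
  rw [continuous_iSup_dom]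
  exact forall_congr' fun n => continuous_coinduced_dom

theorem continuous_permute {n : ℕ} (e : Equiv.Perm (Fin n)) :
    Continuous fun x : offDiag π n => permute x e := by
  refine Continuous.subtype_mk ?_ _
  exact continuous_pi fun i => (continuous_apply (e i)).comp continuous_subtype_val

/-- The saturation of an open set of tuples is a finite union of its permuted copies, and tuples of
another length never meet the image. -/
theorem isOpenMap_sym (n : ℕ) : IsOpenMap (sym π n) := by
  intro R hR
  rw [isOpen_finConfig_iff]
  intro m
  by_cases hmn : m = n
  · subst hmn
    have : sym π m ⁻¹' (sym π m '' R) =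
        ⋃ e : Equiv.Perm (Fin m), (fun x => permute x e) ⁻¹' R := by
      ext y
      simp only [mem_preimage, mem_image, mem_iUnion]
      constructor
      · rintro ⟨x, hx, h⟩
        obtain ⟨e, rfl⟩ := exists_permute_of_sym_eq h.symm
        exact ⟨e, hx⟩
      · rintro ⟨e, he⟩
        exact ⟨_, he, sym_permute y e⟩
    rw [this]
    exact isOpen_iUnion fun e => hR.preimage (continuous_permute e)
  · convert isOpen_empty
    ext y
    simp only [mem_preimage, mem_image, mem_empty_iff_false, iff_false]
    rintro ⟨x, -, h⟩
    exact hmn (by rw [← card_sym y, ← h, card_sym])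

/-- Confine each position to one of finitely many disjoint open sets. A nontrivial permutation would
move a point into the wrong one, so `sym` is locally injective. -/
theorem exists_nhds_injOn_sym (hπ : Continuous π) {n : ℕ} (x : offDiag π n) :
    ∃ R : Set (offDiag π n), IsOpen R ∧ x ∈ R ∧ InjOn (sym π n) R := by
  obtain ⟨U, hU, hdisj⟩ := (Set.finite_range (π ∘ x.1)).t2_separation
  refine ⟨{y | ∀ i, π (y.1 i) ∈ U (π (x.1 i))}, ?_, fun i => (hU _).1, ?_⟩
  · simp only [ofPred_forall]
    exact isOpen_iInter_of_finite fun i => (hU _).2.preimage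
      (hπ.comp ((continuous_apply i).comp continuous_subtype_val))
  · intro y hy z hz h
    obtain ⟨e, rfl⟩ := exists_permute_of_sym_eq h
    have he : ∀ i, e i = i := by
      intro i
      by_contra hne
      have h1 : π (x.1 (e i)) ≠ π (x.1 i) := fun h => hne (x.2 h)
      exact (Set.disjoint_left.1 (hdisj ⟨e i, rfl⟩ ⟨i, rfl⟩ h1)) (hy (e i)) (hz i)
    refine Subtype.ext (funext fun i => ?_)
    simp [permute, he]

theorem isOpen_offDiag (hπ : Continuous π) (n : ℕ) : IsOpen (offDiag π n) := by
  have : offDiag π n = ⋂ i, ⋂ j, {x | i ≠ j → π (x i) ≠ π (x j)} := by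
    ext x
    simp only [offDiag, mem_ofPred_eq, mem_iInter]
    exact ⟨fun h i j hij h' => hij (h h'), fun h i j h' => by_contra fun hij => h i j hij h'⟩
  rw [this]
  refine isOpen_iInter_of_finite fun i => isOpen_iInter_of_finite fun j => ?_
  by_cases hij : i = j
  · simp [hij]
  · simp only [ne_eq, hij, not_false_eq_true, forall_const]
    exact isOpen_ne_fun (hπ.comp (continuous_apply i)) (hπ.comp (continuous_apply j))

/-- `sym` is locally an open embedding, and countably many of the neighbourhoods where this holds
cover the tuples. Hence measurability on `Γ₀` can be tested on tuples. -/
theorem measurableSet_image_sym [SecondCountableTopology X] [MeasurableSpace X] [BorelSpace X]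
    (hπ : Continuous π) {n : ℕ} {B : Set (offDiag π n)} (hB : MeasurableSet B) :
    MeasurableSet (sym π n '' B) := by
  choose R hRo hRx hRi using fun x : offDiag π n => exists_nhds_injOn_sym hπ x
  obtain ⟨s, hs, hsU⟩ := TopologicalSpace.countable_cover_nhds fun x =>
    (hRo x).mem_nhds (hRx x)
  have : sym π n '' B = ⋃ x ∈ s, (sym π n ∘ (Subtype.val : R x → offDiag π n)) ''
      (Subtype.val ⁻¹' B) := by
    ext η
    simp only [mem_image, mem_iUnion, mem_preimage, Function.comp, Subtype.exists, exists_prop]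
    constructor
    · rintro ⟨y, hyD, hy, rfl⟩
      have : (⟨y, hyD⟩ : offDiag π n) ∈ ⋃ x ∈ s, R x := hsU ▸ mem_univ _
      simp only [mem_iUnion] at this
      obtain ⟨x, hx, hyR⟩ := this
      exact ⟨x.1, x.2, hx, y, hyD, hyR, hy, rfl⟩
    · rintro ⟨x, hx, _, y, hyD, -, hy, h⟩
      exact ⟨y, hyD, hy, h⟩
  rw [this]
  refine MeasurableSet.biUnion hs fun x _ => ?_
  have hemb : IsOpenEmbedding (sym π n ∘ (Subtype.val : R x → offDiag π n)) := by
    refine IsOpenEmbedding.of_continuous_injective_isOpenMap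
      ((continuous_sym n).comp continuous_subtype_val) ?_ ?_
    · intro a b h
      exact Subtype.ext (hRi x a.2 b.2 h)
    · exact (isOpenMap_sym n).comp (hRo x).isOpenMap_subtype_val
  exact hemb.measurableEmbedding.measurableSet_image.2 (hB.preimage measurable_subtype_coe)

theorem measurable_sym [SecondCountableTopology X] [MeasurableSpace X] [BorelSpace X]
    (n : ℕ) : Measurable (sym π n) := (continuous_sym n).measurable

/-- The Borel sets of `Γ₀` are those whose preimages in the spaces of tuples are Borel. -/
theorem measurable_finConfig [SecondCountableTopology X] [MeasurableSpace X] [BorelSpace X]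
    (hπ : Continuous π) {Y : Type*} [MeasurableSpace Y] {g : FinConfig π → Y}
    (hg : ∀ n, Measurable (g ∘ sym π n)) : Measurable g := by
  intro A hA
  have : g ⁻¹' A = ⋃ n, sym π n '' ((g ∘ sym π n) ⁻¹' A) := by
    ext η
    simp only [mem_preimage, mem_iUnion, mem_image, Function.comp]
    constructor
    · intro h
      obtain ⟨n, x, rfl⟩ := exists_sym_eq η
      exact ⟨n, x, h, rfl⟩
    · rintro ⟨n, x, h, rfl⟩
      exact h
  rw [this]
  exact MeasurableSet.iUnion fun n => measurableSet_image_sym hπ (hg n hA)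

theorem measurable_card [SecondCountableTopology X] [MeasurableSpace X] [BorelSpace X]
    (hπ : Continuous π) : Measurable (card π) := by
  refine measurable_finConfig hπ fun n => ?_
  have : card π ∘ sym π n = fun _ => n := funext card_sym
  rw [this]
  exact measurable_const

theorem isOpen_finConfigIn (hπ : Continuous π) {Λ : Set (E d)} (hΛ : IsOpen Λ) :
    IsOpen (FinConfigIn π Λ) := by
  rw [isOpen_finConfig_iff]
  intro n
  have : sym π n ⁻¹' FinConfigIn π Λ = ⋂ i, {x | π (x.1 i) ∈ Λ} := by
    ext x
    simp [FinConfigIn, sym, range_subset_iff]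
  rw [this]
  exact isOpen_iInter_of_finite fun i =>
    hΛ.preimage (hπ.comp ((continuous_apply i).comp continuous_subtype_val))

end FiniteConfigurations

/-! ### Perfect normality of `Γ₀` and regularity of finite measures on it -/

section Regularity

variable {d : ℕ} {X : Type} {π : X → E d} [MetricSpace X]

/-- On `n`-tuples take the distance to the complement of the preimage of `U` inside all of `X^n`.
That set is closed because off-diagonal tuples form an open set, and the sup distance is permutation
invariant, so the function descends to `Γ₀`. -/
theorem exists_continuous_pos_iff (hπ : Continuous π) {U : Set (FinConfig π)} (hU : IsOpen U) :
    ∃ ψ : FinConfig π → ℝ, Continuous ψ ∧ (∀ η, 0 ≤ ψ η) ∧ ∀ η, 0 < ψ η ↔ η ∈ U := by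
  let C : ∀ n, Set (Fin n → X) := fun n => (Subtype.val '' (sym π n ⁻¹' U))ᶜ
  have hCo : ∀ n, IsClosed (C n) := fun n =>
    ((isOpen_offDiag hπ n).isOpenMap_subtype_val _ (isOpen_finConfig_iff.1 hU n)).isClosed_compl
  have hmem : ∀ n (x : offDiag π n), x.1 ∈ C n ↔ sym π n x ∉ U := by
    intro n x
    simp only [C, mem_compl_iff, mem_image, not_exists, not_and, mem_preimage]
    exact ⟨fun h hx => h x hx rfl, fun h y hy hyx => h (by rwa [← Subtype.ext hyx])⟩
  have hperm : ∀ n (e : Equiv.Perm (Fin n)) (z : Fin n → X), z ∈ C n → z ∘ e ∈ C n := by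
    intro n e z hz hz'
    obtain ⟨y, hy, hyz⟩ := hz'
    refine hz ⟨permute y e.symm, ?_, ?_⟩
    · rwa [mem_preimage, sym_permute]
    · ext i
      simp [permute, hyz]
  have hle : ∀ n (x : offDiag π n) e,
      Metric.infEDist (permute x e).1 (C n) ≤ Metric.infEDist x.1 (C n) := by
    intro n x e
    refine le_iInf₂ fun z hz => (Metric.infEDist_le_edist_of_mem (hperm n e z hz)).trans ?_
    refine edist_pi_le_iff.2 fun i => ?_
    exact edist_le_pi_edist x.1 z (e i)
  -- The cap at `1` keeps the value finite when `C n` is empty, where the distance is `∞`.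
  -- Invariance needs only `hle`, used for `e` and for `e.symm`.
  obtain ⟨ψ, hψ⟩ := exists_lift
    (fun n (x : offDiag π n) => (min 1 (Metric.infEDist x.1 (C n))).toReal) (by
      intro n x e
      have h2 := hle n (permute x e) e.symm
      have h3 : permute (permute x e) e.symm = x := Subtype.ext (by ext i; simp [permute])
      rw [h3] at h2
      simp only [le_antisymm (hle n x e) h2])
  refine ⟨ψ, ?_, ?_, ?_⟩
  · rw [continuous_finConfig_iff]
    intro n
    have : ψ ∘ sym π n = fun x => (min 1 (Metric.infEDist x.1 (C n))).toReal := funext (hψ n)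
    rw [this]
    refine ENNReal.continuousOn_toReal.comp_continuous
      (continuous_const.min (Metric.continuous_infEDist.comp continuous_subtype_val)) fun x => ?_
    exact ((min_le_left _ _).trans_lt ENNReal.one_lt_top).ne
  · intro η
    obtain ⟨n, x, rfl⟩ := exists_sym_eq η
    rw [hψ]
    exact ENNReal.toReal_nonneg
  · intro η
    obtain ⟨n, x, rfl⟩ := exists_sym_eq η
    rw [hψ, ENNReal.toReal_pos_iff, lt_min_iff]
    have h1 := Metric.infEDist_pos_iff_notMem_closure (x := x.1) (E := C n)
    rw [(hCo n).closure_eq, hmem, not_not] at h1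
    rw [h1]
    simp

theorem exists_continuous_eq_zero_iff (hπ : Continuous π) {A : Set (FinConfig π)}
    (hA : IsClosed A) :
    ∃ ψ : FinConfig π → ℝ, Continuous ψ ∧ (∀ η, 0 ≤ ψ η) ∧ ∀ η, ψ η = 0 ↔ η ∈ A := by
  obtain ⟨ψ, hc, h0, h⟩ := exists_continuous_pos_iff hπ hA.isOpen_compl
  refine ⟨ψ, hc, h0, fun η => ?_⟩
  have := h η
  rw [mem_compl_iff, (h0 η).lt_iff_ne'] at this
  exact not_iff_not.1 this

theorem normalSpace_finConfig (hπ : Continuous π) : NormalSpace (FinConfig π) := by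
  refine ⟨fun A B hA hB hAB => ?_⟩
  obtain ⟨a, hac, ha0, ha⟩ := exists_continuous_eq_zero_iff hπ hA
  obtain ⟨b, hbc, hb0, hb⟩ := exists_continuous_eq_zero_iff hπ hB
  refine ⟨{η | a η < b η}, {η | b η < a η}, isOpen_lt hac hbc, isOpen_lt hbc hac, ?_, ?_, ?_⟩
  · intro η hη
    have h1 := (ha η).2 hη
    have h2 : b η ≠ 0 := fun h => disjoint_left.1 hAB hη ((hb η).1 h)
    simpa [h1] using (hb0 η).lt_of_ne' h2
  · intro η hη
    have h1 := (hb η).2 hη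
    have h2 : a η ≠ 0 := fun h => disjoint_left.1 hAB ((ha η).1 h) hη
    simpa [h1] using (ha0 η).lt_of_ne' h2
  · exact disjoint_left.2 fun η (h1 : a η < b η) (h2 : b η < a η) => lt_asymm h1 h2

/-- An open set is the increasing union of the closed sets where its defining function is at least
`1/(j+1)`. Regularity serves twice: for the density of continuous functions in `L¹`, and for
reducing inequalities of measures to open sets. -/
theorem weaklyRegular_finConfig (hπ : Continuous π) (m : Measure (FinConfig π))
    [IsFiniteMeasure m] : m.WeaklyRegular := by
  refine Measure.InnerRegularWRT.weaklyRegular_of_finite m ?_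
  intro U hU r hr
  obtain ⟨ψ, hc, h0, h⟩ := exists_continuous_pos_iff hπ hU
  have hUe : U = ⋃ j : ℕ, {η | 1 / ((j : ℝ) + 1) ≤ ψ η} := by
    ext η
    rw [← h, mem_iUnion]
    constructor
    · intro hη
      obtain ⟨j, hj⟩ := exists_nat_one_div_lt hη
      exact ⟨j, hj.le⟩
    · rintro ⟨j, hj⟩
      exact lt_of_lt_of_le (by positivity) hj
  have hmono : Monotone fun j : ℕ => {η | 1 / ((j : ℝ) + 1) ≤ ψ η} := by
    intro i j hij η hη
    have h1 : 1 / ((j : ℝ) + 1) ≤ 1 / ((i : ℝ) + 1) := by gcongr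
    exact h1.trans hη
  rw [hUe, hmono.measure_iUnion, lt_iSup_iff] at hr
  obtain ⟨j, hj⟩ := hr
  refine ⟨_, ?_, isClosed_le continuous_const hc, hj⟩
  rw [hUe]
  exact subset_iUnion (fun j : ℕ => {η | 1 / ((j : ℝ) + 1) ≤ ψ η}) j

end Regularity

/-! ### Parametrization of finite configurations by arbitrary tuples -/

section Tuples

variable {d : ℕ} {X : Type} {π : X → E d}

/-- The empty configuration. -/
def emptyConfig (π : X → E d) : FinConfig π := ⟨∅, injOn_empty _, finite_empty⟩

open Classical in
/-- The configuration of the points of a tuple, extended by `∅` to all tuples. -/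
def tup (π : X → E d) (n : ℕ) (x : Fin n → X) : FinConfig π :=
  if h : x ∈ offDiag π n then sym π n ⟨x, h⟩ else emptyConfig π

theorem tup_of_mem {n : ℕ} {x : Fin n → X} (h : x ∈ offDiag π n) :
    tup π n x = sym π n ⟨x, h⟩ := dif_pos h

theorem tup_coe {n : ℕ} (x : offDiag π n) : tup π n x.1 = sym π n x := dif_pos x.2

theorem tup_val {n : ℕ} {x : Fin n → X} (h : x ∈ offDiag π n) : (tup π n x).1 = range x := by
  rw [tup_of_mem h]; rfl

theorem card_tup {n : ℕ} {x : Fin n → X} (h : x ∈ offDiag π n) : card π (tup π n x) = n := by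
  rw [tup_of_mem h, card_sym]

theorem exists_tup_eq (η : FinConfig π) : ∃ n, ∃ x ∈ offDiag π n, tup π n x = η := by
  obtain ⟨n, x, rfl⟩ := exists_sym_eq η
  exact ⟨n, x.1, x.2, tup_coe x⟩

theorem tup_comp_perm {n : ℕ} (x : Fin n → X) (e : Equiv.Perm (Fin n)) :
    tup π n (x ∘ e) = tup π n x := by
  have hiff : x ∘ e ∈ offDiag π n ↔ x ∈ offDiag π n :=
    ⟨fun h => by
      have h2 : Function.Injective ((π ∘ (x ∘ e)) ∘ e.symm) := h.comp e.symm.injective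
      have h3 : (π ∘ (x ∘ e)) ∘ e.symm = π ∘ x := by ext1 i; simp
      rwa [h3] at h2, fun h => (h.comp e.injective : _)⟩
  by_cases h : x ∈ offDiag π n
  · rw [tup_of_mem h, tup_of_mem (hiff.2 h)]
    exact sym_permute ⟨x, h⟩ e
  · rw [tup, tup, dif_neg h, dif_neg (mt hiff.1 h)]

theorem exists_mem_finConfigIn_ball (η : FinConfig π) :
    ∃ k : ℕ, η ∈ FinConfigIn π (Metric.ball 0 k) := by
  obtain ⟨r, hr⟩ := (η.2.2.image π).isBounded.subset_ball 0
  obtain ⟨k, hk⟩ := exists_nat_ge r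
  refine ⟨k, fun x hx => ?_⟩
  exact Metric.ball_subset_ball hk (hr (mem_image_of_mem π hx))

theorem finConfigIn_mono {Λ Λ' : Set (E d)} (h : Λ ⊆ Λ') :
    FinConfigIn π Λ ⊆ FinConfigIn π Λ' :=
  fun _ hη => hη.trans (preimage_mono h)

theorem monotone_finConfigIn_ball :
    Monotone fun k : ℕ => FinConfigIn π (Metric.ball 0 k) := fun i j hij =>
  finConfigIn_mono (Metric.ball_subset_ball (by exact_mod_cast hij))

theorem iUnion_finConfigIn_ball : ⋃ k : ℕ, FinConfigIn π (Metric.ball 0 k) = univ :=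
  eq_univ_of_forall fun η => mem_iUnion.2 (exists_mem_finConfigIn_ball η)

variable [TopologicalSpace X] [SecondCountableTopology X] [MeasurableSpace X] [BorelSpace X]

theorem measurable_tup (hπ : Continuous π) (n : ℕ) : Measurable (tup π n) := by
  classical
  exact Measurable.dite (s := offDiag π n) (measurable_sym n)
    (g := fun _ => emptyConfig π) measurable_const (isOpen_offDiag hπ n).measurableSet

theorem measurable_finConfig' (hπ : Continuous π) {Y : Type*} [MeasurableSpace Y]
    {g : FinConfig π → Y} (f : ∀ n, (Fin n → X) → Y) (hf : ∀ n, Measurable (f n))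
    (hg : ∀ n, ∀ x ∈ offDiag π n, g (tup π n x) = f n x) : Measurable g := by
  refine measurable_finConfig hπ fun n => ?_
  have : g ∘ sym π n = f n ∘ Subtype.val := by
    ext1 x
    rw [Function.comp, ← tup_coe, hg n x.1 x.2]
    rfl
  rw [this]
  exact (hf n).comp measurable_subtype_coe

end Tuples

/-- The properties of the position map and of the intensity measure that the general theory
needs. -/
structure Intensity {d : ℕ} {X : Type} [TopologicalSpace X] [MeasurableSpace X] (π : X → E d)
    (σ : Measure X) : Prop where
  cont : Continuous π
  null : ∀ p, σ (π ⁻¹' {p}) = 0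
  fin : ∀ Λ, Bornology.IsBounded Λ → σ (π ⁻¹' Λ) < ∞

/-! ### The Lebesgue–Poisson measure -/

section LebesguePoisson

variable {d : ℕ} {X : Type} {π : X → E d} [TopologicalSpace X] [SecondCountableTopology X]
  [MeasurableSpace X] [BorelSpace X] {σ : Measure X}

theorem Intensity.restrict (hσ : Intensity π σ) (s : Set X) : Intensity π (σ.restrict s) where
  cont := hσ.cont
  null p := le_antisymm ((Measure.restrict_apply_le _ _).trans (hσ.null p).le) zero_le
  fin Λ hΛ := (Measure.restrict_apply_le _ _).trans_lt (hσ.fin Λ hΛ)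

/-- Fubini in the `i`-th coordinate: with the other points fixed, that coordinate would have to lie
in one fibre of `π`, which is `σ`-null. -/
theorem pi_collision_null [SigmaFinite σ] (hσ : Intensity π σ) {n : ℕ} {i j : Fin n}
    (hij : i ≠ j) : Measure.pi (fun _ : Fin n => σ) {x | π (x i) = π (x j)} = 0 := by
  cases n with
  | zero => exact i.elim0
  | succ n =>
    obtain ⟨k, rfl⟩ := Fin.exists_succAbove_eq hij.symm
    have hm : MeasurableSet {q : X × (Fin n → X) | π q.1 = π (q.2 k)} :=
      measurableSet_eq_fun (hσ.cont.measurable.comp measurable_fst)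
        (hσ.cont.measurable.comp ((measurable_pi_apply k).comp measurable_snd))
    have := (measurePreserving_piFinSuccAbove (fun _ : Fin (n + 1) => σ) i).measure_preimage
      hm.nullMeasurableSet
    have h2 : ((σ.prod (Measure.pi fun _ : Fin n => σ))
        {q : X × (Fin n → X) | π q.1 = π (q.2 k)}) = 0 := by
      rw [Measure.prod_apply_symm hm]
      refine (lintegral_congr fun y => ?_).trans lintegral_zero
      exact hσ.null (π (y k))
    rw [h2] at this
    exact this

theorem ae_mem_offDiag [SigmaFinite σ] (hσ : Intensity π σ) (n : ℕ) :
    ∀ᵐ x ∂(Measure.pi fun _ : Fin n => σ), x ∈ offDiag π n := by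
  have : ∀ᵐ x ∂(Measure.pi fun _ : Fin n => σ), ∀ i j : Fin n, i ≠ j → π (x i) ≠ π (x j) := by
    refine ae_all_iff.2 fun i => ae_all_iff.2 fun j => ?_
    by_cases hij : i = j
    · simp [hij]
    · have := pi_collision_null hσ hij
      simp only [ne_eq, hij, not_false_eq_true, forall_const]
      rw [ae_iff]
      simpa using this
  filter_upwards [this] with x hx i j h
  by_contra hij
  exact hx i j hij h

/-- Tuples with coinciding positions are null, so the subtype of off-diagonal tuples can be dropped
and the total map `tup` used from here on. -/
theorem lebesguePoisson_eq [SigmaFinite σ] (hσ : Intensity π σ) :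
    lebesguePoisson π σ = Measure.sum fun n : ℕ => ((n.factorial : ℝ≥0∞)⁻¹) •
      (Measure.pi fun _ : Fin n => σ).map (tup π n) := by
  unfold lebesguePoisson
  congr 1
  ext1 n
  congr 1
  have h1 : sym π n = tup π n ∘ Subtype.val := by
    ext1 x
    exact (tup_coe x).symm
  rw [h1, ← Measure.map_map (measurable_tup hσ.cont n) measurable_subtype_coe,
    map_comap_subtype_coe (isOpen_offDiag hσ.cont n).measurableSet,
    Measure.restrict_eq_self_of_ae_mem (ae_mem_offDiag hσ n)]

theorem lintegral_lebesguePoisson [SigmaFinite σ] (hσ : Intensity π σ)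
    {g : FinConfig π → ℝ≥0∞} (hg : Measurable g) :
    ∫⁻ η, g η ∂(lebesguePoisson π σ) = ∑' n : ℕ, ((n.factorial : ℝ≥0∞)⁻¹) *
      ∫⁻ x, g (tup π n x) ∂(Measure.pi fun _ : Fin n => σ) := by
  rw [lebesguePoisson_eq hσ, lintegral_sum_measure]
  congr 1
  ext1 n
  rw [lintegral_smul_measure, lintegral_map hg (measurable_tup hσ.cont n), smul_eq_mul]

theorem ae_lebesguePoisson [SigmaFinite σ] (hσ : Intensity π σ) {p : FinConfig π → Prop}
    (hp : MeasurableSet {η | p η})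
    (h : ∀ n, ∀ᵐ x ∂(Measure.pi fun _ : Fin n => σ), p (tup π n x)) :
    ∀ᵐ η ∂(lebesguePoisson π σ), p η := by
  rw [lebesguePoisson_eq hσ, Measure.ae_sum_iff]
  intro n
  refine Measure.ae_smul_measure ?_ _
  exact (ae_map_iff (measurable_tup hσ.cont n).aemeasurable hp).2 (h n)

theorem measurableSet_finConfigIn (hπ : Continuous π) {Λ : Set (E d)} (hΛ : IsOpen Λ) :
    MeasurableSet (FinConfigIn π Λ) := (isOpen_finConfigIn hπ hΛ).measurableSet

theorem tup_mem_finConfigIn {n : ℕ} {x : Fin n → X} (h : x ∈ offDiag π n) {Λ : Set (E d)} :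
    tup π n x ∈ FinConfigIn π Λ ↔ x ∈ Set.pi univ fun _ => π ⁻¹' Λ := by
  simp only [FinConfigIn, mem_ofPred_eq, tup_val h, range_subset_iff, Set.mem_pi, mem_univ,
    forall_const]

/-- This turns every integral over `Γ_Λ` into an integral over all of `Γ₀` for another intensity,
which is finite when `Λ` is bounded. -/
theorem lebesguePoisson_restrict [SigmaFinite σ] (hσ : Intensity π σ) {Λ : Set (E d)}
    (hΛ : IsOpen Λ) : (lebesguePoisson π σ).restrict (FinConfigIn π Λ) =
      lebesguePoisson π (σ.restrict (π ⁻¹' Λ)) := by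
  have hm := measurableSet_finConfigIn hσ.cont hΛ
  rw [lebesguePoisson_eq hσ, lebesguePoisson_eq (hσ.restrict _), Measure.restrict_sum _ hm]
  congr 1
  ext1 n
  rw [Measure.restrict_smul, Measure.restrict_map (measurable_tup hσ.cont n) hm]
  congr 2
  rw [← Measure.restrict_pi_pi]
  refine Measure.restrict_congr_set ?_
  filter_upwards [ae_mem_offDiag hσ n] with x hx
  exact propext (tup_mem_finConfigIn hx)

theorem tsum_inv_factorial_mul_pow_ne_top {b : ℝ≥0∞} (hb : b ≠ ∞) :
    ∑' n : ℕ, ((n.factorial : ℝ≥0∞)⁻¹) * b ^ n ≠ ∞ := by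
  have h : ∀ n : ℕ, ((n.factorial : ℝ≥0∞)⁻¹) * b ^ n =
      ENNReal.ofReal (b.toReal ^ n / n.factorial) := by
    intro n
    rw [ENNReal.ofReal_div_of_pos (by positivity), ENNReal.ofReal_pow ENNReal.toReal_nonneg,
      ENNReal.ofReal_toReal hb, ENNReal.ofReal_natCast, ENNReal.div_eq_inv_mul]
  simp_rw [h]
  exact (Real.summable_pow_div_factorial b.toReal).tsum_ofReal_ne_top

/-- The integral is the exponential series of `a * σ univ`. -/
theorem lintegral_pow_card_lt_top [IsFiniteMeasure σ] (hσ : Intensity π σ) {a : ℝ≥0∞}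
    (ha : a ≠ ∞) : ∫⁻ η, a ^ card π η ∂(lebesguePoisson π σ) < ∞ := by
  have hm : Measurable fun η : FinConfig π => a ^ card π η :=
    (measurable_from_top (f := fun n : ℕ => a ^ n)).comp (measurable_card hσ.cont)
  rw [lintegral_lebesguePoisson hσ hm, lt_top_iff_ne_top]
  have h : ∀ n : ℕ, ∫⁻ x, a ^ card π (tup π n x) ∂(Measure.pi fun _ : Fin n => σ) =
      (a * σ univ) ^ n := by
    intro n
    have : ∀ᵐ x ∂(Measure.pi fun _ : Fin n => σ), a ^ card π (tup π n x) = a ^ n := by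
      filter_upwards [ae_mem_offDiag hσ n] with x hx
      rw [card_tup hx]
    rw [lintegral_congr_ae this, lintegral_const, Measure.pi_univ, mul_pow]
    simp
  simp_rw [h]
  exact tsum_inv_factorial_mul_pow_ne_top (ENNReal.mul_ne_top ha (measure_ne_top σ _))

theorem setLIntegral_pow_card_lt_top [SigmaFinite σ] (hσ : Intensity π σ) {Λ : Set (E d)}
    (hΛ : IsOpen Λ) (hb : Bornology.IsBounded Λ) {a : ℝ≥0∞} (ha : a ≠ ∞) :
    ∫⁻ η in FinConfigIn π Λ, a ^ card π η ∂(lebesguePoisson π σ) < ∞ := by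
  rw [lebesguePoisson_restrict hσ hΛ]
  have : IsFiniteMeasure (σ.restrict (π ⁻¹' Λ)) := ⟨by simpa using hσ.fin Λ hb⟩
  exact lintegral_pow_card_lt_top (hσ.restrict _) ha

theorem lebesguePoisson_finConfigIn_lt_top [SigmaFinite σ] (hσ : Intensity π σ) {Λ : Set (E d)}
    (hΛ : IsOpen Λ) (hb : Bornology.IsBounded Λ) :
    lebesguePoisson π σ (FinConfigIn π Λ) < ∞ := by
  simpa using setLIntegral_pow_card_lt_top hσ hΛ hb (a := 1) ENNReal.one_ne_top

theorem sigmaFinite_lebesguePoisson [SigmaFinite σ] (hσ : Intensity π σ) :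
    SigmaFinite (lebesguePoisson π σ) :=
  ⟨⟨⟨fun k => FinConfigIn π (Metric.ball 0 k), fun _ => trivial,
    fun _ => lebesguePoisson_finConfigIn_lt_top hσ Metric.isOpen_ball Metric.isBounded_ball,
    iUnion_finConfigIn_ball⟩⟩⟩

end LebesguePoisson

/-! ### Sums over subconfigurations -/

section SubSum

variable {d : ℕ} {X : Type} {π : X → E d}

/-- The sum of `f` over the finite subconfigurations of a set. -/
def subSum (f : FinConfig π → ℝ≥0∞) (s : Set X) : ℝ≥0∞ :=
  ∑' η : {η : FinConfig π // η.1 ⊆ s}, f η.1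

theorem subSum_eq_indicator (f : FinConfig π → ℝ≥0∞) (s : Set X) :
    subSum f s = ∑' η : FinConfig π, {η : FinConfig π | η.1 ⊆ s}.indicator f η :=
  tsum_subtype {η : FinConfig π | η.1 ⊆ s} f

/-- Subconfigurations of an injective tuple correspond to sets of indices. Listing each index set in
increasing order gives a fixed measurable expression in the tuple. -/
theorem exists_equiv_subconfig {N : ℕ} {x : Fin N → X} (hx : x ∈ offDiag π N) :
    ∃ e : Finset (Fin N) ≃ {η : FinConfig π // η.1 ⊆ range x},
      ∀ S, (e S).1 = tup π S.card (x ∘ S.orderEmbOfFin rfl) := by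
  have hx' : ∀ S : Finset (Fin N), x ∘ S.orderEmbOfFin rfl ∈ offDiag π S.card := fun S =>
    Function.Injective.comp (g := π ∘ x) hx (S.orderEmbOfFin rfl).injective
  have hval : ∀ S : Finset (Fin N), (tup π S.card (x ∘ S.orderEmbOfFin rfl)).1 = x '' S := by
    intro S
    rw [tup_val (hx' S), range_comp, Finset.range_orderEmbOfFin]
  have hinj : Function.Injective x := Function.Injective.of_comp hx
  let F : Finset (Fin N) → {η : FinConfig π // η.1 ⊆ range x} := fun S =>
    ⟨tup π S.card (x ∘ S.orderEmbOfFin rfl), by rw [hval]; exact image_subset_range _ _⟩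
  have hF : Function.Bijective F := by
    constructor
    · intro S T h
      have h1 := congrArg (fun η : {η : FinConfig π // η.1 ⊆ range x} => η.1.1) h
      simp only [F, hval] at h1
      exact Finset.coe_injective (hinj.image_injective h1)
    · rintro ⟨η, hη⟩
      refine ⟨(Set.toFinite (x ⁻¹' η.1)).toFinset, Subtype.ext (Subtype.ext ?_)⟩
      simp only [F, hval]
      rw [Set.Finite.coe_toFinset, image_preimage_eq_of_subset hη]
  exact ⟨Equiv.ofBijective F hF, fun S => rfl⟩

theorem subSum_range {N : ℕ} (f : FinConfig π → ℝ≥0∞) {x : Fin N → X} (hx : x ∈ offDiag π N) :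
    subSum f (range x) =
      ∑ S : Finset (Fin N), f (tup π S.card (x ∘ S.orderEmbOfFin rfl)) := by
  obtain ⟨e, he⟩ := exists_equiv_subconfig hx
  rw [subSum, ← e.tsum_eq, tsum_fintype]
  simp_rw [he]

end SubSum

/-! ### Minlos' identity -/

section Minlos

variable {d : ℕ} {X : Type} {π : X → E d} [TopologicalSpace X] [SecondCountableTopology X]
  [MeasurableSpace X] [BorelSpace X] {σ : Measure X}

theorem measurable_subSum (hπ : Continuous π) {f : FinConfig π → ℝ≥0∞} (hf : Measurable f) :
    Measurable fun ω : FinConfig π => subSum f ω.1 := by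
  refine measurable_finConfig' hπ
    (fun N x => ∑ S : Finset (Fin N), f (tup π S.card (x ∘ S.orderEmbOfFin rfl))) ?_ ?_
  · intro N
    refine Finset.measurable_sum _ fun S _ => (hf.comp (measurable_tup hπ _)).comp ?_
    exact measurable_pi_lambda _ fun i => measurable_pi_apply _
  · intro N x hx
    rw [tup_val hx, subSum_range f hx]

theorem measurePreserving_comp_perm [SigmaFinite σ] {n : ℕ} (e : Equiv.Perm (Fin n)) :
    MeasurePreserving (fun x : Fin n → X => x ∘ e) (Measure.pi fun _ : Fin n => σ)
      (Measure.pi fun _ : Fin n => σ) := by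
  have hm : Measurable fun x : Fin n → X => x ∘ e :=
    measurable_pi_lambda _ fun i => measurable_pi_apply _
  refine ⟨hm, (Measure.pi_eq fun s hs => ?_).symm⟩
  rw [Measure.map_apply hm (MeasurableSet.univ_pi hs)]
  have : (fun x : Fin n → X => x ∘ e) ⁻¹' Set.pi univ s = Set.pi univ fun i => s (e.symm i) := by
    ext x
    simp only [mem_preimage, Set.mem_pi, mem_univ, forall_const, Function.comp]
    exact ⟨fun h i => by simpa using h (e.symm i), fun h i => by simpa using h (e i)⟩
  rw [this, Measure.pi_pi]
  exact Equiv.prod_comp e.symm fun i => σ (s i)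

theorem measurable_append {n m : ℕ} :
    Measurable fun q : (Fin n → X) × (Fin m → X) => Fin.append q.1 q.2 := by
  refine measurable_pi_lambda _ fun i => ?_
  refine Fin.addCases (fun i => ?_) (fun i => ?_) i
  · simp only [Fin.append_left]
    exact (measurable_pi_apply i).comp measurable_fst
  · simp only [Fin.append_right]
    exact (measurable_pi_apply i).comp measurable_snd

theorem measurePreserving_append [SigmaFinite σ] {n m : ℕ} :
    MeasurePreserving (fun q : (Fin n → X) × (Fin m → X) => Fin.append q.1 q.2)
      ((Measure.pi fun _ : Fin n => σ).prod (Measure.pi fun _ : Fin m => σ))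
      (Measure.pi fun _ : Fin (n + m) => σ) := by
  refine ⟨measurable_append, (Measure.pi_eq fun s hs => ?_).symm⟩
  rw [Measure.map_apply measurable_append (MeasurableSet.univ_pi hs)]
  have : (fun q : (Fin n → X) × (Fin m → X) => Fin.append q.1 q.2) ⁻¹' Set.pi univ s =
      (Set.pi univ fun i => s (Fin.castAdd m i)) ×ˢ (Set.pi univ fun i => s (Fin.natAdd n i)) := by
    ext q
    simp only [mem_preimage, Set.mem_pi, mem_univ, forall_const, mem_prod]
    refine ⟨fun h => ⟨fun i => ?_, fun i => ?_⟩, fun h i => ?_⟩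
    · simpa using h (Fin.castAdd m i)
    · simpa using h (Fin.natAdd n i)
    · refine Fin.addCases (fun i => ?_) (fun i => ?_) i
      · simpa using h.1 i
      · simpa using h.2 i
  rw [this, Measure.prod_prod, Measure.pi_pi, Measure.pi_pi, Fin.prod_univ_add]

theorem exists_perm_castAdd {n m : ℕ} {ι : Fin n → Fin (n + m)} (hι : Function.Injective ι) :
    ∃ e : Equiv.Perm (Fin (n + m)), ∀ i, e (Fin.castAdd m i) = ι i := by
  classical
  let e₀ : {x // x ∈ range (Fin.castAdd m : Fin n → Fin (n + m))} ≃ {x // x ∈ range ι} :=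
    (Equiv.ofInjective _ (Fin.castAdd_injective n m)).symm.trans (Equiv.ofInjective ι hι)
  refine ⟨e₀.extendSubtype, fun i => ?_⟩
  rw [Equiv.extendSubtype_apply_of_mem _ _ ⟨i, rfl⟩]
  have : (⟨Fin.castAdd m i, ⟨i, rfl⟩⟩ : {x // x ∈ range (Fin.castAdd m : Fin n → Fin (n + m))}) =
    Equiv.ofInjective _ (Fin.castAdd_injective n m) i := rfl
  rw [this]
  simp [e₀]

/-- Integral of `f` at the first `n` of `n + m` points times `p` at all points. -/
def splitIntegral (π : X → E d) (σ : Measure X) (f p : FinConfig π → ℝ≥0∞) (n m : ℕ) : ℝ≥0∞ :=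
  ∫⁻ z, f (tup π n (z ∘ Fin.castAdd m)) * p (tup π (n + m) z)
    ∂(Measure.pi fun _ : Fin (n + m) => σ)

/-- By exchangeability only the number of selected coordinates matters: a permutation moves them to
the first `n` places. -/
theorem lintegral_comp_injective [SigmaFinite σ] (hπ : Continuous π) {f p : FinConfig π → ℝ≥0∞}
    (hf : Measurable f) (hp : Measurable p) {n m N : ℕ} (hN : N = n + m) {ι : Fin n → Fin N}
    (hι : Function.Injective ι) :
    ∫⁻ z, f (tup π n (z ∘ ι)) * p (tup π N z) ∂(Measure.pi fun _ : Fin N => σ) =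
      splitIntegral π σ f p n m := by
  subst hN
  obtain ⟨e, he⟩ := exists_perm_castAdd hι
  have hm : Measurable fun z : Fin (n + m) → X =>
      f (tup π n (z ∘ Fin.castAdd m)) * p (tup π (n + m) z) := by
    refine ((hf.comp (measurable_tup hπ _)).comp ?_).mul (hp.comp (measurable_tup hπ _))
    exact measurable_pi_lambda _ fun i => measurable_pi_apply _
  rw [splitIntegral, ← (measurePreserving_comp_perm e).lintegral_comp hm]
  refine lintegral_congr fun z => ?_
  rw [tup_comp_perm]
  have : (z ∘ e) ∘ Fin.castAdd m = z ∘ ι := by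
    ext1 i
    simp [he]
  rw [this]

/-- Among `N` points there are `N.choose n` index sets of size `n`, all contributing equally, and
`N.choose n / N! = 1 / (n! (N - n)!)`. Writing `N = n + m` decouples the two sums. -/
theorem lintegral_subSum_mul [SigmaFinite σ] (hσ : Intensity π σ) {f p : FinConfig π → ℝ≥0∞}
    (hf : Measurable f) (hp : Measurable p) :
    ∫⁻ ω, subSum f ω.1 * p ω ∂(lebesguePoisson π σ) =
      ∑' n : ℕ, ∑' m : ℕ, ((n.factorial : ℝ≥0∞)⁻¹) * ((m.factorial : ℝ≥0∞)⁻¹) *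
        splitIntegral π σ f p n m := by
  have hterm : ∀ (N : ℕ) (S : Finset (Fin N)), Measurable fun z : Fin N → X =>
      f (tup π S.card (z ∘ S.orderEmbOfFin rfl)) * p (tup π N z) := by
    intro N S
    refine ((hf.comp (measurable_tup hσ.cont _)).comp ?_).mul (hp.comp (measurable_tup hσ.cont _))
    exact measurable_pi_lambda _ fun i => measurable_pi_apply _
  have hN : ∀ N : ℕ, ((N.factorial : ℝ≥0∞)⁻¹) *
      ∫⁻ z, subSum f (tup π N z).1 * p (tup π N z) ∂(Measure.pi fun _ : Fin N => σ) =
      ∑ q ∈ Finset.HasAntidiagonal.antidiagonal N, ((q.1.factorial : ℝ≥0∞)⁻¹) * ((q.2.factorial : ℝ≥0∞)⁻¹) *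
        splitIntegral π σ f p q.1 q.2 := by
    intro N
    have h1 : ∫⁻ z, subSum f (tup π N z).1 * p (tup π N z) ∂(Measure.pi fun _ : Fin N => σ) =
        ∑ S : Finset (Fin N), splitIntegral π σ f p S.card (N - S.card) := by
      have : ∀ᵐ z ∂(Measure.pi fun _ : Fin N => σ), subSum f (tup π N z).1 * p (tup π N z) =
          ∑ S : Finset (Fin N), f (tup π S.card (z ∘ S.orderEmbOfFin rfl)) * p (tup π N z) := by
        filter_upwards [ae_mem_offDiag hσ N] with z hz
        rw [tup_val hz, subSum_range f hz, Finset.sum_mul]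
      rw [lintegral_congr_ae this, lintegral_finsetSum _ fun S _ => hterm N S]
      refine Finset.sum_congr rfl fun S _ => ?_
      refine lintegral_comp_injective hσ.cont hf hp ?_ (S.orderEmbOfFin rfl).injective
      have := S.card_le_univ
      rw [Fintype.card_fin] at this
      omega
    have h2 := Finset.sum_powerset_apply_card
      (fun n => splitIntegral π σ f p n (N - n)) (x := (Finset.univ : Finset (Fin N)))
    rw [Finset.powerset_univ, Finset.card_univ, Fintype.card_fin] at h2
    rw [h1, h2, Finset.Nat.sum_antidiagonal_eq_sum_range_succ_mk, Finset.mul_sum]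
    refine Finset.sum_congr rfl fun n hn => ?_
    have hnN : n ≤ N := Nat.lt_succ_iff.1 (Finset.mem_range.1 hn)
    have h3 : ((N.factorial : ℝ≥0∞)⁻¹) * (N.choose n : ℝ≥0∞) =
        ((n.factorial : ℝ≥0∞)⁻¹) * (((N - n).factorial : ℝ≥0∞)⁻¹) := by
      have h4 := Nat.choose_mul_factorial_mul_factorial hnN
      have hnt : ∀ k : ℕ, (k : ℝ≥0∞) ≠ ∞ := ENNReal.natCast_ne_top
      have hc : (N.choose n : ℝ≥0∞) ≠ 0 := by exact_mod_cast (Nat.choose_pos hnN).ne'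
      rw [← h4]
      push_cast
      rw [ENNReal.mul_inv (Or.inr (hnt _)) (Or.inl (ENNReal.mul_ne_top (hnt _) (hnt _))),
        ENNReal.mul_inv (Or.inr (hnt _)) (Or.inl (hnt _))]
      calc _ = ((N.choose n : ℝ≥0∞)⁻¹ * N.choose n) *
            (((n.factorial : ℝ≥0∞)⁻¹) * (((N - n).factorial : ℝ≥0∞)⁻¹)) := by ring
        _ = _ := by rw [ENNReal.inv_mul_cancel hc (hnt _), one_mul]
    rw [nsmul_eq_mul, ← mul_assoc, h3]
  have hm : Measurable fun ω : FinConfig π => subSum f ω.1 * p ω :=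
    (measurable_subSum hσ.cont hf).mul hp
  rw [lintegral_lebesguePoisson hσ hm]
  simp_rw [hN]
  rw [← ENNReal.tsum_prod (f := fun n m => ((n.factorial : ℝ≥0∞)⁻¹) *
    ((m.factorial : ℝ≥0∞)⁻¹) * splitIntegral π σ f p n m),
    ← Finset.HasAntidiagonal.sigmaAntidiagonalEquivProd.tsum_eq, ENNReal.tsum_sigma']
  refine tsum_congr fun N => ?_
  rw [← Finset.tsum_subtype]
  rfl

theorem append_mem_offDiag {n m : ℕ} {x : Fin n → X} {y : Fin m → X} :
    Fin.append x y ∈ offDiag π (n + m) ↔ x ∈ offDiag π n ∧ y ∈ offDiag π m ∧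
      ∀ i j, π (x i) ≠ π (y j) := by
  have : π ∘ Fin.append x y = Fin.append (π ∘ x) (π ∘ y) := by
    ext1 i
    refine Fin.addCases (fun i => ?_) (fun i => ?_) i <;> simp
  simp only [offDiag, mem_ofPred_eq, this, Fin.append_injective_iff]
  rfl

theorem range_append {n m : ℕ} (x : Fin n → X) (y : Fin m → X) :
    range (Fin.append x y) = range x ∪ range y := by
  ext a
  simp only [mem_range, mem_union]
  constructor
  · rintro ⟨i, rfl⟩
    refine Fin.addCases (fun i => ?_) (fun i => ?_) i
    · exact Or.inl ⟨i, by simp⟩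
    · exact Or.inr ⟨i, by simp⟩
  · rintro (⟨i, rfl⟩ | ⟨i, rfl⟩)
    · exact ⟨Fin.castAdd m i, by simp⟩
    · exact ⟨Fin.natAdd n i, by simp⟩

theorem evalUnion_tup (p : FinConfig π → ℝ≥0∞) {n m : ℕ} {x : Fin n → X} {y : Fin m → X}
    (h : Fin.append x y ∈ offDiag π (n + m)) :
    evalUnion π p (tup π m y) (tup π n x) = p (tup π (n + m) (Fin.append x y)) := by
  obtain ⟨hx, hy, -⟩ := append_mem_offDiag.1 h
  have hr : (tup π m y).1 ∪ (tup π n x).1 = (tup π (n + m) (Fin.append x y)).1 := by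
    rw [tup_val h, tup_val hx, tup_val hy, range_append, union_comm]
  have hi : InjOn π ((tup π m y).1 ∪ (tup π n x).1) := hr ▸ (tup π (n + m) (Fin.append x y)).2.1
  rw [evalUnion, dif_pos hi]
  congr 1
  exact Subtype.ext hr

theorem ae_append_mem_offDiag [SigmaFinite σ] (hσ : Intensity π σ) {n : ℕ} {x : Fin n → X}
    (hx : x ∈ offDiag π n) (m : ℕ) :
    ∀ᵐ y ∂(Measure.pi fun _ : Fin m => σ), Fin.append x y ∈ offDiag π (n + m) := by
  have : ∀ᵐ y ∂(Measure.pi fun _ : Fin m => σ), ∀ i j, π (x i) ≠ π (y j) := by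
    refine ae_all_iff.2 fun i => ae_all_iff.2 fun j => ?_
    have := Measure.pi_eval_preimage_null (fun _ : Fin m => σ) (i := j) (hσ.null (π (x i)))
    rw [ae_iff]
    convert this using 2
    ext y
    simp [eq_comm]
  filter_upwards [this, ae_mem_offDiag hσ m] with y h1 h2
  exact append_mem_offDiag.2 ⟨hx, h2, h1⟩

theorem measurable_append_left {n m : ℕ} (x : Fin n → X) :
    Measurable fun y : Fin m → X => Fin.append x y :=
  measurable_append.comp (measurable_const.prodMk measurable_id)

/-- For almost every `y` the concatenated tuple is again off-diagonal, and there the union is the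
configuration of that tuple. -/
theorem lintegral_evalUnion [SigmaFinite σ] (hσ : Intensity π σ) {p : FinConfig π → ℝ≥0∞}
    (hp : Measurable p) {n : ℕ} {x : Fin n → X} (hx : x ∈ offDiag π n) :
    ∫⁻ γ, evalUnion π p γ (tup π n x) ∂(lebesguePoisson π σ) =
      ∑' m : ℕ, ((m.factorial : ℝ≥0∞)⁻¹) *
        ∫⁻ y, p (tup π (n + m) (Fin.append x y)) ∂(Measure.pi fun _ : Fin m => σ) := by
  classical
  -- `D` excludes all coincidences of positions with `x`, including shared points, for which
  -- `evalUnion` need not vanish. On `D` the integrand has a measurable formula in tuples, and the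
  -- complement of `D` is null.
  let D : FinConfig π → Prop := fun γ => ∀ a ∈ γ.1, ∀ i, π (x i) ≠ π a
  have hD : ∀ m, ∀ y ∈ offDiag π m,
      D (tup π m y) = (Fin.append x y ∈ offDiag π (n + m)) := by
    intro m y hy
    simp only [D, tup_val hy, forall_mem_range, append_mem_offDiag, hx, hy, true_and]
    exact propext forall_comm
  have hDm : MeasurableSet {γ | D γ} := by
    refine measurableSet_setOfPred.2 (measurable_finConfig' hσ.cont
      (fun m y => Fin.append x y ∈ offDiag π (n + m)) (fun m => ?_) hD)
    exact measurableSet_setOfPred.1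
      ((measurable_append_left x) (isOpen_offDiag hσ.cont (n + m)).measurableSet)
  let g : FinConfig π → ℝ≥0∞ := fun γ => if D γ then evalUnion π p γ (tup π n x) else 0
  have hg : ∀ m, ∀ y ∈ offDiag π m, g (tup π m y) =
      if Fin.append x y ∈ offDiag π (n + m) then p (tup π (n + m) (Fin.append x y)) else 0 := by
    intro m y hy
    simp only [g, hD m y hy]
    split_ifs with h
    · exact evalUnion_tup p h
    · rfl
  have hgm : Measurable g := by
    refine measurable_finConfig' hσ.cont _ (fun m => ?_) hg
    exact Measurable.ite
      ((measurable_append_left x) (isOpen_offDiag hσ.cont (n + m)).measurableSet)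
      ((hp.comp (measurable_tup hσ.cont _)).comp (measurable_append_left x)) measurable_const
  have hae : ∀ᵐ γ ∂(lebesguePoisson π σ), D γ := by
    refine ae_lebesguePoisson hσ hDm fun m => ?_
    filter_upwards [ae_append_mem_offDiag hσ hx m] with y hy
    rw [hD m y (append_mem_offDiag.1 hy).2.1]
    exact hy
  have h1 : ∫⁻ γ, evalUnion π p γ (tup π n x) ∂(lebesguePoisson π σ) =
      ∫⁻ γ, g γ ∂(lebesguePoisson π σ) := by
    refine lintegral_congr_ae ?_
    filter_upwards [hae] with γ hγ
    simp only [g, if_pos hγ]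
  rw [h1, lintegral_lebesguePoisson hσ hgm]
  refine tsum_congr fun m => ?_
  congr 1
  refine lintegral_congr_ae ?_
  filter_upwards [ae_append_mem_offDiag hσ hx m] with y hy
  rw [hg m y (append_mem_offDiag.1 hy).2.1, if_pos hy]

theorem measurable_tup_append (hπ : Continuous π) {p : FinConfig π → ℝ≥0∞} (hp : Measurable p)
    (n m : ℕ) : Measurable fun q : (Fin n → X) × (Fin m → X) =>
      p (tup π (n + m) (Fin.append q.1 q.2)) :=
  (hp.comp (measurable_tup hπ _)).comp measurable_append

theorem measurable_lintegral_evalUnion [SigmaFinite σ] (hσ : Intensity π σ)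
    {p : FinConfig π → ℝ≥0∞} (hp : Measurable p) :
    Measurable fun η => ∫⁻ γ, evalUnion π p γ η ∂(lebesguePoisson π σ) := by
  refine measurable_finConfig' hσ.cont _ (fun n => ?_) fun n x hx => lintegral_evalUnion hσ hp hx
  exact Measurable.tsum fun m =>
    (measurable_tup_append hσ.cont hp n m).lintegral_prod_right'.const_mul _

/-- Minlos' identity. -/
theorem lintegral_subSum_mul_eq [SigmaFinite σ] (hσ : Intensity π σ) {f p : FinConfig π → ℝ≥0∞}
    (hf : Measurable f) (hp : Measurable p) :
    ∫⁻ ω, subSum f ω.1 * p ω ∂(lebesguePoisson π σ) =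
      ∫⁻ η, f η * (∫⁻ γ, evalUnion π p γ η ∂(lebesguePoisson π σ)) ∂(lebesguePoisson π σ) := by
  rw [lintegral_subSum_mul hσ hf hp,
    lintegral_lebesguePoisson hσ (g := fun η => f η * _)
      (hf.mul (measurable_lintegral_evalUnion hσ hp))]
  refine tsum_congr fun n => ?_
  have h1 : ∫⁻ x, f (tup π n x) * (∫⁻ γ, evalUnion π p γ (tup π n x) ∂(lebesguePoisson π σ))
      ∂(Measure.pi fun _ : Fin n => σ) = ∫⁻ x, ∑' m : ℕ, ((m.factorial : ℝ≥0∞)⁻¹) *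
        ∫⁻ y, f (tup π n x) * p (tup π (n + m) (Fin.append x y))
          ∂(Measure.pi fun _ : Fin m => σ) ∂(Measure.pi fun _ : Fin n => σ) := by
    refine lintegral_congr_ae ?_
    filter_upwards [ae_mem_offDiag hσ n] with x hx
    rw [lintegral_evalUnion hσ hp hx, ← ENNReal.tsum_mul_left]
    refine tsum_congr fun m => ?_
    rw [lintegral_const_mul (f := fun y => p (tup π (n + m) (Fin.append x y))) _
      ((hp.comp (measurable_tup hσ.cont _)).comp (measurable_append_left x))]
    exact mul_left_comm _ _ _
  have hm : ∀ m, Measurable fun q : (Fin n → X) × (Fin m → X) =>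
      f (tup π n q.1) * p (tup π (n + m) (Fin.append q.1 q.2)) := fun m =>
    ((hf.comp (measurable_tup hσ.cont _)).comp measurable_fst).mul
      (measurable_tup_append hσ.cont hp n m)
  rw [h1, lintegral_tsum fun m => ((hm m).lintegral_prod_right'.const_mul _).aemeasurable,
    ← ENNReal.tsum_mul_left]
  refine tsum_congr fun m => ?_
  rw [lintegral_const_mul _ (hm m).lintegral_prod_right', mul_assoc]
  congr 2
  have hm' : Measurable fun z : Fin (n + m) → X =>
      f (tup π n (z ∘ Fin.castAdd m)) * p (tup π (n + m) z) := by
    refine ((hf.comp (measurable_tup hσ.cont _)).comp ?_).mul (hp.comp (measurable_tup hσ.cont _))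
    exact measurable_pi_lambda _ fun i => measurable_pi_apply _
  rw [splitIntegral, ← measurePreserving_append.lintegral_comp hm', lintegral_prod]
  · refine lintegral_congr fun x => lintegral_congr fun y => ?_
    have : Fin.append x y ∘ Fin.castAdd m = x := by
      ext1 i
      simp
    rw [this]
  · exact (hm'.comp measurable_append).aemeasurable

end Minlos

/-! ### Pairings of configurations with functions -/

section Pairing

variable {d : ℕ} {X : Type} {π : X → E d}

theorem pairing_eq_indicator (f : X → ℝ) (γ : Config π) :
    pairing π f γ = ∑' x, γ.1.indicator f x := tsum_subtype γ.1 f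

theorem summable_indicator_config {f : X → ℝ} {L : Set (E d)} (hL : IsCompact L)
    (hf : ∀ x, f x ≠ 0 → π x ∈ L) (γ : Config π) : Summable (γ.1.indicator f) := by
  refine summable_of_hasFiniteSupport ((γ.2.2 L hL).subset fun x hx => ?_)
  rw [Function.mem_support, indicator_apply_ne_zero] at hx
  exact ⟨hx.1, hf x hx.2⟩

theorem sum_le_pairing {f : X → ℝ} {L : Set (E d)} (hL : IsCompact L)
    (hf : ∀ x, f x ≠ 0 → π x ∈ L) (hf0 : ∀ x, 0 ≤ f x) (γ : Config π) (s : Finset X)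
    (hs : (s : Set X) ⊆ γ.1) : ∑ x ∈ s, f x ≤ pairing π f γ := by
  rw [pairing_eq_indicator]
  have h1 : ∑ x ∈ s, f x = ∑ x ∈ s, γ.1.indicator f x :=
    Finset.sum_congr rfl fun x hx => (indicator_of_mem (hs hx) f).symm
  rw [h1]
  exact (summable_indicator_config hL hf γ).sum_le_tsum s fun x _ =>
    indicator_nonneg (fun x _ => hf0 x) x

theorem pairing_eq_sum {f : X → ℝ} (γ : Config π) (s : Finset X) (hs : (s : Set X) ⊆ γ.1)
    (h0 : ∀ x ∈ γ.1, x ∉ s → f x = 0) : pairing π f γ = ∑ x ∈ s, f x := by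
  rw [pairing_eq_indicator, tsum_eq_sum (s := s)]
  · exact Finset.sum_congr rfl fun x hx => indicator_of_mem (hs hx) f
  · intro x hx
    by_cases hxγ : x ∈ γ.1
    · rw [indicator_of_mem hxγ, h0 x hxγ hx]
    · exact indicator_of_notMem hxγ f

theorem exists_pos_of_pairing_pos {f : X → ℝ} {γ : Config π} (h : 0 < pairing π f γ) :
    ∃ x ∈ γ.1, f x ≠ 0 := by
  by_contra! hc
  rw [pairing_eq_sum γ ∅ (by simp) fun x hx _ => hc x hx] at h
  simp at h

variable [TopologicalSpace X]

theorem continuous_pairing (f : X →ᵇ ℝ) {L : Set (E d)} (hL : IsCompact L)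
    (hf : ∀ x, f x ≠ 0 → π x ∈ L) : Continuous (pairing π f) :=
  continuous_iInf_dom (i := ⟨f, L, hL, hf⟩) continuous_induced_dom

end Pairing

/-! ### The topology of `Γ` and continuity of restriction to balls -/

section ConfigTopology

variable {d : ℕ} {X : Type} {π : X → E d} [MetricSpace X]

/-- The configurations that have a point in a given open set form an open set. -/
theorem isOpen_hits (hπ : Continuous π) {B : Set X} (hB : IsOpen B) :
    IsOpen {γ : Config π | ∃ x ∈ γ.1, x ∈ B} := by
  rw [isOpen_iff_mem_nhds]
  rintro γ ⟨x, hxγ, hxB⟩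
  obtain ⟨ε, hε, hball⟩ := Metric.isOpen_iff.1 hB x hxB
  -- The first term confines the support to the ball inside `B`. The second bounds the support in
  -- space, as required of a test function.
  let g : X →ᵇ ℝ := BoundedContinuousFunction.ofNormedAddCommGroup
    (fun y => max 0 (min (ε - dist y x) (1 - dist (π y) (π x)))) (by fun_prop) ε (by
      intro y
      rw [Real.norm_eq_abs, abs_of_nonneg (le_max_left _ _)]
      exact max_le hε.le ((min_le_left _ _).trans (by linarith [dist_nonneg (x := y) (y := x)])))
  have hg : ∀ y, g y = max 0 (min (ε - dist y x) (1 - dist (π y) (π x))) := fun y => rfl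
  have hne : ∀ y, g y ≠ 0 → dist y x < ε ∧ dist (π y) (π x) < 1 := by
    intro y hy
    rw [hg] at hy
    have : 0 < min (ε - dist y x) (1 - dist (π y) (π x)) := by
      by_contra h
      exact hy (max_eq_left (not_lt.1 h))
    obtain ⟨h1, h2⟩ := lt_min_iff.1 this
    exact ⟨by linarith, by linarith⟩
  have hL : ∀ y, g y ≠ 0 → π y ∈ Metric.closedBall (π x) 1 := fun y hy => (hne y hy).2.le
  have hLc := isCompact_closedBall (π x) 1
  have hpos : 0 < pairing π g γ := by
    have h1 := sum_le_pairing hLc hL (fun y => le_max_left _ _) γ {x} (by simpa using hxγ)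
    rw [Finset.sum_singleton, hg] at h1
    refine lt_of_lt_of_le ?_ h1
    simp [hε]
  refine mem_of_superset ((isOpen_lt continuous_const (continuous_pairing g hLc hL)).mem_nhds
    hpos) ?_
  intro γ' hγ'
  obtain ⟨y, hy, hgy⟩ := exists_pos_of_pairing_pos hγ'
  exact ⟨y, hy, hball (hne y hgy).1⟩

theorem isOpen_exists_tuple (hπ : Continuous π) {n : ℕ} {W : Set (Fin n → X)} (hW : IsOpen W) :
    IsOpen {γ : Config π | ∃ x ∈ W, ∀ i, x i ∈ γ.1} := by
  rw [isOpen_iff_mem_nhds]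
  rintro γ ⟨x, hxW, hxγ⟩
  obtain ⟨u, hu, hsub⟩ := isOpen_pi_iff'.1 hW x hxW
  have : ∀ i, {γ : Config π | ∃ y ∈ γ.1, y ∈ u i} ∈ 𝓝 γ := fun i =>
    (isOpen_hits hπ (hu i).1).mem_nhds ⟨x i, hxγ i, (hu i).2⟩
  filter_upwards [iInter_mem.2 this] with γ' hγ'
  choose y hy hyu using mem_iInter.1 hγ'
  exact ⟨y, hsub fun i _ => hyu i, hy⟩

/-- The configurations that have a subconfiguration of `n` points in `U`, with positions
in `Λ`. -/
def hasSub (π : X → E d) (Λ : Set (E d)) (U : Set (FinConfig π)) (n : ℕ) : Set (Config π) :=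
  {γ | ∃ x : offDiag π n, sym π n x ∈ U ∧ ∀ i, x.1 i ∈ γ.1 ∩ π ⁻¹' Λ}

theorem isOpen_hasSub (hπ : Continuous π) {Λ : Set (E d)} (hΛ : IsOpen Λ)
    {U : Set (FinConfig π)} (hU : IsOpen U) (n : ℕ) : IsOpen (hasSub π Λ U n) := by
  have hW : IsOpen (Subtype.val '' (sym π n ⁻¹' (U ∩ FinConfigIn π Λ))) :=
    (isOpen_offDiag hπ n).isOpenMap_subtype_val _
      (isOpen_finConfig_iff.1 (hU.inter (isOpen_finConfigIn hπ hΛ)) n)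
  convert isOpen_exists_tuple hπ hW using 1
  ext γ
  constructor
  · rintro ⟨x, hx, hxγ⟩
    exact ⟨x.1, ⟨x, ⟨hx, range_subset_iff.2 fun i => (hxγ i).2⟩, rfl⟩, fun i => (hxγ i).1⟩
  · rintro ⟨_, ⟨x, ⟨hx, hx'⟩, rfl⟩, hxγ⟩
    exact ⟨x, hx, fun i => ⟨hxγ i, range_subset_iff.1 hx' i⟩⟩

/-- A further point of `γ` in `Λ` could be appended to `x`, giving `n + 1` points with distinct
positions. -/
theorem localConfig_eq_sym {Λ : Set (E d)} {hΛ : Bornology.IsBounded Λ} {γ : Config π} {n : ℕ}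
    {x : offDiag π n} (hx : ∀ i, x.1 i ∈ γ.1 ∩ π ⁻¹' Λ) (h : γ ∉ hasSub π Λ univ (n + 1)) :
    localConfig π Λ hΛ γ = sym π n x := by
  refine Subtype.ext (Subset.antisymm (fun y hy => ?_) (range_subset_iff.2 hx))
  by_contra hyx
  refine h ⟨⟨Fin.snoc x.1 y, ?_⟩, mem_univ _, ?_⟩
  · have : π ∘ (Fin.snoc x.1 y : Fin (n + 1) → X) = Fin.snoc (π ∘ x.1) (π y) := by
      ext1 i
      refine Fin.lastCases ?_ (fun i => ?_) i <;> simp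
    simp only [offDiag, mem_ofPred_eq, this]
    refine Fin.snoc_injective_iff.2 ⟨x.2, ?_⟩
    rintro ⟨i, hi⟩
    exact hyx ⟨i, γ.2.1 (hx i).1 hy.1 hi⟩
  · intro i
    refine Fin.lastCases ?_ (fun i => ?_) i
    · have hy' : y ∈ γ.1 ∩ π ⁻¹' Λ := hy
      simpa using hy'
    · simpa using hx i

theorem notMem_hasSub_succ {Λ : Set (E d)} {hΛ : Bornology.IsBounded Λ} {γ : Config π} {n : ℕ}
    {x : offDiag π n} (hx : sym π n x = localConfig π Λ hΛ γ) :
    γ ∉ hasSub π Λ univ (n + 1) := by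
  rintro ⟨y, -, hy⟩
  have h1 : range y.1 ⊆ range x.1 := by
    have : range x.1 = γ.1 ∩ π ⁻¹' Λ := congrArg Subtype.val hx
    rw [this]
    exact range_subset_iff.2 hy
  have h2 := Set.ncard_le_ncard h1 (finite_range _)
  have h3 := card_sym x
  have h4 := card_sym y
  simp only [card, sym] at h3 h4
  omega

/-- Restriction to `Λ` is not continuous, since points can cross the boundary. But "having `n`
points in `Λ` that form an element of `U`" and "having `n + 1` points in `Λ`" are open conditions,
and their differences describe the preimage of `U`. -/
theorem measurable_localConfig (hπ : Continuous π) {Λ : Set (E d)} (hΛ : IsOpen Λ)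
    (hb : Bornology.IsBounded Λ) : Measurable (localConfig π Λ hb) := by
  refine measurable_of_isOpen fun U hU => ?_
  have : localConfig π Λ hb ⁻¹' U = ⋃ n, hasSub π Λ U n \ hasSub π Λ univ (n + 1) := by
    ext γ
    simp only [mem_preimage, mem_iUnion, Set.mem_sdiff]
    constructor
    · intro h
      obtain ⟨n, x, hx⟩ := exists_sym_eq (localConfig π Λ hb γ)
      refine ⟨n, ⟨x, hx ▸ h, ?_⟩, notMem_hasSub_succ hx⟩
      exact range_subset_iff.1 (congrArg Subtype.val hx).subset
    · rintro ⟨n, ⟨x, hxU, hx⟩, h⟩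
      rwa [localConfig_eq_sym hx h]
  rw [this]
  exact MeasurableSet.iUnion fun n => (isOpen_hasSub hπ hΛ hU n).measurableSet.diff
    (isOpen_hasSub hπ hΛ isOpen_univ _).measurableSet

/-- Only finitely many norms of positions occur up to `k + 1`, so those different from `k` keep a
positive distance from `k`. -/
theorem exists_gt_disjoint_annulus (γ : Config π) (k : ℝ) :
    ∃ r > k, ∀ x ∈ γ.1, ‖π x‖ ≤ r → ‖π x‖ ≤ k := by
  have hfin : ((fun x => ‖π x‖) '' (γ.1 ∩ π ⁻¹' Metric.closedBall 0 (k + 1))).Finite :=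
    (γ.2.2 _ (isCompact_closedBall _ _)).image _
  have hopen : IsOpen (((fun x => ‖π x‖) '' (γ.1 ∩ π ⁻¹' Metric.closedBall 0 (k + 1))) \ {k})ᶜ :=
    (hfin.subset sdiff_subset).isClosed.isOpen_compl
  obtain ⟨ε, hε, hball⟩ := Metric.isOpen_iff.1 hopen k (by simp)
  refine ⟨k + min (ε / 2) 1, by simp [hε], fun x hx hxr => ?_⟩
  by_contra! hlt
  have h1 : ‖π x‖ ≤ k + 1 := hxr.trans (by gcongr; exact min_le_right _ _)
  have h2 : ‖π x‖ ≤ k + ε / 2 := hxr.trans (by gcongr; exact min_le_left _ _)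
  refine hball (a := ‖π x‖) ?_ ⟨⟨x, ⟨hx, by simpa using h1⟩, rfl⟩, hlt.ne'⟩
  rw [Metric.mem_ball, Real.dist_eq, abs_of_pos (by linarith)]
  linarith

/-- The radius `r` lies in the interior of an annulus free of points of `γ`, so no point sits near
the boundary of the ball. The radius depends on `γ`, which is why only pointwise continuity is
claimed. -/
theorem exists_continuousAt_localConfig (hπ : Continuous π) (γ : Config π) (k : ℝ) :
    ∃ r > k, ContinuousAt (localConfig π (Metric.ball 0 r) Metric.isBounded_ball) γ := by
  obtain ⟨r', hr', hγ⟩ := exists_gt_disjoint_annulus γ k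
  set r := (k + r') / 2 with hr
  have hkr : k < r := by linarith
  have hrr' : r < r' := by linarith
  refine ⟨r, hkr, ?_⟩
  obtain ⟨n, x, hx⟩ := exists_sym_eq (localConfig π (Metric.ball 0 r) Metric.isBounded_ball γ)
  have hxr : range x.1 = γ.1 ∩ π ⁻¹' Metric.ball 0 r := congrArg Subtype.val hx
  let χ : X →ᵇ ℝ := BoundedContinuousFunction.ofNormedAddCommGroup
    (fun y => max 0 (min 1 ((r' - ‖π y‖) / (r' - r)))) (by fun_prop) 1 (by
      intro y
      rw [Real.norm_eq_abs, abs_of_nonneg (le_max_left _ _)]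
      exact max_le zero_le_one (min_le_left _ _))
  have hχ : ∀ y, χ y = max 0 (min 1 ((r' - ‖π y‖) / (r' - r))) := fun y => rfl
  have hχ1 : ∀ y, ‖π y‖ < r → χ y = 1 := by
    intro y hy
    rw [hχ, min_eq_left, max_eq_right zero_le_one]
    rw [le_div_iff₀ (by linarith)]
    linarith
  have hχ0 : ∀ y, r' ≤ ‖π y‖ → χ y = 0 := by
    intro y hy
    rw [hχ, max_eq_left]
    exact (min_le_right _ _).trans (div_nonpos_of_nonpos_of_nonneg (by linarith) (by linarith))
  have hL : ∀ y, χ y ≠ 0 → π y ∈ Metric.closedBall 0 r' := by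
    intro y hy
    by_contra h
    exact hy (hχ0 y (by simpa using (not_le.1 (by simpa using h)).le))
  have hLc := isCompact_closedBall (0 : E d) r'
  classical
  have hcard : ∀ {m : ℕ} (y : offDiag π m), (∀ i, ‖π (y.1 i)‖ < r) →
      ∑ z ∈ Finset.univ.image y.1, χ z = m := by
    intro m y hy
    rw [Finset.sum_image fun i _ j _ h => offDiag.injective y h,
      Finset.sum_congr rfl fun i _ => hχ1 _ (hy i)]
    simp
  have hsum : pairing π χ γ = n := by
    have hxin : ∀ i, x.1 i ∈ γ.1 ∩ π ⁻¹' Metric.ball 0 r := fun i => hxr ▸ mem_range_self i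
    rw [← hcard x fun i => by simpa using (hxin i).2]
    refine pairing_eq_sum γ _ ?_ ?_
    · simpa [range_subset_iff] using fun i => (hxin i).1
    · intro z hz hzx
      by_contra hne
      have h1 : ‖π z‖ ≤ k := hγ z hz (by simpa using hL z hne)
      have : z ∈ range x.1 := hxr ▸ ⟨hz, by simpa using h1.trans_lt hkr⟩
      exact hzx (by simpa using this)
  rw [ContinuousAt, tendsto_def]
  intro U hU
  obtain ⟨V, hVU, hV, hγV⟩ := mem_nhds_iff.1 hU
  have h1 : hasSub π (Metric.ball 0 r) V n ∈ 𝓝 γ := by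
    refine (isOpen_hasSub hπ Metric.isOpen_ball hV n).mem_nhds ⟨x, hx ▸ hγV, ?_⟩
    exact fun i => hxr ▸ mem_range_self i
  -- The cutoff `χ` lies strictly between `0` and `1` only in the empty annulus, so its pairing with
  -- `γ` counts exactly the `n` points in the ball. A configuration with `n + 1` points in the ball
  -- has pairing at least `n + 1`.
  have h2 : {γ' : Config π | pairing π χ γ' < n + 1} ∈ 𝓝 γ := by
    refine (isOpen_lt (continuous_pairing χ hLc hL) continuous_const).mem_nhds ?_
    simp [hsum]
  filter_upwards [h1, h2] with γ' hγ1 hγ2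
  obtain ⟨y, hyV, hy⟩ := hγ1
  have h3 : γ' ∉ hasSub π (Metric.ball 0 r) univ (n + 1) := by
    rintro ⟨z, -, hz⟩
    have h4 := sum_le_pairing hLc hL (fun y => le_max_left _ _) γ' (Finset.univ.image z.1)
      (by simpa [range_subset_iff] using fun i => (hz i).1)
    rw [hcard z fun i => by simpa using (hz i).2] at h4
    push_cast at h4
    exact absurd hγ2 (not_lt.2 h4)
  rw [mem_preimage, localConfig_eq_sym hy h3]
  exact hVU hyV

end ConfigTopology

/-! ### The correlation measure and its density -/

section CorrelationMeasure

variable {d : ℕ} {X : Type} {π : X → E d} [MetricSpace X] [SecondCountableTopology X]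
  [MeasurableSpace X] [BorelSpace X] {σ : Measure X}

/-- Localization: testing only subconfigurations in `Λ` involves only `γ ∩ Λ`, which is finite. -/
theorem subSum_indicator_finConfigIn (f : FinConfig π → ℝ≥0∞) {Λ : Set (E d)}
    (hb : Bornology.IsBounded Λ) (γ : Config π) :
    subSum ((FinConfigIn π Λ).indicator f) γ.1 = subSum f (localConfig π Λ hb γ).1 := by
  rw [subSum_eq_indicator, subSum_eq_indicator]
  refine tsum_congr fun η => ?_
  rw [indicator_indicator]
  congr 1
  ext η'
  exact subset_inter_iff.symm

/-- The counting measure on the finite subconfigurations of `γ`. -/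
def subCount (γ : Config π) : Measure (FinConfig π) :=
  Measure.sum fun η : {η : FinConfig π // η.1 ⊆ γ.1} => Measure.dirac η.1

theorem lintegral_subCount (γ : Config π) {f : FinConfig π → ℝ≥0∞} (hf : Measurable f) :
    ∫⁻ η, f η ∂(subCount γ) = subSum f γ.1 := by
  rw [subCount, lintegral_sum_measure, subSum]
  exact tsum_congr fun η => lintegral_dirac' _ hf

theorem measurable_subSum_config (hπ : Continuous π) {f : FinConfig π → ℝ≥0∞}
    (hf : Measurable f) : Measurable fun γ : Config π => subSum f γ.1 := by
  have hm : ∀ k : ℕ, MeasurableSet (FinConfigIn π (Metric.ball 0 k)) := fun k =>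
    measurableSet_finConfigIn hπ Metric.isOpen_ball
  have h1 : ∀ γ : Config π, subSum f γ.1 =
      ⨆ k : ℕ, subSum f (localConfig π (Metric.ball 0 k) Metric.isBounded_ball γ).1 := by
    intro γ
    simp_rw [← subSum_indicator_finConfigIn, ← lintegral_subCount γ hf,
      ← lintegral_subCount γ (hf.indicator (hm _)), lintegral_indicator (hm _)]
    rw [← setLIntegral_iUnion_of_directed _ (monotone_finConfigIn_ball.directed_le),
      iUnion_finConfigIn_ball, setLIntegral_univ]
  simp_rw [h1]
  exact Measurable.iSup fun k => (measurable_subSum hπ hf).comp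
    (measurable_localConfig hπ Metric.isOpen_ball Metric.isBounded_ball)

theorem measurable_subCount (hπ : Continuous π) : Measurable (subCount (π := π)) := by
  refine Measure.measurable_of_measurable_coe _ fun s hs => ?_
  have : (fun γ : Config π => subCount γ s) =
      fun γ => subSum (s.indicator fun _ => (1 : ℝ≥0∞)) γ.1 := by
    ext1 γ
    rw [← lintegral_subCount γ (measurable_const.indicator hs), lintegral_indicator hs]
    simp
  rw [this]
  exact measurable_subSum_config hπ (measurable_const.indicator hs)

/-- The correlation measure of `μ`. -/
def corrMeasure (μ : Measure (Config π)) : Measure (FinConfig π) := μ.bind subCount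

theorem lintegral_corrMeasure (hπ : Continuous π) (μ : Measure (Config π))
    {f : FinConfig π → ℝ≥0∞} (hf : Measurable f) :
    ∫⁻ η, f η ∂(corrMeasure μ) = ∫⁻ γ, subSum f γ.1 ∂μ := by
  rw [corrMeasure, Measure.lintegral_bind (measurable_subCount hπ).aemeasurable hf.aemeasurable]
  exact lintegral_congr fun γ => lintegral_subCount γ hf

/-- The finite configuration `γ ∩ Λ` is a subconfiguration of `γ`. If it lies in `A`, it contributes
at least `1` to the count of subconfigurations in `A ∩ Γ_Λ`, so that event is null when the
correlation measure of `A ∩ Γ_Λ` vanishes. -/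
theorem locallyAC_of_corrMeasure (hπ : Continuous π) {μ : Measure (Config π)}
    (h : corrMeasure μ ≪ lebesguePoisson π σ) : LocallyAC π σ μ := by
  intro Λ hΛ hΛo
  refine Measure.AbsolutelyContinuous.mk fun A hA hA0 => ?_
  have hm := measurableSet_finConfigIn hπ hΛo
  rw [Measure.restrict_apply hA] at hA0
  have h1 := h hA0
  have hA' := hA.inter hm
  rw [← lintegral_indicator_one hA', lintegral_corrMeasure hπ μ (measurable_one.indicator hA'),
    lintegral_eq_zero_iff (measurable_subSum_config hπ (measurable_one.indicator hA'))] at h1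
  rw [localLaw, Measure.map_apply (measurable_localConfig hπ hΛo hΛ) hA]
  refine measure_mono_null (fun γ hγ => ?_) (ae_iff.1 h1)
  simp only [mem_preimage] at hγ
  simp only [Pi.zero_apply, mem_ofPred_eq]
  refine (lt_of_lt_of_le zero_lt_one ?_).ne'
  let η : {η : FinConfig π // η.1 ⊆ γ.1} := ⟨localConfig π Λ hΛ γ, inter_subset_left⟩
  refine le_trans (le_of_eq ?_) (ENNReal.le_tsum η)
  have hmem : η.1 ∈ A ∩ FinConfigIn π Λ :=
    ⟨hγ, (inter_subset_right : γ.1 ∩ π ⁻¹' Λ ⊆ π ⁻¹' Λ)⟩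
  rw [indicator_of_mem hmem]
  rfl

theorem measurable_correlationOn [SigmaFinite σ] (hσ : Intensity π σ) (μ : Measure (Config π))
    {Λ : Set (E d)} (hΛ : Bornology.IsBounded Λ) (hΛo : IsOpen Λ) :
    Measurable (correlationOn π σ μ Λ hΛ) := by
  unfold correlationOn
  rw [lebesguePoisson_restrict hσ hΛo]
  exact measurable_lintegral_evalUnion (hσ.restrict _) (Measure.measurable_rnDeriv _ _)

theorem localLaw_eq_withDensity [SigmaFinite σ] (hσ : Intensity π σ) {μ : Measure (Config π)}
    [IsFiniteMeasure μ] (hμ : LocallyAC π σ μ) {Λ : Set (E d)} (hΛ : Bornology.IsBounded Λ)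
    (hΛo : IsOpen Λ) : localLaw π μ Λ hΛ =
      ((lebesguePoisson π σ).restrict (FinConfigIn π Λ)).withDensity
        (localDensity π σ μ Λ hΛ) := by
  have := sigmaFinite_lebesguePoisson hσ
  have : IsFiniteMeasure (localLaw π μ Λ hΛ) := by unfold localLaw; infer_instance
  exact (Measure.withDensity_rnDeriv_eq _ _ (hμ Λ hΛ hΛo)).symm

/-- Localization turns the left side into an integral over the law of `γ ∩ Λ`. Minlos' identity for
the intensity restricted to `Λ` then moves the sum over subconfigurations onto the density. -/
theorem setLIntegral_corrMeasure [SigmaFinite σ] (hσ : Intensity π σ) {μ : Measure (Config π)}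
    [IsFiniteMeasure μ] (hμ : LocallyAC π σ μ) {Λ : Set (E d)} (hΛ : Bornology.IsBounded Λ)
    (hΛo : IsOpen Λ) {f : FinConfig π → ℝ≥0∞} (hf : Measurable f) :
    ∫⁻ η in FinConfigIn π Λ, f η ∂(corrMeasure μ) =
      ∫⁻ η in FinConfigIn π Λ, f η * correlationOn π σ μ Λ hΛ η ∂(lebesguePoisson π σ) := by
  have hm := measurableSet_finConfigIn hσ.cont hΛo
  have hdm : Measurable (localDensity π σ μ Λ hΛ) := Measure.measurable_rnDeriv _ _
  have hs : Measurable fun ω : FinConfig π => subSum f ω.1 := measurable_subSum hσ.cont hf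
  rw [← lintegral_indicator hm, lintegral_corrMeasure hσ.cont μ (hf.indicator hm)]
  simp_rw [subSum_indicator_finConfigIn f hΛ]
  rw [← lintegral_map hs (measurable_localConfig hσ.cont hΛo hΛ)]
  change ∫⁻ ω, subSum f ω.1 ∂(localLaw π μ Λ hΛ) = _
  rw [localLaw_eq_withDensity hσ hμ hΛ hΛo, lintegral_withDensity_eq_lintegral_mul _ hdm hs]
  simp only [Pi.mul_apply, mul_comm (localDensity π σ μ Λ hΛ _)]
  unfold correlationOn
  rw [lebesguePoisson_restrict hσ hΛo, lintegral_subSum_mul_eq (hσ.restrict _) hf hdm]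

theorem corrMeasure_restrict [SigmaFinite σ] (hσ : Intensity π σ) {μ : Measure (Config π)}
    [IsFiniteMeasure μ] (hμ : LocallyAC π σ μ) {Λ : Set (E d)} (hΛ : Bornology.IsBounded Λ)
    (hΛo : IsOpen Λ) : (corrMeasure μ).restrict (FinConfigIn π Λ) =
      ((lebesguePoisson π σ).restrict (FinConfigIn π Λ)).withDensity
        (correlationOn π σ μ Λ hΛ) := by
  ext A hA
  have h := setLIntegral_corrMeasure hσ hμ hΛ hΛo (measurable_one.indicator hA)
  rw [lintegral_indicator_one hA] at h
  rw [h, withDensity_apply _ hA, ← lintegral_indicator hA]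
  refine lintegral_congr fun η => ?_
  by_cases hη : η ∈ A <;> simp [hη]

/-- Both functions are densities of the same measure `corrMeasure μ` on the intersection of the two
domains, and the correlation measure does not refer to `Λ`. -/
theorem correlationOn_ae_eq [SigmaFinite σ] (hσ : Intensity π σ) {μ : Measure (Config π)}
    [IsFiniteMeasure μ] (hμ : LocallyAC π σ μ) {Λ Λ' : Set (E d)} (hΛ : Bornology.IsBounded Λ)
    (hΛo : IsOpen Λ) (hΛ' : Bornology.IsBounded Λ') (hΛo' : IsOpen Λ') :
    ∀ᵐ η ∂(lebesguePoisson π σ), η ∈ FinConfigIn π Λ ∩ FinConfigIn π Λ' →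
      correlationOn π σ μ Λ hΛ η = correlationOn π σ μ Λ' hΛ' η := by
  have := sigmaFinite_lebesguePoisson hσ
  have hm := measurableSet_finConfigIn hσ.cont hΛo
  have hm' := measurableSet_finConfigIn hσ.cont hΛo'
  rw [← ae_restrict_iff' (hm.inter hm')]
  refine ae_eq_of_forall_setLIntegral_eq_of_sigmaFinite
    (measurable_correlationOn hσ μ hΛ hΛo) (measurable_correlationOn hσ μ hΛ' hΛo') ?_
  intro A hA _
  have key : ∀ {L : Set (E d)} (hL : Bornology.IsBounded L) (_ : IsOpen L) {M : Set (FinConfig π)},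
      MeasurableSet M → M ⊆ FinConfigIn π L →
      ∫⁻ η in A, correlationOn π σ μ L hL η ∂((lebesguePoisson π σ).restrict M) =
        corrMeasure μ (A ∩ M) := by
    intro L hL hLo M hM hML
    have h := corrMeasure_restrict hσ hμ hL hLo
    have h2 := DFunLike.congr_fun h (A ∩ M)
    rw [Measure.restrict_apply (hA.inter hM), withDensity_apply _ (hA.inter hM),
      Measure.restrict_restrict (hA.inter hM),
      inter_eq_left.2 (inter_subset_right.trans hML)] at h2
    rw [h2, Measure.restrict_restrict hA]
  rw [key hΛ hΛo (hm.inter hm') inter_subset_left, key hΛ' hΛo' (hm.inter hm') inter_subset_right]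

theorem mem_finConfigIn_radius (η : FinConfig π) :
    η ∈ FinConfigIn π (Metric.ball 0 (radius π η)) :=
  Nat.sInf_mem (s := {k : ℕ | η ∈ FinConfigIn π (Metric.ball 0 k)}) (exists_mem_finConfigIn_ball η)

theorem isCorrelationFunctional_correlation [SigmaFinite σ] (hσ : Intensity π σ)
    {μ : Measure (Config π)} [IsFiniteMeasure μ] (hμ : LocallyAC π σ μ) :
    IsCorrelationFunctional π σ μ (correlation π σ μ) := by
  intro Λ hΛ hΛo
  have h : ∀ k : ℕ, _ := fun k : ℕ => correlationOn_ae_eq hσ hμ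
    (Metric.isBounded_ball (x := (0 : E d)) (r := k)) Metric.isOpen_ball hΛ hΛo
  rw [EventuallyEq, ae_restrict_iff' (measurableSet_finConfigIn hσ.cont hΛo)]
  filter_upwards [ae_all_iff.2 h] with η hη hηΛ
  exact hη (radius π η) ⟨mem_finConfigIn_radius η, hηΛ⟩

theorem measurable_radius (hπ : Continuous π) : Measurable (radius π) := by
  refine measurable_of_Iic fun k => ?_
  have : radius π ⁻¹' Iic k = FinConfigIn π (Metric.ball 0 k) := by
    ext η
    constructor
    · intro h
      exact finConfigIn_mono (Metric.ball_subset_ball (by exact_mod_cast h))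
        (mem_finConfigIn_radius η)
    · intro h
      exact Nat.sInf_le h
  rw [this]
  exact measurableSet_finConfigIn hπ Metric.isOpen_ball

/-- The defining ball depends on `η` only through the integer `radius π η`, so countably many
measurable functions are glued together. -/
theorem measurable_correlation [SigmaFinite σ] (hσ : Intensity π σ) (μ : Measure (Config π)) :
    Measurable (correlation π σ μ) := by
  let c : ℕ → FinConfig π → ℝ≥0∞ := fun k =>
    correlationOn π σ μ (Metric.ball 0 k) Metric.isBounded_ball
  have hc : ∀ k, Measurable (c k) := fun k =>
    measurable_correlationOn hσ μ Metric.isBounded_ball Metric.isOpen_ball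
  have h : correlation π σ μ = (fun q : ℕ × FinConfig π => c q.1 q.2) ∘
      fun η => (radius π η, η) := by
    ext1 η
    rfl
  rw [h]
  clear_value c
  exact (measurable_from_prod_countable_right hc).comp
    ((measurable_radius hσ.cont).prodMk measurable_id)

theorem measure_ext_of_restrict_ball {m m' : Measure (FinConfig π)}
    (h : ∀ k : ℕ, m.restrict (FinConfigIn π (Metric.ball 0 k)) =
      m'.restrict (FinConfigIn π (Metric.ball 0 k))) : m = m' :=
  (Measure.ext_iff_of_iUnion_eq_univ iUnion_finConfigIn_ball).2 h

theorem corrMeasure_eq_withDensity [SigmaFinite σ] (hσ : Intensity π σ) {μ : Measure (Config π)}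
    [IsFiniteMeasure μ] (hμ : LocallyAC π σ μ) :
    corrMeasure μ = (lebesguePoisson π σ).withDensity (correlation π σ μ) := by
  refine measure_ext_of_restrict_ball fun k => ?_
  have hm : MeasurableSet (FinConfigIn π (Metric.ball 0 k)) :=
    measurableSet_finConfigIn hσ.cont Metric.isOpen_ball
  rw [corrMeasure_restrict hσ hμ Metric.isBounded_ball Metric.isOpen_ball,
    restrict_withDensity hm]
  exact withDensity_congr_ae (isCorrelationFunctional_correlation hσ hμ _ _ Metric.isOpen_ball).symm

end CorrelationMeasure

/-! ### Real-valued `K`-transforms -/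

section RealSums

variable {d : ℕ} {X : Type} {π : X → E d}

theorem comp_orderEmbOfFin_mem_offDiag {N : ℕ} {x : Fin N → X} (hx : x ∈ offDiag π N)
    (S : Finset (Fin N)) : x ∘ S.orderEmbOfFin rfl ∈ offDiag π S.card :=
  Function.Injective.comp (g := π ∘ x) hx (S.orderEmbOfFin rfl).injective

/-- The sum of a real function over the finite subconfigurations of a set. -/
def realSubSum (f : FinConfig π → ℝ) (s : Set X) : ℝ :=
  ∑' η : {η : FinConfig π // η.1 ⊆ s}, f η.1

theorem realSubSum_range {N : ℕ} (f : FinConfig π → ℝ) {x : Fin N → X} (hx : x ∈ offDiag π N) :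
    realSubSum f (range x) =
      ∑ S : Finset (Fin N), f (tup π S.card (x ∘ S.orderEmbOfFin rfl)) := by
  obtain ⟨e, he⟩ := exists_equiv_subconfig hx
  rw [realSubSum, ← e.tsum_eq, tsum_fintype]
  simp_rw [he]

theorem KTransform_eq_realSubSum {f : FinConfig π → ℝ} {Λ Λ' : Set (E d)}
    (hf : ∀ η, η ∉ FinConfigIn π Λ → f η = 0) (h : Λ ⊆ Λ') (γ : Config π) :
    KTransform π f γ = realSubSum f (γ.1 ∩ π ⁻¹' Λ') := by
  have h1 : KTransform π f γ = ∑' η : FinConfig π, {η : FinConfig π | η.1 ⊆ γ.1}.indicator f η :=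
    tsum_subtype {η : FinConfig π | η.1 ⊆ γ.1} f
  have h2 : realSubSum f (γ.1 ∩ π ⁻¹' Λ') =
      ∑' η : FinConfig π, {η : FinConfig π | η.1 ⊆ γ.1 ∩ π ⁻¹' Λ'}.indicator f η :=
    tsum_subtype {η : FinConfig π | η.1 ⊆ γ.1 ∩ π ⁻¹' Λ'} f
  rw [h1, h2]
  refine tsum_congr fun η => ?_
  by_cases hη : η ∈ FinConfigIn π Λ
  · have : η.1 ⊆ π ⁻¹' Λ' := finConfigIn_mono h hη
    by_cases hγ : η.1 ⊆ γ.1 <;> simp [indicator, hγ, this]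
  · simp [indicator, hf η hη]

variable [TopologicalSpace X]

theorem continuous_realSubSum {f : FinConfig π → ℝ} (hf : Continuous f) :
    Continuous fun ω : FinConfig π => realSubSum f ω.1 := by
  rw [continuous_finConfig_iff]
  intro N
  have : (fun ω : FinConfig π => realSubSum f ω.1) ∘ sym π N = fun x : offDiag π N =>
      ∑ S : Finset (Fin N), f (sym π S.card
        ⟨x.1 ∘ S.orderEmbOfFin rfl, comp_orderEmbOfFin_mem_offDiag x.2 S⟩) := by
    ext1 x
    refine (realSubSum_range f x.2).trans (Finset.sum_congr rfl fun S _ => ?_)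
    rw [tup_of_mem (comp_orderEmbOfFin_mem_offDiag x.2 S)]
  rw [this]
  refine continuous_finsetSum _ fun S _ => hf.comp ((continuous_sym _).comp ?_)
  have hx : ∀ i, Continuous fun x : offDiag π N => x.1 i := fun i =>
    (continuous_apply i).comp continuous_subtype_val
  exact Continuous.subtype_mk (continuous_pi fun i => hx (S.orderEmbOfFin rfl i)) _

theorem KTransform_restr {f : FinConfig π → ℝ} {Λ : Set (E d)}
    (hf : ∀ η, η ∉ FinConfigIn π Λ → f η = 0) (γ : Config π) :
    KTransform π f γ = KTransform π f (restr π Λ γ) := by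
  rw [KTransform_eq_realSubSum hf Subset.rfl, KTransform_eq_realSubSum hf Subset.rfl]
  simp only [restr, inter_assoc, inter_self]

theorem summable_of_subSum_ne_top {f : FinConfig π → ℝ} {s : Set X}
    (h : subSum (fun η => ‖f η‖ₑ) s ≠ ∞) :
    Summable fun η : {η : FinConfig π // η.1 ⊆ s} => f η.1 := by
  have h1 : ∑' η : {η : FinConfig π // η.1 ⊆ s}, ((‖f η.1‖₊ : NNReal) : ℝ≥0∞) ≠ ∞ := h
  exact Summable.of_nnnorm (ENNReal.tsum_coe_ne_top_iff_summable.1 h1)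

theorem enorm_KTransform_le {f : FinConfig π → ℝ} (γ : Config π) :
    ‖KTransform π f γ‖ₑ ≤ subSum (fun η => ‖f η‖ₑ) γ.1 := enorm_tsum_le_tsum_enorm

theorem KTransform_sub {f g : FinConfig π → ℝ} {γ : Config π}
    (hf : subSum (fun η => ‖f η‖ₑ) γ.1 ≠ ∞) (hg : subSum (fun η => ‖g η‖ₑ) γ.1 ≠ ∞) :
    KTransform π f γ - KTransform π g γ = KTransform π (fun η => f η - g η) γ :=
  ((summable_of_subSum_ne_top hf).tsum_sub (summable_of_subSum_ne_top hg)).symm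

/-- Splitting into positive and negative parts reduces measurability and integration of `Kf` to the
nonnegative sums already treated. -/
theorem KTransform_eq_toReal_sub {f : FinConfig π → ℝ} {γ : Config π}
    (hf : subSum (fun η => ‖f η‖ₑ) γ.1 ≠ ∞) :
    KTransform π f γ = (subSum (fun η => ENNReal.ofReal (f η)) γ.1).toReal -
      (subSum (fun η => ENNReal.ofReal (-f η)) γ.1).toReal := by
  have hs := summable_of_subSum_ne_top hf
  have e1 : (subSum (fun η => ENNReal.ofReal (f η)) γ.1).toReal =
      ∑' η : {η : FinConfig π // η.1 ⊆ γ.1}, max (f η.1) 0 := by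
    rw [subSum, ENNReal.tsum_toReal_eq fun _ => ENNReal.ofReal_ne_top]
    exact tsum_congr fun η => ENNReal.toReal_ofReal'
  have e2 : (subSum (fun η => ENNReal.ofReal (-f η)) γ.1).toReal =
      ∑' η : {η : FinConfig π // η.1 ⊆ γ.1}, max (-f η.1) 0 := by
    rw [subSum, ENNReal.tsum_toReal_eq fun _ => ENNReal.ofReal_ne_top]
    exact tsum_congr fun η => ENNReal.toReal_ofReal'
  have s1 : Summable fun η : {η : FinConfig π // η.1 ⊆ γ.1} => max (f η.1) 0 :=
    Summable.of_nonneg_of_le (fun _ => le_max_right _ _)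
      (fun η => max_le (le_abs_self _) (abs_nonneg _)) hs.abs
  have s2 : Summable fun η : {η : FinConfig π // η.1 ⊆ γ.1} => max (-f η.1) 0 :=
    Summable.of_nonneg_of_le (fun _ => le_max_right _ _)
      (fun η => max_le (neg_le_abs _) (abs_nonneg _)) hs.abs
  rw [e1, e2, ← s1.tsum_sub s2]
  refine tsum_congr fun η => ?_
  rcases le_total 0 (f η.1) with h | h
  · rw [max_eq_left h, max_eq_right (by linarith), sub_zero]
  · rw [max_eq_right h, max_eq_left (by linarith)]; ring

end RealSums

/-! ### Integrals of `K`-transforms -/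

section Integrals

variable {d : ℕ} {X : Type} {π : X → E d} [MetricSpace X] [SecondCountableTopology X]
  [MeasurableSpace X] [BorelSpace X]

/-- Near each `γ`, factor through the restriction to a slightly larger ball whose radius is chosen
so that the restriction is continuous at `γ`. Enlarging the ball does not change the sum, by the
support condition. -/
theorem continuous_KTransform (hπ : Continuous π) {f : FinConfig π → ℝ} (hf : Continuous f)
    {k : ℕ} (h0 : ∀ η, η ∉ FinConfigIn π (Metric.ball 0 k) → f η = 0) :
    Continuous (KTransform π f) := by
  rw [continuous_iff_continuousAt]
  intro γ
  obtain ⟨r, hr, hc⟩ := exists_continuousAt_localConfig hπ γ k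
  have : KTransform π f = (fun ω : FinConfig π => realSubSum f ω.1) ∘
      localConfig π (Metric.ball 0 r) Metric.isBounded_ball := by
    ext1 γ'
    exact KTransform_eq_realSubSum h0 (Metric.ball_subset_ball hr.le) γ'
  rw [this]
  exact (continuous_realSubSum hf).continuousAt.comp hc

theorem ae_subSum_ne_top (hπ : Continuous π) {μ : Measure (Config π)} {ν : Measure (FinConfig π)}
    (hμ : corrMeasure μ ≤ ν) {f : FinConfig π → ℝ≥0∞} (hf : Measurable f)
    (hfν : ∫⁻ η, f η ∂ν ≠ ∞) : ∀ᵐ γ ∂μ, subSum f γ.1 ≠ ∞ := by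
  have h1 : ∫⁻ γ, subSum f γ.1 ∂μ ≠ ∞ := by
    rw [← lintegral_corrMeasure hπ μ hf]
    exact ne_top_of_le_ne_top hfν (lintegral_mono' hμ le_rfl)
  filter_upwards [ae_lt_top (measurable_subSum_config hπ hf) h1] with γ hγ
  exact hγ.ne

theorem aemeasurable_KTransform (hπ : Continuous π) {μ : Measure (Config π)}
    {ν : Measure (FinConfig π)} (hμ : corrMeasure μ ≤ ν) {f : FinConfig π → ℝ}
    (hf : Measurable f) (hfν : ∫⁻ η, ‖f η‖ₑ ∂ν ≠ ∞) : AEMeasurable (KTransform π f) μ := by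
  refine ⟨fun γ => (subSum (fun η => ENNReal.ofReal (f η)) γ.1).toReal -
    (subSum (fun η => ENNReal.ofReal (-f η)) γ.1).toReal, ?_, ?_⟩
  · exact (measurable_subSum_config hπ hf.ennreal_ofReal).ennreal_toReal.sub
      (measurable_subSum_config hπ hf.neg.ennreal_ofReal).ennreal_toReal
  · filter_upwards [ae_subSum_ne_top hπ hμ hf.enorm hfν] with γ hγ
    exact KTransform_eq_toReal_sub hγ

theorem lintegral_enorm_KTransform_le (hπ : Continuous π) {μ : Measure (Config π)}
    {ν : Measure (FinConfig π)} (hμ : corrMeasure μ ≤ ν) {f : FinConfig π → ℝ}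
    (hf : Measurable f) : ∫⁻ γ, ‖KTransform π f γ‖ₑ ∂μ ≤ ∫⁻ η, ‖f η‖ₑ ∂ν :=
  (lintegral_mono fun γ => enorm_KTransform_le γ).trans
    ((lintegral_corrMeasure hπ μ hf.enorm).symm.le.trans (lintegral_mono' hμ le_rfl))

theorem integrable_KTransform (hπ : Continuous π) {μ : Measure (Config π)}
    {ν : Measure (FinConfig π)} (hμ : corrMeasure μ ≤ ν) {f : FinConfig π → ℝ}
    (hf : Measurable f) (hfν : ∫⁻ η, ‖f η‖ₑ ∂ν ≠ ∞) : Integrable (KTransform π f) μ :=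
  ⟨(aemeasurable_KTransform hπ hμ hf hfν).aestronglyMeasurable,
    (lintegral_enorm_KTransform_le hπ hμ hf).trans_lt hfν.lt_top⟩

theorem eLpNorm_KTransform_sub_le (hπ : Continuous π) {μ : Measure (Config π)}
    {ν : Measure (FinConfig π)} (hμ : corrMeasure μ ≤ ν) {f g : FinConfig π → ℝ}
    (hf : Measurable f) (hg : Measurable g) (hfν : ∫⁻ η, ‖f η‖ₑ ∂ν ≠ ∞)
    (hgν : ∫⁻ η, ‖g η‖ₑ ∂ν ≠ ∞) :
    eLpNorm (fun γ => KTransform π f γ - KTransform π g γ) 1 μ ≤ ∫⁻ η, ‖f η - g η‖ₑ ∂ν := by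
  rw [eLpNorm_one_eq_lintegral_enorm]
  refine le_trans (le_of_eq (lintegral_congr_ae ?_))
    (lintegral_enorm_KTransform_le hπ hμ (hf.sub hg))
  filter_upwards [ae_subSum_ne_top hπ hμ hf.enorm hfν, ae_subSum_ne_top hπ hμ hg.enorm hgν]
    with γ h1 h2
  rw [KTransform_sub h1 h2]

theorem integral_KTransform (hπ : Continuous π) {μ : Measure (Config π)} {f : FinConfig π → ℝ}
    (hf : Measurable f) (hfi : ∫⁻ η, ‖f η‖ₑ ∂(corrMeasure μ) ≠ ∞) :
    ∫ γ, KTransform π f γ ∂μ = ∫ η, f η ∂(corrMeasure μ) := by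
  have hi : Integrable f (corrMeasure μ) := ⟨hf.aestronglyMeasurable, hfi.lt_top⟩
  have key : ∀ {g : FinConfig π → ℝ≥0∞}, Measurable g → (∀ η, g η ≤ ‖f η‖ₑ) →
      Integrable (fun γ : Config π => (subSum g γ.1).toReal) μ ∧
      ∫ γ, (subSum g γ.1).toReal ∂μ = (∫⁻ η, g η ∂(corrMeasure μ)).toReal := by
    intro g hg hgf
    have h1 : ∫⁻ γ, subSum g γ.1 ∂μ ≠ ∞ := by
      rw [← lintegral_corrMeasure hπ μ hg]
      exact ne_top_of_le_ne_top hfi (lintegral_mono hgf)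
    have hm := measurable_subSum_config hπ hg
    refine ⟨integrable_toReal_of_lintegral_ne_top hm.aemeasurable h1, ?_⟩
    rw [integral_toReal hm.aemeasurable (ae_lt_top hm h1), lintegral_corrMeasure hπ μ hg]
  have k1 := key (g := fun η => ENNReal.ofReal (f η)) hf.ennreal_ofReal
    fun η => Real.ofReal_le_enorm _
  have k2 := key (g := fun η => ENNReal.ofReal (-f η)) hf.neg.ennreal_ofReal
    fun η => (Real.ofReal_le_enorm _).trans (by rw [enorm_neg])
  rw [integral_eq_lintegral_pos_part_sub_lintegral_neg_part hi, ← k1.2, ← k2.2,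
    ← integral_sub k1.1 k2.1]
  refine integral_congr_ae ?_
  filter_upwards [ae_subSum_ne_top hπ le_rfl hf.enorm hfi] with γ hγ
  exact KTransform_eq_toReal_sub hγ

/-- A null set of the correlation measure has zero expected count, so almost every `γ` has no
subconfiguration in it. Functions equal almost everywhere on `Γ₀` therefore have the same
`K`-transform almost surely. -/
theorem ae_forall_subconfig (hπ : Continuous π) {μ : Measure (Config π)} {p : FinConfig π → Prop}
    (h : ∀ᵐ η ∂(corrMeasure μ), p η) : ∀ᵐ γ ∂μ, ∀ η : FinConfig π, η.1 ⊆ γ.1 → p η := by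
  obtain ⟨N, hN, hNm, hN0⟩ := exists_measurable_superset_of_null (ae_iff.1 h)
  rw [← lintegral_indicator_one hNm, lintegral_corrMeasure hπ μ (measurable_one.indicator hNm),
    lintegral_eq_zero_iff (measurable_subSum_config hπ (measurable_one.indicator hNm))] at hN0
  filter_upwards [hN0] with γ hγ η hη
  by_contra hp
  have h1 := ENNReal.tsum_eq_zero.1 hγ ⟨η, hη⟩
  rw [indicator_of_mem (hN hp)] at h1
  exact one_ne_zero h1

end Integrals

/-! ### Uniform approximation by bounded continuous cylinder functions -/

section Approximation

variable {d : ℕ} {X : Type} {π : X → E d} [MetricSpace X] [SecondCountableTopology X]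
  [MeasurableSpace X] [BorelSpace X]

/-- Measures for which the configurations in bounded sets have exponential moments. -/
def HasMoments (ν : Measure (FinConfig π)) : Prop :=
  ∀ k : ℕ, ∫⁻ η in FinConfigIn π (Metric.ball 0 k), 3 ^ card π η ∂ν < ∞

theorem measurable_pow_card (hπ : Continuous π) (a : ℝ≥0∞) :
    Measurable fun η : FinConfig π => a ^ card π η :=
  (measurable_from_top (f := fun n : ℕ => a ^ n)).comp (measurable_card hπ)

theorem HasMoments.measure_lt_top {ν : Measure (FinConfig π)} (hν : HasMoments ν) (k : ℕ) :
    ν (FinConfigIn π (Metric.ball 0 k)) < ∞ := by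
  refine lt_of_le_of_lt ?_ (hν k)
  rw [← setLIntegral_one]
  exact lintegral_mono fun η => one_le_pow₀ (by norm_num)

/-- With `n` points both sides equal `4^n`: the left is `(2^n)²` and the right is the binomial
expansion of `(3 + 1)^n`. This is where the base `3` in `HasMoments` comes from. -/
theorem subSum_one_sq (ω : FinConfig π) :
    (subSum (fun _ : FinConfig π => (1 : ℝ≥0∞)) ω.1) ^ 2 = subSum (fun η : FinConfig π => 3 ^ card π η) ω.1 := by
  obtain ⟨n, x, hx, rfl⟩ := exists_tup_eq ω
  rw [tup_val hx, subSum_range _ hx, subSum_range _ hx]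
  have h1 : ∀ S : Finset (Fin n), (3 : ℝ≥0∞) ^ card π (tup π S.card (x ∘ S.orderEmbOfFin rfl)) =
      3 ^ S.card * 1 ^ (Fintype.card (Fin n) - S.card) := by
    intro S
    rw [card_tup (comp_orderEmbOfFin_mem_offDiag hx S), one_pow, mul_one]
  simp_rw [h1]
  rw [Fintype.sum_pow_mul_eq_add_pow (Fin n) (3 : ℝ≥0∞) 1]
  simp only [Finset.sum_const, Finset.card_univ, Fintype.card_finset, Fintype.card_fin,
    nsmul_eq_mul, mul_one, Nat.cast_pow, Nat.cast_ofNat]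
  rw [← pow_mul, mul_comm n 2, pow_mul]
  norm_num

theorem subSum_ne_top_of_finConfigIn {f : FinConfig π → ℝ≥0∞} (hf : ∀ η, f η ≠ ∞)
    {Λ : Set (E d)} (hb : Bornology.IsBounded Λ) (h0 : ∀ η, η ∉ FinConfigIn π Λ → f η = 0)
    (γ : Config π) : subSum f γ.1 ≠ ∞ := by
  have : (FinConfigIn π Λ).indicator f = f := indicator_eq_self.2 fun η hη => by
    by_contra h
    exact hη (h0 η h)
  rw [← this, subSum_indicator_finConfigIn f hb]
  obtain ⟨n, x, hx, h⟩ := exists_tup_eq (localConfig π Λ hb γ)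
  rw [← h, tup_val hx, subSum_range _ hx]
  exact ENNReal.sum_ne_top.2 fun S _ => hf _

theorem enorm_KTransform_sq_le {f : FinConfig π → ℝ} {C : NNReal} (hC : ∀ η, ‖f η‖ₑ ≤ C)
    {Λ : Set (E d)} (hb : Bornology.IsBounded Λ) (h0 : ∀ η, η ∉ FinConfigIn π Λ → f η = 0)
    (γ : Config π) : ‖KTransform π f γ‖ₑ ^ 2 ≤
      C ^ 2 * subSum ((FinConfigIn π Λ).indicator fun η => 3 ^ card π η) γ.1 := by
  rw [subSum_indicator_finConfigIn _ hb, ← subSum_one_sq, ← mul_pow]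
  gcongr
  refine (enorm_KTransform_le γ).trans ?_
  rw [← subSum_indicator_finConfigIn _ hb, subSum, subSum, ← ENNReal.tsum_mul_left]
  refine ENNReal.tsum_le_tsum fun η => ?_
  by_cases hη : η.1 ∈ FinConfigIn π Λ
  · simpa [hη] using hC η.1
  · simp [h0 _ hη]

/-- Truncation of a real number to `[-M, M]`. -/
def clamp (M t : ℝ) : ℝ := max (-M) (min M t)

/-- Clamping changes only values with `|t| > M`, by less than `|t|`, and there `|t| ≤ t²/M`. A
uniform second moment thus controls the error. -/
theorem abs_clamp_sub_le {M : ℝ} (hM : 0 < M) (t : ℝ) : |clamp M t - t| ≤ t ^ 2 / M := by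
  have h0 : 0 ≤ t ^ 2 / M := by positivity
  rw [clamp]
  rcases le_total t M with h | h
  · rw [min_eq_right h]
    rcases le_total (-M) t with h' | h'
    · rw [max_eq_right h']
      simpa using h0
    · rw [max_eq_left h', abs_of_nonneg (by linarith), le_div_iff₀ hM]
      nlinarith
  · rw [min_eq_left h, max_eq_right (by linarith), abs_of_nonpos (by linarith), le_div_iff₀ hM]
    nlinarith

theorem abs_clamp_le {M : ℝ} (hM : 0 < M) (t : ℝ) : |clamp M t| ≤ M :=
  abs_le.2 ⟨le_max_left _ _, max_le (by linarith) (min_le_left _ _)⟩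

/-- Truncation of an integrable function to a bounded function with bounded support. -/
theorem exists_truncation (hπ : Continuous π) {ν' : Measure (FinConfig π)} {f : FinConfig π → ℝ}
    (hf : Measurable f) (hfi : ∫⁻ η, ‖f η‖ₑ ∂ν' ≠ ∞) {ε : ℝ≥0∞} (hε : ε ≠ 0) :
    ∃ (k : ℕ) (g : FinConfig π → ℝ), Measurable g ∧ (∀ η, ‖g η‖ₑ ≤ k) ∧
      (∀ η, ‖g η‖ₑ ≤ ‖f η‖ₑ) ∧ (∀ η, η ∉ FinConfigIn π (Metric.ball 0 k) → g η = 0) ∧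
      ∫⁻ η, ‖g η - f η‖ₑ ∂ν' ≤ ε := by
  let A : ℕ → Set (FinConfig π) := fun k =>
    FinConfigIn π (Metric.ball 0 k) ∩ {η | |f η| ≤ k}
  have hA : ∀ k, MeasurableSet (A k) := fun k =>
    (measurableSet_finConfigIn hπ Metric.isOpen_ball).inter
      (measurableSet_le (measurable_norm.comp hf) measurable_const)
  have hlim : Tendsto (fun k => ∫⁻ η, ‖(A k).indicator f η - f η‖ₑ ∂ν') atTop
      (𝓝 (∫⁻ η, 0 ∂ν')) := by
    refine tendsto_lintegral_of_dominated_convergence (fun η => ‖f η‖ₑ)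
      (fun k => ((hf.indicator (hA k)).sub hf).enorm) (fun k => Eventually.of_forall fun η => ?_)
      hfi (Eventually.of_forall fun η => ?_)
    · by_cases h : η ∈ A k <;> simp [h]
    · obtain ⟨k, hk⟩ := exists_mem_finConfigIn_ball η
      obtain ⟨j, hj⟩ := exists_nat_ge |f η|
      refine tendsto_const_nhds.congr' ?_
      filter_upwards [eventually_ge_atTop (max k j)] with i hi
      have : η ∈ A i := ⟨monotone_finConfigIn_ball ((le_max_left _ _).trans hi) hk,
        hj.trans (by exact_mod_cast (le_max_right _ _).trans hi)⟩
      simp [this]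
  rw [lintegral_zero] at hlim
  obtain ⟨k, hk⟩ := (hlim.eventually (ge_mem_nhds (pos_iff_ne_zero.2 hε))).exists
  refine ⟨k, (A k).indicator f, hf.indicator (hA k), fun η => ?_, fun η => ?_, fun η hη => ?_, hk⟩
  · by_cases h : η ∈ A k
    · rw [indicator_of_mem h, Real.enorm_eq_ofReal_abs]
      exact ENNReal.ofReal_le_natCast.2 h.2
    · simp [h]
  · by_cases h : η ∈ A k <;> simp [h]
  · exact indicator_of_notMem (fun h => hη h.1) f

/-- Bounded functions with bounded support are approximated by continuous ones. -/
theorem exists_continuous_approx (hπ : Continuous π) {ν : Measure (FinConfig π)} {k : ℕ}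
    (hν : ν (FinConfigIn π (Metric.ball 0 k)) < ∞) {f : FinConfig π → ℝ} (hf : Measurable f)
    (hfb : ∀ η, ‖f η‖ₑ ≤ k) (hf0 : ∀ η, η ∉ FinConfigIn π (Metric.ball 0 k) → f η = 0)
    {ε : ℝ≥0∞} (hε : ε ≠ 0) :
    ∃ (C : NNReal) (g : FinConfig π → ℝ), Continuous g ∧ (∀ η, ‖g η‖ₑ ≤ C) ∧
      (∀ η, η ∉ FinConfigIn π (Metric.ball 0 k) → g η = 0) ∧ ∫⁻ η, ‖g η - f η‖ₑ ∂ν ≤ ε := by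
  set B := FinConfigIn π (Metric.ball 0 k) with hB
  have hBo : IsOpen B := isOpen_finConfigIn hπ Metric.isOpen_ball
  have hfin : IsFiniteMeasure (ν.restrict B) := ⟨by simpa using hν⟩
  have := weaklyRegular_finConfig hπ (ν.restrict B)
  have := normalSpace_finConfig hπ
  have hmem : MemLp f 1 (ν.restrict B) := by
    refine MemLp.of_bound hf.aestronglyMeasurable k (Eventually.of_forall fun η => ?_)
    have := hfb η
    rw [Real.enorm_eq_ofReal_abs] at this
    exact ENNReal.ofReal_le_natCast.1 this
  have hε2 : ε / 2 ≠ 0 := (ENNReal.half_pos hε).ne'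
  obtain ⟨φ, hφ, hφm⟩ := hmem.exists_boundedContinuous_eLpNorm_sub_le ENNReal.one_ne_top hε2
  obtain ⟨ψ, hψc, hψ0, hψ⟩ := exists_continuous_pos_iff hπ hBo
  -- The continuous approximant `φ` need not vanish outside `B`. The continuous cutoffs `χ j`
  -- increase to the indicator of `B` and restore the support condition at small `L¹` cost.
  let χ : ℕ → FinConfig π → ℝ := fun j η => min 1 (j * ψ η)
  have hχc : ∀ j, Continuous (χ j) := fun j => continuous_const.min (continuous_const.mul hψc)
  have hχ0 : ∀ j η, 0 ≤ χ j η := fun j η => le_min zero_le_one (mul_nonneg j.cast_nonneg (hψ0 η))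
  have hχ1 : ∀ j η, χ j η ≤ 1 := fun j η => min_le_left _ _
  have hχB : ∀ j η, η ∉ B → χ j η = 0 := by
    intro j η hη
    have : ψ η = 0 := le_antisymm (not_lt.1 fun h => hη ((hψ η).1 h)) (hψ0 η)
    simp [χ, this]
  have hgle : ∀ j η, ‖φ η * χ j η‖ₑ ≤ ‖φ‖₊ := by
    intro j η
    have h1 : ‖φ η * χ j η‖ ≤ ‖φ‖ := by
      rw [norm_mul, Real.norm_eq_abs (χ j η), abs_of_nonneg (hχ0 j η)]
      exact (mul_le_of_le_one_right (norm_nonneg _) (hχ1 j η)).trans (φ.norm_coe_le_norm η)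
    exact ENNReal.coe_le_coe.2 h1
  have hlim : Tendsto (fun j => ∫⁻ η in B, ‖φ η * χ j η - φ η‖ₑ ∂ν) atTop
      (𝓝 (∫⁻ _ in B, 0 ∂ν)) := by
    refine tendsto_lintegral_of_dominated_convergence (fun _ => (‖φ‖₊ : ℝ≥0∞))
      (fun j => (((φ.continuous.mul (hχc j)).sub φ.continuous).measurable).enorm)
      (fun j => Eventually.of_forall fun η => ?_) ?_ ?_
    · have h1 : ‖φ η * χ j η - φ η‖ ≤ ‖φ‖ := by
        have : φ η * χ j η - φ η = -(φ η * (1 - χ j η)) := by ring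
        rw [this, norm_neg, norm_mul, Real.norm_eq_abs (1 - χ j η),
          abs_of_nonneg (by linarith [hχ1 j η])]
        exact (mul_le_of_le_one_right (norm_nonneg _) (by linarith [hχ0 j η])).trans
          (φ.norm_coe_le_norm η)
      exact ENNReal.coe_le_coe.2 h1
    · rw [lintegral_const]
      exact ENNReal.mul_ne_top ENNReal.coe_ne_top (measure_ne_top _ _)
    · refine (ae_restrict_iff' hBo.measurableSet).2 (Eventually.of_forall fun η hη => ?_)
      have hpos := (hψ η).2 hη
      obtain ⟨J, hJ⟩ := exists_nat_ge (1 / ψ η)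
      refine tendsto_const_nhds.congr' ?_
      filter_upwards [eventually_ge_atTop J] with j hj
      have : χ j η = 1 := by
        refine min_eq_left ?_
        have h1 : 1 / ψ η ≤ j := hJ.trans (by exact_mod_cast hj)
        rwa [div_le_iff₀ hpos] at h1
      simp [this]
  rw [lintegral_zero] at hlim
  obtain ⟨j, hj⟩ := (hlim.eventually (ge_mem_nhds (pos_iff_ne_zero.2 hε2))).exists
  refine ⟨‖φ‖₊, fun η => φ η * χ j η, φ.continuous.mul (hχc j), hgle j,
    fun η hη => by simp [hχB j η hη], ?_⟩
  have h1 : ∫⁻ η, ‖φ η * χ j η - f η‖ₑ ∂ν = ∫⁻ η in B, ‖φ η * χ j η - f η‖ₑ ∂ν := by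
    rw [← lintegral_indicator hBo.measurableSet]
    refine lintegral_congr fun η => ?_
    by_cases hη : η ∈ B
    · simp [hη]
    · simp [hη, hχB j η hη, hf0 η hη]
  rw [h1]
  calc ∫⁻ η in B, ‖φ η * χ j η - f η‖ₑ ∂ν
      ≤ ∫⁻ η in B, (‖φ η * χ j η - φ η‖ₑ + ‖f η - φ η‖ₑ) ∂ν := by
        refine lintegral_mono fun η => ?_
        have : φ η * χ j η - f η = (φ η * χ j η - φ η) - (f η - φ η) := by ring
        rw [this]
        exact enorm_sub_le
    _ = ∫⁻ η in B, ‖φ η * χ j η - φ η‖ₑ ∂ν + ∫⁻ η in B, ‖f η - φ η‖ₑ ∂ν :=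
        lintegral_add_right _ (hf.sub φ.continuous.measurable).enorm
    _ ≤ ε / 2 + ε / 2 := by
        refine add_le_add hj ?_
        rw [eLpNorm_one_eq_lintegral_enorm] at hφ
        exact hφ
    _ = ε := ENNReal.add_halves ε

/-- Approximation of `Kf` by bounded continuous cylinder functions, uniformly in all measures
whose correlation measure is dominated. -/
theorem exists_cylinder_approx (hπ : Continuous π) {ν ν' : Measure (FinConfig π)}
    (hν : HasMoments ν) {f : FinConfig π → ℝ} (hf : Measurable f)
    (hfi : ∫⁻ η, ‖f η‖ₑ ∂ν' ≠ ∞) {ε : ℝ≥0∞} (hε : ε ≠ 0) :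
    ∃ G : Config π →ᵇ ℝ, IsCylinder π G ∧ ∀ μ : Measure (Config π), corrMeasure μ ≤ ν →
      corrMeasure μ ≤ ν' → eLpNorm (fun γ => G γ - KTransform π f γ) 1 μ ≤ ε := by
  have hε3 : ε / 3 ≠ 0 := by simp [hε]
  obtain ⟨k, f₁, hf₁, hf₁b, hf₁f, hf₁0, hf₁ε⟩ := exists_truncation hπ hf hfi hε3
  have hνk := hν.measure_lt_top k
  have hbfin : ∀ {h : FinConfig π → ℝ} {C : NNReal}, (∀ η, ‖h η‖ₑ ≤ C) →
      (∀ η, η ∉ FinConfigIn π (Metric.ball 0 k) → h η = 0) → ∫⁻ η, ‖h η‖ₑ ∂ν ≠ ∞ := by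
    intro h C hC h0
    have hm : MeasurableSet (FinConfigIn π (Metric.ball 0 k)) :=
      measurableSet_finConfigIn hπ Metric.isOpen_ball
    refine ne_top_of_le_ne_top (ENNReal.mul_ne_top (ENNReal.coe_ne_top (r := C)) hνk.ne) ?_
    rw [← lintegral_indicator_const hm]
    refine lintegral_mono fun η => ?_
    by_cases hη : η ∈ FinConfigIn π (Metric.ball 0 k)
    · simpa [hη] using hC η
    · simp [hη, h0 η hη]
  obtain ⟨C, g, hg, hgC, hg0, hgε⟩ := exists_continuous_approx hπ hνk hf₁ hf₁b hf₁0 hε3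
  have hKg := continuous_KTransform hπ hg hg0
  -- A bound for the second moment of `Kg`, the same for all `μ` whose correlation measure is
  -- dominated by `ν`. The level `M` is then chosen so that `c / M ≤ ε / 3`.
  let c : ℝ≥0∞ := C ^ 2 * ∫⁻ η in FinConfigIn π (Metric.ball 0 k), 3 ^ card π η ∂ν
  have hc : c ≠ ∞ := ENNReal.mul_ne_top (by simp) (hν k).ne
  obtain ⟨M, hM0, hM⟩ : ∃ M : NNReal, 0 < M ∧ c / M ≤ ε / 3 := by
    by_cases hε' : ε / 3 = ∞
    · exact ⟨1, one_pos, by simp [hε']⟩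
    · refine ⟨(c / (ε / 3)).toNNReal + 1, by positivity, ?_⟩
      have h1 : c / (ε / 3) ≠ ∞ := ENNReal.div_ne_top hc hε3
      refine ENNReal.div_le_of_le_mul ?_
      rw [ENNReal.coe_add, ENNReal.coe_toNNReal h1, mul_add,
        ENNReal.mul_div_cancel hε3 hε']
      exact le_self_add
  have hMr : (0 : ℝ) < M := hM0
  let G : Config π →ᵇ ℝ := BoundedContinuousFunction.ofNormedAddCommGroup
    (fun γ => clamp M (KTransform π g γ))
    (continuous_const.max (continuous_const.min hKg)) M fun γ => abs_clamp_le hMr _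
  have hG : ∀ γ, G γ = clamp M (KTransform π g γ) := fun γ => rfl
  refine ⟨G, ⟨Metric.ball 0 k, Metric.isBounded_ball, measurableSet_ball, fun γ => ?_⟩, ?_⟩
  · rw [hG, hG, ← KTransform_restr hg0]
  intro μ hμν hμν'
  have hfk : ∫⁻ η, ‖f₁ η‖ₑ ∂ν ≠ ∞ := hbfin (C := k) (by simpa using hf₁b) hf₁0
  have hgk : ∫⁻ η, ‖g η‖ₑ ∂ν ≠ ∞ := hbfin hgC hg0
  have hfk' : ∫⁻ η, ‖f₁ η‖ₑ ∂ν' ≠ ∞ := ne_top_of_le_ne_top hfi (lintegral_mono hf₁f)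
  have e1 : eLpNorm (fun γ => G γ - KTransform π g γ) 1 μ ≤ ε / 3 := by
    rw [eLpNorm_one_eq_lintegral_enorm]
    have hm : MeasurableSet (FinConfigIn π (Metric.ball 0 k)) :=
      measurableSet_finConfigIn hπ Metric.isOpen_ball
    calc ∫⁻ γ, ‖G γ - KTransform π g γ‖ₑ ∂μ
        ≤ ∫⁻ γ, (C ^ 2 / M) * subSum ((FinConfigIn π (Metric.ball 0 k)).indicator
            fun η => 3 ^ card π η) γ.1 ∂μ := by
          refine lintegral_mono fun γ => ?_
          have h1 := abs_clamp_sub_le hMr (KTransform π g γ)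
          have h2 := enorm_KTransform_sq_le hgC Metric.isBounded_ball hg0 γ
          rw [hG, Real.enorm_eq_ofReal_abs]
          refine (ENNReal.ofReal_le_ofReal h1).trans ?_
          rw [ENNReal.ofReal_div_of_pos hMr, ← sq_abs, ENNReal.ofReal_pow (abs_nonneg _),
            ← Real.enorm_eq_ofReal_abs, ENNReal.ofReal_coe_nnreal, ENNReal.mul_div_right_comm.symm]
          gcongr
      _ = (C ^ 2 / M) * ∫⁻ η in FinConfigIn π (Metric.ball 0 k), 3 ^ card π η
            ∂(corrMeasure μ) := by
          have h3 := (measurable_pow_card hπ 3).indicator hm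
          rw [lintegral_const_mul _ (measurable_subSum_config hπ h3),
            ← lintegral_corrMeasure hπ μ h3, lintegral_indicator hm]
      _ ≤ (C ^ 2 / M) * ∫⁻ η in FinConfigIn π (Metric.ball 0 k), 3 ^ card π η ∂ν := by
          gcongr
      _ = c / M := ENNReal.mul_div_right_comm.symm
      _ ≤ ε / 3 := hM
  -- The two dominations play different roles: `ν` supplies moments and controls the bounded
  -- functions `f₁` and `g`, while `ν'` controls the passage from `f₁` to `f`, the only place where
  -- integrability of `f` enters.
  have e2 := (eLpNorm_KTransform_sub_le hπ hμν hg.measurable hf₁ hgk hfk).trans hgε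
  have e3 := (eLpNorm_KTransform_sub_le hπ hμν' hf₁ hf hfk' hfi).trans hf₁ε
  have m1 := (aemeasurable_KTransform hπ hμν hg.measurable hgk).aestronglyMeasurable
  have m2 := (aemeasurable_KTransform hπ hμν hf₁ hfk).aestronglyMeasurable
  have m3 := (aemeasurable_KTransform hπ hμν' hf hfi).aestronglyMeasurable
  have m0 : AEStronglyMeasurable G μ := G.continuous.measurable.aestronglyMeasurable
  have hsplit : (fun γ => G γ - KTransform π f γ) = ((fun γ => G γ - KTransform π g γ) +
      (fun γ => KTransform π g γ - KTransform π f₁ γ)) +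
      (fun γ => KTransform π f₁ γ - KTransform π f γ) := by
    ext1 γ
    simp only [Pi.add_apply]
    ring
  rw [hsplit]
  calc _ ≤ eLpNorm ((fun γ => G γ - KTransform π g γ) +
        (fun γ => KTransform π g γ - KTransform π f₁ γ)) 1 μ +
        eLpNorm (fun γ => KTransform π f₁ γ - KTransform π f γ) 1 μ :=
        eLpNorm_add_le ((m0.sub m1).add (m1.sub m2)) (m2.sub m3) le_rfl
    _ ≤ (ε / 3 + ε / 3) + ε / 3 := by
        gcongr
        exact (eLpNorm_add_le (m0.sub m1) (m1.sub m2) le_rfl).trans (add_le_add e1 e2)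
    _ = ε := ENNReal.add_thirds ε

end Approximation

/-! ### Domination and convergence of correlation measures under weak limits -/

section WeakLimit

variable {d : ℕ} {X : Type} {π : X → E d} [MetricSpace X] [SecondCountableTopology X]
  [MeasurableSpace X] [BorelSpace X]

/-- Outer regularity is needed only for the larger measure `ν`: enlarge a set inside a ball to an
open one of almost the same `ν`-measure, then let the ball grow. -/
theorem measure_le_of_isOpen (hπ : Continuous π) {m ν : Measure (FinConfig π)}
    (hν : ∀ k : ℕ, ν (FinConfigIn π (Metric.ball 0 k)) < ∞)
    (h : ∀ (k : ℕ) (U : Set (FinConfig π)), IsOpen U → U ⊆ FinConfigIn π (Metric.ball 0 k) →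
      m U ≤ ν U) : m ≤ ν := by
  have hBo : ∀ k : ℕ, IsOpen (FinConfigIn π (Metric.ball 0 k)) := fun k =>
    isOpen_finConfigIn hπ Metric.isOpen_ball
  have hk : ∀ (k : ℕ) (A : Set (FinConfig π)), MeasurableSet A →
      m (A ∩ FinConfigIn π (Metric.ball 0 k)) ≤ ν (A ∩ FinConfigIn π (Metric.ball 0 k)) := by
    intro k A hA
    have : IsFiniteMeasure (ν.restrict (FinConfigIn π (Metric.ball 0 k))) := ⟨by simpa using hν k⟩
    have := weaklyRegular_finConfig hπ (ν.restrict (FinConfigIn π (Metric.ball 0 k)))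
    rw [← Measure.restrict_apply hA, ← Measure.restrict_apply hA]
    refine le_of_forall_gt fun r hr => ?_
    obtain ⟨U, hAU, hU, hUr⟩ := A.exists_isOpen_lt_of_lt r hr
    refine lt_of_le_of_lt ?_ hUr
    refine (measure_mono hAU).trans ?_
    rw [Measure.restrict_apply hU.measurableSet, Measure.restrict_apply hU.measurableSet]
    exact h k _ (hU.inter (hBo k)) inter_subset_right
  refine Measure.le_iff.2 fun A hA => ?_
  have hA' : A = ⋃ k : ℕ, A ∩ FinConfigIn π (Metric.ball 0 k) := by
    rw [← inter_iUnion, iUnion_finConfigIn_ball, inter_univ]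
  have hmono : Monotone fun k : ℕ => A ∩ FinConfigIn π (Metric.ball 0 k) := fun i j hij =>
    inter_subset_inter_right _ (monotone_finConfigIn_ball hij)
  rw [hA', hmono.measure_iUnion, hmono.measure_iUnion]
  exact iSup_mono fun k => hk k A hA

theorem subSum_ofReal {f : FinConfig π → ℝ} (hf : ∀ η, 0 ≤ f η) {Λ : Set (E d)}
    (hb : Bornology.IsBounded Λ) (h0 : ∀ η, η ∉ FinConfigIn π Λ → f η = 0) (γ : Config π) :
    subSum (fun η => ENNReal.ofReal (f η)) γ.1 = ENNReal.ofReal (KTransform π f γ) := by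
  have h := subSum_ne_top_of_finConfigIn (f := fun η => ‖f η‖ₑ) (fun η => enorm_ne_top) hb
    (fun η hη => by simp [h0 η hη]) γ
  exact (ENNReal.ofReal_tsum_of_nonneg
    (f := fun η : {η : FinConfig π // η.1 ⊆ γ.1} => f η.1) (fun η => hf η.1) (summable_of_subSum_ne_top h)).symm

/-- For open `U` in a ball, exhaust `1_U` by continuous `φ j`. The transforms `K(φ j)` are
continuous but unbounded, so weak convergence is applied to their truncations at `M`. Monotone
convergence in `M` and then in `j` gives the bound on `U`. -/
theorem corrMeasure_le_of_tendsto (hπ : Continuous π) {μs : ℕ → ProbabilityMeasure (Config π)}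
    {μ : ProbabilityMeasure (Config π)} (hlim : Tendsto μs atTop (𝓝 μ))
    {ν : Measure (FinConfig π)} (hν : ∀ k : ℕ, ν (FinConfigIn π (Metric.ball 0 k)) < ∞)
    (hn : ∀ n, corrMeasure (μs n : Measure (Config π)) ≤ ν) :
    corrMeasure (μ : Measure (Config π)) ≤ ν := by
  refine measure_le_of_isOpen hπ hν fun k U hU hUk => ?_
  obtain ⟨ψ, hψc, hψ0, hψ⟩ := exists_continuous_pos_iff hπ hU
  let φ : ℕ → FinConfig π → ℝ := fun j η => min 1 (j * ψ η)
  have hφc : ∀ j, Continuous (φ j) := fun j => continuous_const.min (continuous_const.mul hψc)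
  have hφ0 : ∀ j η, 0 ≤ φ j η := fun j η => le_min zero_le_one (mul_nonneg j.cast_nonneg (hψ0 η))
  have hφU : ∀ j η, η ∉ U → φ j η = 0 := by
    intro j η hη
    have : ψ η = 0 := le_antisymm (not_lt.1 fun h => hη ((hψ η).1 h)) (hψ0 η)
    simp [φ, this]
  have hφk : ∀ j η, η ∉ FinConfigIn π (Metric.ball 0 k) → φ j η = 0 := fun j η hη =>
    hφU j η fun h => hη (hUk h)
  have hφm : ∀ j, Measurable fun η => ENNReal.ofReal (φ j η) := fun j =>
    (hφc j).measurable.ennreal_ofReal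
  have hφν : ∀ {m : Measure (FinConfig π)} (j : ℕ), m ≤ ν →
      ∫⁻ η, ENNReal.ofReal (φ j η) ∂m ≤ ν U := by
    intro m j hm
    rw [← lintegral_indicator_one hU.measurableSet]
    refine lintegral_mono' hm fun η => ?_
    by_cases hη : η ∈ U
    · simp [hη, φ]
    · simp [hη, hφU j η hη]
  have step1 : ∀ j M : ℕ, ∫⁻ γ, min (ENNReal.ofReal (KTransform π (φ j) γ)) M
      ∂(μ : Measure (Config π)) ≤ ν U := by
    intro j M
    have hK := continuous_KTransform hπ (hφc j) (hφk j)
    let G : Config π →ᵇ NNReal := BoundedContinuousFunction.mkOfBound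
      ⟨fun γ => min (KTransform π (φ j) γ).toNNReal M,
        (continuous_real_toNNReal.comp hK).min continuous_const⟩ M (by
          intro x y
          rw [NNReal.dist_eq]
          have h1 : ((min (KTransform π (φ j) x).toNNReal (M : NNReal) : NNReal) : ℝ) ≤ M := by
            exact_mod_cast min_le_right _ _
          have h2 : ((min (KTransform π (φ j) y).toNNReal (M : NNReal) : NNReal) : ℝ) ≤ M := by
            exact_mod_cast min_le_right _ _
          exact abs_sub_le_of_nonneg_of_le (NNReal.coe_nonneg _) h1 (NNReal.coe_nonneg _) h2)
    have hG : ∀ γ, (G γ : ℝ≥0∞) = min (ENNReal.ofReal (KTransform π (φ j) γ)) M := by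
      intro γ
      change (((min (KTransform π (φ j) γ).toNNReal (M : NNReal) : NNReal)) : ℝ≥0∞) = _
      rw [ENNReal.coe_min]
      rfl
    have ht := ProbabilityMeasure.tendsto_iff_forall_lintegral_tendsto.1 hlim G
    simp_rw [hG] at ht
    refine le_of_tendsto' ht fun n => ?_
    refine le_trans (lintegral_mono fun γ => min_le_left _ _) ?_
    simp_rw [← subSum_ofReal (hφ0 j) Metric.isBounded_ball (hφk j)]
    rw [← lintegral_corrMeasure hπ _ (hφm j)]
    exact hφν j (hn n)
  have step2 : ∀ j, ∫⁻ η, ENNReal.ofReal (φ j η) ∂(corrMeasure (μ : Measure (Config π))) ≤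
      ν U := by
    intro j
    have hKm : Measurable (KTransform π (φ j)) :=
      (continuous_KTransform hπ (hφc j) (hφk j)).measurable
    rw [lintegral_corrMeasure hπ _ (hφm j)]
    simp_rw [subSum_ofReal (hφ0 j) Metric.isBounded_ball (hφk j)]
    refine le_of_tendsto' (lintegral_tendsto_of_tendsto_of_monotone
      (f := fun (M : ℕ) γ => min (ENNReal.ofReal (KTransform π (φ j) γ)) (M : ℝ≥0∞))
      (fun M => (hKm.ennreal_ofReal.min measurable_const).aemeasurable)
      (Eventually.of_forall fun γ M M' h => min_le_min_left _ (by exact_mod_cast h))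
      (Eventually.of_forall fun γ => ?_)) (step1 j)
    obtain ⟨M₀, hM₀⟩ := ENNReal.exists_nat_gt (ENNReal.ofReal_ne_top (r := KTransform π (φ j) γ))
    refine tendsto_const_nhds.congr' ?_
    filter_upwards [eventually_ge_atTop M₀] with M hM
    exact (min_eq_left (hM₀.le.trans (by exact_mod_cast hM))).symm
  rw [← lintegral_indicator_one hU.measurableSet]
  refine le_of_tendsto' (lintegral_tendsto_of_tendsto_of_monotone
    (f := fun (j : ℕ) η => ENNReal.ofReal (φ j η)) (fun j => (hφm j).aemeasurable)
    (Eventually.of_forall fun η i j h => ?_) (Eventually.of_forall fun η => ?_)) step2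
  · refine ENNReal.ofReal_le_ofReal (min_le_min_left _ ?_)
    exact mul_le_mul_of_nonneg_right (by exact_mod_cast h) (hψ0 η)
  · by_cases hη : η ∈ U
    · obtain ⟨J, hJ⟩ := exists_nat_ge (1 / ψ η)
      refine tendsto_const_nhds.congr' ?_
      filter_upwards [eventually_ge_atTop J] with j hj
      have : φ j η = 1 := by
        refine min_eq_left ?_
        have h1 : 1 / ψ η ≤ j := hJ.trans (by exact_mod_cast hj)
        rwa [div_le_iff₀ ((hψ η).2 hη)] at h1
      simp [this, hη]
    · simp [hη, hφU _ η hη]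

/-- Convergence of the correlation measures, tested against all functions integrable with respect
to `ν`. -/
def CorrTendsto (μs : ℕ → Measure (Config π)) (μ : Measure (Config π))
    (ν : Measure (FinConfig π)) : Prop :=
  ∀ f : FinConfig π → ℝ≥0∞, Measurable f → ∫⁻ η, f η ∂ν ≠ ∞ →
    Tendsto (fun n => ∫⁻ η, f η ∂(corrMeasure (μs n))) atTop (𝓝 (∫⁻ η, f η ∂(corrMeasure μ)))

theorem tendsto_of_approx {a : ℕ → ℝ} {a' : ℝ}
    (h : ∀ ε > 0, ∃ (b : ℕ → ℝ) (b' : ℝ), (∀ n, |a n - b n| ≤ ε) ∧ |a' - b'| ≤ ε ∧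
      Tendsto b atTop (𝓝 b')) : Tendsto a atTop (𝓝 a') := by
  rw [Metric.tendsto_atTop]
  intro ε hε
  obtain ⟨b, b', h1, h2, h3⟩ := h (ε / 4) (by linarith)
  obtain ⟨N, hN⟩ := Metric.tendsto_atTop.1 h3 (ε / 4) (by linarith)
  refine ⟨N, fun n hn => ?_⟩
  have h4 := hN n hn
  rw [Real.dist_eq] at h4 ⊢
  have h5 := h1 n
  rw [abs_le] at h5 h2
  rw [abs_lt] at h4 ⊢
  constructor <;> linarith

theorem abs_integral_sub_le {Ω : Type*} [MeasurableSpace Ω] {m : Measure Ω} {f g : Ω → ℝ}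
    (hf : Integrable f m) (hg : Integrable g m) {ε : ℝ} (hε : 0 ≤ ε)
    (h : ∫⁻ ω, ‖f ω - g ω‖ₑ ∂m ≤ ENNReal.ofReal ε) : |∫ ω, f ω ∂m - ∫ ω, g ω ∂m| ≤ ε := by
  rw [← integral_sub hf hg]
  have h1 := (enorm_integral_le_lintegral_enorm (fun ω => f ω - g ω)).trans h
  rw [Real.enorm_eq_ofReal_abs] at h1
  exact (ENNReal.ofReal_le_ofReal_iff hε).1 h1

/-- A single bounded continuous `G` is close to `Kf` in `L¹` of all `μs n` and of `μ` at once, so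
the weak convergence of `∫ G` passes to `∫ Kf`. -/
theorem corrTendsto_of_tendsto (hπ : Continuous π) {μs : ℕ → ProbabilityMeasure (Config π)}
    {μ : ProbabilityMeasure (Config π)} (hlim : Tendsto μs atTop (𝓝 μ))
    {ν : Measure (FinConfig π)} (hν : HasMoments ν)
    (hn : ∀ n, corrMeasure (μs n : Measure (Config π)) ≤ ν) :
    CorrTendsto (fun n => (μs n : Measure (Config π))) (μ : Measure (Config π)) ν := by
  have hμ := corrMeasure_le_of_tendsto hπ hlim hν.measure_lt_top hn
  intro f hf hfν
  let g : FinConfig π → ℝ := fun η => (f η).toReal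
  have hg : Measurable g := hf.ennreal_toReal
  have hfg : f =ᵐ[ν] fun η => ‖g η‖ₑ := by
    filter_upwards [ae_lt_top hf hfν] with η hη
    rw [Real.enorm_of_nonneg ENNReal.toReal_nonneg, ENNReal.ofReal_toReal hη.ne]
  have hgν : ∫⁻ η, ‖g η‖ₑ ∂ν ≠ ∞ := by rwa [← lintegral_congr_ae hfg]
  have key : ∀ m : Measure (Config π), corrMeasure m ≤ ν →
      ∫⁻ η, f η ∂(corrMeasure m) = ENNReal.ofReal (∫ γ, KTransform π g γ ∂m) := by
    intro m hm
    have h1 : ∫⁻ η, ‖g η‖ₑ ∂(corrMeasure m) ≠ ∞ :=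
      ne_top_of_le_ne_top hgν (lintegral_mono' hm le_rfl)
    rw [integral_KTransform hπ hg h1, ofReal_integral_eq_lintegral_ofReal
      ⟨hg.aestronglyMeasurable, h1.lt_top⟩ (Eventually.of_forall fun η => ENNReal.toReal_nonneg)]
    refine lintegral_congr_ae ?_
    filter_upwards [(Measure.absolutelyContinuous_of_le hm) hfg] with η hη
    rw [hη, Real.enorm_of_nonneg ENNReal.toReal_nonneg]
  simp_rw [key _ (hn _), key _ hμ]
  refine ENNReal.tendsto_ofReal (tendsto_of_approx fun ε hε => ?_)
  obtain ⟨G, -, hG⟩ := exists_cylinder_approx hπ hν hg hgν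
    (ENNReal.ofReal_pos.2 hε).ne'
  have hb : ∀ m : ProbabilityMeasure (Config π), corrMeasure (m : Measure (Config π)) ≤ ν →
      |∫ γ, KTransform π g γ ∂(m : Measure (Config π)) - ∫ γ, G γ ∂(m : Measure (Config π))|
        ≤ ε := by
    intro m hm
    rw [abs_sub_comm]
    refine abs_integral_sub_le (G.integrable _) (integrable_KTransform hπ hm hg hgν) hε.le ?_
    rw [← eLpNorm_one_eq_lintegral_enorm]
    exact hG _ hm hm
  exact ⟨_, _, fun n => hb _ (hn n), hb _ hμ,
    ProbabilityMeasure.tendsto_iff_forall_integral_tendsto.1 hlim G⟩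

theorem CorrTendsto.integral {μs : ℕ → Measure (Config π)} {μ : Measure (Config π)}
    {ν : Measure (FinConfig π)} (h : CorrTendsto μs μ ν) (hn : ∀ n, corrMeasure (μs n) ≤ ν)
    (hμ : corrMeasure μ ≤ ν) {f : FinConfig π → ℝ} (hf : Measurable f)
    (hfν : ∫⁻ η, ‖f η‖ₑ ∂ν ≠ ∞) :
    Tendsto (fun n => ∫ η, f η ∂(corrMeasure (μs n))) atTop (𝓝 (∫ η, f η ∂(corrMeasure μ))) := by
  have h1 : ∫⁻ η, ENNReal.ofReal (f η) ∂ν ≠ ∞ :=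
    ne_top_of_le_ne_top hfν (lintegral_mono fun η => Real.ofReal_le_enorm _)
  have h2 : ∫⁻ η, ENNReal.ofReal (-f η) ∂ν ≠ ∞ :=
    ne_top_of_le_ne_top hfν (lintegral_mono fun η => (Real.ofReal_le_enorm _).trans
      (by rw [enorm_neg]))
  have hle : ∀ {m : Measure (FinConfig π)} {g : FinConfig π → ℝ≥0∞}, m ≤ ν →
      ∫⁻ η, g η ∂ν ≠ ∞ → ∫⁻ η, g η ∂m ≠ ∞ := fun hm hg =>
    ne_top_of_le_ne_top hg (lintegral_mono' hm le_rfl)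
  have hi : ∀ {m : Measure (FinConfig π)}, m ≤ ν → Integrable f m := fun hm =>
    ⟨hf.aestronglyMeasurable, (hle hm hfν).lt_top⟩
  simp_rw [fun n => integral_eq_lintegral_pos_part_sub_lintegral_neg_part (hi (hn n)),
    integral_eq_lintegral_pos_part_sub_lintegral_neg_part (hi hμ)]
  exact ((ENNReal.tendsto_toReal (hle hμ h1)).comp (h _ hf.ennreal_ofReal h1)).sub
    ((ENNReal.tendsto_toReal (hle hμ h2)).comp (h _ hf.neg.ennreal_ofReal h2))

/-- Two dominating measures appear because the improved bound allows functions integrable only for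
the smaller weight `ν'`, whereas convergence and moments are known for `ν`. A bounded truncation
with bounded support is integrable for both. -/
theorem KConvergence_of_corrTendsto (hπ : Continuous π) {μs : ℕ → Measure (Config π)}
    {μ : Measure (Config π)} {ν ν' : Measure (FinConfig π)} (hν : HasMoments ν)
    (h : CorrTendsto μs μ ν) (hn : ∀ n, corrMeasure (μs n) ≤ ν) (hμ : corrMeasure μ ≤ ν)
    (hn' : ∀ n, corrMeasure (μs n) ≤ ν') (hμ' : corrMeasure μ ≤ ν') {f : FinConfig π → ℝ}
    (hf : Measurable f) (hfν : ∫⁻ η, ‖f η‖ₑ ∂ν' ≠ ∞) : KConvergence π μs μ f := by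
  have hsum : ∀ m : Measure (Config π), corrMeasure m ≤ ν' →
      ∀ᵐ γ ∂m, Summable fun η : {η : FinConfig π // η.1 ⊆ γ.1} => |f η.1| := by
    intro m hm
    filter_upwards [ae_subSum_ne_top hπ hm hf.enorm hfν] with γ hγ
    exact (summable_of_subSum_ne_top hγ).abs
  refine ⟨fun n => hsum _ (hn' n), hsum _ hμ', fun n => integrable_KTransform hπ (hn' n) hf hfν,
    integrable_KTransform hπ hμ' hf hfν, ?_, ?_⟩
  · have hle : ∀ {m : Measure (FinConfig π)}, m ≤ ν' → ∫⁻ η, ‖f η‖ₑ ∂m ≠ ∞ := fun hm =>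
      ne_top_of_le_ne_top hfν (lintegral_mono' hm le_rfl)
    simp_rw [fun n => integral_KTransform hπ hf (hle (hn' n)), integral_KTransform hπ hf (hle hμ')]
    refine tendsto_of_approx fun ε hε => ?_
    obtain ⟨k, g, hg, hgk, hgf, hg0, hgε⟩ := exists_truncation hπ hf hfν
      (ENNReal.ofReal_pos.2 hε).ne'
    have hgν : ∫⁻ η, ‖g η‖ₑ ∂ν ≠ ∞ := by
      have hm : MeasurableSet (FinConfigIn π (Metric.ball 0 k)) :=
        measurableSet_finConfigIn hπ Metric.isOpen_ball
      refine ne_top_of_le_ne_top (ENNReal.mul_ne_top (ENNReal.natCast_ne_top k)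
        (hν.measure_lt_top k).ne) ?_
      rw [← lintegral_indicator_const hm]
      refine lintegral_mono fun η => ?_
      by_cases hη : η ∈ FinConfigIn π (Metric.ball 0 k)
      · simpa [hη] using hgk η
      · simp [hη, hg0 η hη]
    have hb : ∀ {m : Measure (FinConfig π)}, m ≤ ν' →
        |∫ η, f η ∂m - ∫ η, g η ∂m| ≤ ε := by
      intro m hm
      rw [abs_sub_comm]
      refine abs_integral_sub_le ⟨hg.aestronglyMeasurable, ?_⟩
        ⟨hf.aestronglyMeasurable, (hle hm).lt_top⟩ hε.le
        ((lintegral_mono' hm le_rfl).trans hgε)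
      exact (lintegral_mono hgf).trans_lt (hle hm).lt_top
    exact ⟨_, _, fun n => hb (hn' n), hb hμ', h.integral hn hμ hg hgν⟩
  · have hε : ∀ k : ℕ, ((k : ℝ≥0∞) + 1)⁻¹ ≠ 0 := fun k => by simp
    choose G hGc hG using fun k : ℕ => exists_cylinder_approx hπ hν hf hfν (hε k)
    have hz : Tendsto (fun k : ℕ => ((k : ℝ≥0∞) + 1)⁻¹) atTop (𝓝 0) := by
      have := (tendsto_add_atTop_iff_nat 1).2 ENNReal.tendsto_inv_nat_nhds_zero
      simpa using this
    refine ⟨G, hGc, ?_, ?_⟩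
    · exact tendsto_of_tendsto_of_tendsto_of_le_of_le tendsto_const_nhds hz (fun k => zero_le)
        fun k => iSup_le fun n => hG k _ (hn n) (hn' n)
    · exact tendsto_of_tendsto_of_tendsto_of_le_of_le tendsto_const_nhds hz (fun k => zero_le)
        fun k => hG k _ hμ hμ'

theorem KConvergence.congr (hπ : Continuous π) {μs : ℕ → Measure (Config π)}
    {μ : Measure (Config π)} {f g : FinConfig π → ℝ} (h : KConvergence π μs μ g)
    (hn : ∀ n, f =ᵐ[corrMeasure (μs n)] g) (hμ : f =ᵐ[corrMeasure μ] g) :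
    KConvergence π μs μ f := by
  have hs : ∀ {m : Measure (Config π)}, f =ᵐ[corrMeasure m] g →
      ∀ᵐ γ ∂m, (fun η : {η : FinConfig π // η.1 ⊆ γ.1} => f η.1) = fun η => g η.1 := by
    intro m hm
    filter_upwards [ae_forall_subconfig hπ hm] with γ hγ
    exact funext fun η => hγ η.1 η.2
  have hK : ∀ {m : Measure (Config π)}, f =ᵐ[corrMeasure m] g →
      KTransform π f =ᵐ[m] KTransform π g := by
    intro m hm
    filter_upwards [hs hm] with γ hγ
    simp only [KTransform, hγ]
  obtain ⟨h1, h2, h3, h4, h5, G, hGc, h6, h7⟩ := h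
  refine ⟨fun n => ?_, ?_, fun n => (h3 n).congr (hK (hn n)).symm, h4.congr (hK hμ).symm, ?_,
    G, hGc, ?_, ?_⟩
  · filter_upwards [h1 n, hs (hn n)] with γ hγ hγ'
    exact hγ.congr fun η => congrArg abs (congrFun hγ' η).symm
  · filter_upwards [h2, hs hμ] with γ hγ hγ'
    exact hγ.congr fun η => congrArg abs (congrFun hγ' η).symm
  · simp_rw [fun n => integral_congr_ae (hK (hn n)), integral_congr_ae (hK hμ)]
    exact h5
  · refine h6.congr fun k => iSup_congr fun n => eLpNorm_congr_ae ?_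
    filter_upwards [hK (hn n)] with γ hγ
    rw [hγ]
  · refine h7.congr fun k => eLpNorm_congr_ae ?_
    filter_upwards [hK hμ] with γ hγ
    rw [hγ]

end WeakLimit

/-! ### From correlation measures to the conclusions -/

section Conclusions

variable {d : ℕ} {X : Type} {π : X → E d} [MetricSpace X] [SecondCountableTopology X]
  [MeasurableSpace X] [BorelSpace X] {σ : Measure X} [SigmaFinite σ]

/-- Comparing in `EReal` keeps the information that `r` is nonnegative, which `ENNReal.ofReal` alone
would lose. A Ruelle bound thereby forces its majorant to be nonnegative almost everywhere. -/
theorem coe_le_coe_real_iff {x : ℝ≥0∞} {r : ℝ} :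
    ((x : ℝ≥0∞) : EReal) ≤ (r : EReal) ↔ 0 ≤ r ∧ x ≤ ENNReal.ofReal r := by
  constructor
  · intro h
    have h0 : 0 ≤ r := EReal.coe_nonneg.1 ((EReal.coe_ennreal_nonneg x).trans h)
    refine ⟨h0, ?_⟩
    rw [← EReal.coe_ennreal_le_coe_ennreal_iff, EReal.coe_ennreal_ofReal, max_eq_left h0]
    exact h
  · rintro ⟨h0, h⟩
    rw [← EReal.coe_ennreal_le_coe_ennreal_iff, EReal.coe_ennreal_ofReal, max_eq_left h0] at h
    exact h

theorem corrMeasure_le_weighted (hσ : Intensity π σ) {μ : Measure (Config π)} [IsFiniteMeasure μ]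
    (hμ : LocallyAC π σ μ) {ξ : ℝ} {h : FinConfig π → ℝ} (hb : RuelleBound π σ μ ξ h) :
    corrMeasure μ ≤ weighted π σ ξ h := by
  rw [corrMeasure_eq_withDensity hσ hμ]
  refine withDensity_mono ?_
  filter_upwards [hb] with η hη
  exact (coe_le_coe_real_iff.1 hη).2

theorem weighted_mono {ξ : ℝ} (hξ : 0 ≤ ξ) {h h' : FinConfig π → ℝ}
    (hh : ∀ᵐ η ∂(lebesguePoisson π σ), h η ≤ h' η) : weighted π σ ξ h ≤ weighted π σ ξ h' := by
  refine withDensity_mono ?_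
  filter_upwards [hh] with η hη
  exact ENNReal.ofReal_le_ofReal (mul_le_mul_of_nonneg_left hη (pow_nonneg hξ _))

theorem measurable_weight (hπ : Continuous π) (ξ C : ℝ) :
    Measurable fun η : FinConfig π => ENNReal.ofReal (ξ ^ card π η * C) :=
  ((measurable_from_top (f := fun n : ℕ => ENNReal.ofReal (ξ ^ n * C))).comp
    (measurable_card hπ))

theorem hasMoments_weighted (hσ : Intensity π σ) {ξ C : ℝ} (hξ : 0 ≤ ξ) :
    HasMoments (weighted π σ ξ fun _ => C) := by
  intro k
  have hm : MeasurableSet (FinConfigIn π (Metric.ball 0 k)) :=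
    measurableSet_finConfigIn hσ.cont Metric.isOpen_ball
  rw [weighted, restrict_withDensity hm,
    lintegral_withDensity_eq_lintegral_mul _ (measurable_weight hσ.cont ξ C)
      (measurable_pow_card hσ.cont 3)]
  have h1 : ∀ η : FinConfig π, ENNReal.ofReal (ξ ^ card π η * C) * 3 ^ card π η =
      ENNReal.ofReal C * (ENNReal.ofReal ξ * 3) ^ card π η := by
    intro η
    rw [ENNReal.ofReal_mul (pow_nonneg hξ _), ENNReal.ofReal_pow hξ, mul_pow]
    ring
  simp_rw [Pi.mul_apply, h1]
  rw [lintegral_const_mul _ (measurable_pow_card hσ.cont _)]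
  exact ENNReal.mul_lt_top ENNReal.ofReal_lt_top (setLIntegral_pow_card_lt_top hσ
    Metric.isOpen_ball Metric.isBounded_ball (ENNReal.mul_ne_top ENNReal.ofReal_ne_top (by simp)))

theorem locallyAC_of_le_weighted (hσ : Intensity π σ) {μ : Measure (Config π)} {ξ : ℝ}
    {h : FinConfig π → ℝ} (hμ : corrMeasure μ ≤ weighted π σ ξ h) : LocallyAC π σ μ :=
  locallyAC_of_corrMeasure hσ.cont
    ((Measure.absolutelyContinuous_of_le hμ).trans (withDensity_absolutelyContinuous _ _))

theorem correlation_le_of_le_weighted (hσ : Intensity π σ) {μ : Measure (Config π)}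
    [IsFiniteMeasure μ] {ξ C : ℝ} (hμ : corrMeasure μ ≤ weighted π σ ξ fun _ => C) :
    ∀ᵐ η ∂(lebesguePoisson π σ),
      correlation π σ μ η ≤ ENNReal.ofReal (ξ ^ card π η * C) := by
  have := sigmaFinite_lebesguePoisson hσ
  have hac := locallyAC_of_le_weighted hσ hμ
  refine ae_le_of_forall_setLIntegral_le_of_sigmaFinite (measurable_correlation hσ μ)
    fun A hA _ => ?_
  have h1 := Measure.le_iff.1 hμ A hA
  rwa [corrMeasure_eq_withDensity hσ hac, withDensity_apply _ hA, weighted,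
    withDensity_apply _ hA] at h1

theorem integral_corrMeasure_eq (hσ : Intensity π σ) {μ : Measure (Config π)}
    [IsFiniteMeasure μ] {ξ C : ℝ} (hμ : corrMeasure μ ≤ weighted π σ ξ fun _ => C)
    (f : FinConfig π → ℝ) : ∫ η, f η ∂(corrMeasure μ) =
      ∫ η, (correlation π σ μ η).toReal * f η ∂(lebesguePoisson π σ) := by
  rw [corrMeasure_eq_withDensity hσ (locallyAC_of_le_weighted hσ hμ),
    integral_withDensity_eq_integral_toReal_smul (measurable_correlation hσ μ)]
  · rfl
  · filter_upwards [correlation_le_of_le_weighted hσ hμ] with η hη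
    exact hη.trans_lt ENNReal.ofReal_lt_top

theorem lintegral_weighted (hπ : Continuous π) (ξ C : ℝ) {f : FinConfig π → ℝ≥0∞}
    (hf : Measurable f) : ∫⁻ η, f η ∂(weighted π σ ξ fun _ => C) =
      ∫⁻ η, ENNReal.ofReal (ξ ^ card π η * C) * f η ∂(lebesguePoisson π σ) := by
  rw [weighted, lintegral_withDensity_eq_lintegral_mul _ (measurable_weight hπ ξ C) hf]
  rfl

/-- Testing `ρ/ξ^♯` against `φ ∈ L¹(λ)` is testing the correlation measure against `φ/ξ^♯`, which is
integrable for `ξ^♯ λ`. -/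
theorem weakStarTendsto_normalizedCorrelation (hσ : Intensity π σ) {μs : ℕ → Measure (Config π)}
    [∀ n, IsFiniteMeasure (μs n)] {μ : Measure (Config π)} [IsFiniteMeasure μ] {ξ : ℝ}
    (hξ : 0 < ξ) (hn : ∀ n, corrMeasure (μs n) ≤ weighted π σ ξ fun _ => 1)
    (hμ : corrMeasure μ ≤ weighted π σ ξ fun _ => 1)
    (h : CorrTendsto μs μ (weighted π σ ξ fun _ => 1)) :
    WeakStarTendsto (lebesguePoisson π σ) (fun n => normalizedCorrelation π σ (μs n) ξ)
      (normalizedCorrelation π σ μ ξ) := by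
  have hpm : Measurable fun η : FinConfig π => ξ ^ card π η :=
    (measurable_from_top (f := fun n : ℕ => ξ ^ n)).comp (measurable_card hσ.cont)
  have hmem : ∀ (m : Measure (Config π)) [IsFiniteMeasure m],
      corrMeasure m ≤ (weighted π σ ξ fun _ => 1) →
      MemLp (normalizedCorrelation π σ m ξ) ∞ (lebesguePoisson π σ) := by
    intro m _ hm
    refine memLp_top_of_bound
      (((measurable_correlation hσ m).ennreal_toReal.div hpm).aestronglyMeasurable) 1 ?_
    filter_upwards [correlation_le_of_le_weighted hσ hm] with η hη
    have hpos : 0 < ξ ^ card π η := pow_pos hξ _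
    rw [normalizedCorrelation, Real.norm_eq_abs,
      abs_of_nonneg (div_nonneg ENNReal.toReal_nonneg hpos.le), div_le_one hpos]
    rw [mul_one] at hη
    exact ENNReal.toReal_le_of_le_ofReal hpos.le hη
  refine ⟨fun n => hmem _ (hn n), hmem _ hμ, fun φ hφ => ?_⟩
  let φ' := hφ.1.mk φ
  have hφ' : φ =ᵐ[lebesguePoisson π σ] φ' := hφ.1.ae_eq_mk
  have hφm : Measurable φ' := hφ.1.stronglyMeasurable_mk.measurable
  let f : FinConfig π → ℝ := fun η => φ' η / ξ ^ card π η
  have hf : Measurable f := hφm.div hpm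
  have hfν : ∫⁻ η, ‖f η‖ₑ ∂(weighted π σ ξ fun _ => 1) ≠ ∞ := by
    rw [lintegral_weighted hσ.cont ξ 1 hf.enorm]
    refine ne_of_lt (lt_of_le_of_lt (le_of_eq ?_) hφ.2)
    refine lintegral_congr_ae ?_
    filter_upwards [hφ'] with η hη
    have hpos : 0 < ξ ^ card π η := pow_pos hξ _
    rw [hη, mul_one, ← abs_of_pos hpos, ← Real.enorm_eq_ofReal_abs, ← enorm_mul]
    congr 1
    simp only [f]
    field_simp
  have hint : ∀ (m : Measure (Config π)) [IsFiniteMeasure m],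
      corrMeasure m ≤ (weighted π σ ξ fun _ => 1) →
      ∫ η, φ η * normalizedCorrelation π σ m ξ η ∂(lebesguePoisson π σ) =
        ∫ η, f η ∂(corrMeasure m) := by
    intro m _ hm
    rw [integral_corrMeasure_eq hσ hm]
    refine integral_congr_ae ?_
    filter_upwards [hφ'] with η hη
    simp only [f, hη, normalizedCorrelation]
    ring
  simp_rw [fun n => hint _ (hn n), hint _ hμ]
  exact h.integral hn hμ hf hfν

theorem ruelleConclusion_of_corrTendsto (hσ : Intensity π σ) {μs : ℕ → Measure (Config π)}
    [∀ n, IsFiniteMeasure (μs n)] {μ : Measure (Config π)} [IsFiniteMeasure μ] {ξ : ℝ}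
    (hξ : 0 < ξ) (hn : ∀ n, corrMeasure (μs n) ≤ weighted π σ ξ fun _ => 1)
    (hμ : corrMeasure μ ≤ weighted π σ ξ fun _ => 1)
    (h : CorrTendsto μs μ (weighted π σ ξ fun _ => 1)) :
    RuelleConclusion π σ μs μ ξ := by
  refine ⟨fun f hf => ?_, fun n =>
    isCorrelationFunctional_correlation hσ (locallyAC_of_le_weighted hσ (hn n)),
    ⟨locallyAC_of_le_weighted hσ hμ,
      isCorrelationFunctional_correlation hσ (locallyAC_of_le_weighted hσ hμ), ?_⟩,
    weakStarTendsto_normalizedCorrelation hσ hξ hn hμ h⟩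
  · have hae := hf.1.ae_eq_mk
    refine KConvergence.congr hσ.cont (KConvergence_of_corrTendsto hσ.cont
      (hasMoments_weighted hσ hξ.le) h hn hμ hn hμ hf.1.stronglyMeasurable_mk.measurable ?_)
      (fun n => (Measure.absolutelyContinuous_of_le (hn n)) hae)
      ((Measure.absolutelyContinuous_of_le hμ) hae)
    exact (hf.congr hae).2.ne
  · filter_upwards [correlation_le_of_le_weighted hσ hμ] with η hη
    exact coe_le_coe_real_iff.2 ⟨mul_nonneg (pow_nonneg hξ.le _) zero_le_one, hη⟩

/-- On a set `A` of finite `λ`-measure, both `∫_A ρ/ζ^♯ dλ` and `∫_A h n dλ` converge, so their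
inequality passes to the limit. As `A` is arbitrary, it holds almost everywhere. -/
theorem improvedRuelleConclusion_of_corrTendsto (hσ : Intensity π σ)
    {μs : ℕ → Measure (Config π)} [∀ n, IsFiniteMeasure (μs n)] {μ : Measure (Config π)}
    [IsFiniteMeasure μ] (hac : ∀ n, LocallyAC π σ (μs n)) {ζ : ℝ} (hζ : 0 < ζ) {C : ℝ}
    (hn : ∀ n, corrMeasure (μs n) ≤ weighted π σ ζ fun _ => C)
    (hμ : corrMeasure μ ≤ weighted π σ ζ fun _ => C)
    (H : CorrTendsto μs μ (weighted π σ ζ fun _ => C)) {h : ℕ → FinConfig π → ℝ}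
    {h' : FinConfig π → ℝ} (hw : WeakStarTendsto (lebesguePoisson π σ) h h')
    (hb : ∀ n, RuelleBound π σ (μs n) ζ (h n)) :
    ImprovedRuelleConclusion π σ μs μ ζ h h' := by
  have := sigmaFinite_lebesguePoisson hσ
  have hacμ := locallyAC_of_le_weighted hσ hμ
  have hn0 : ∀ n, ∀ᵐ η ∂(lebesguePoisson π σ), 0 ≤ h n η := by
    intro n
    filter_upwards [hb n] with η hη
    exact nonneg_of_mul_nonneg_right (coe_le_coe_real_iff.1 hη).1 (pow_pos hζ _)
  have hint : ∀ {g : FinConfig π → ℝ}, MemLp g ∞ (lebesguePoisson π σ) →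
      ∀ A : Set (FinConfig π), lebesguePoisson π σ A < ∞ →
      IntegrableOn g A (lebesguePoisson π σ) := by
    intro g hg A hA
    have : IsFiniteMeasure ((lebesguePoisson π σ).restrict A) := ⟨by simpa using hA⟩
    exact (hg.restrict A).integrable le_top
  have hset : ∀ A : Set (FinConfig π), MeasurableSet A → lebesguePoisson π σ A < ∞ →
      Tendsto (fun n => ∫ η in A, h n η ∂(lebesguePoisson π σ)) atTop
        (𝓝 (∫ η in A, h' η ∂(lebesguePoisson π σ))) := by
    intro A hA hAf
    have h1 := hw.2.2 (A.indicator fun _ => 1)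
      ((integrable_indicator_iff hA).2 (integrableOn_const hAf.ne))
    have h2 : ∀ g : FinConfig π → ℝ,
        ∫ η, A.indicator (fun _ => (1 : ℝ)) η * g η ∂(lebesguePoisson π σ) =
          ∫ η in A, g η ∂(lebesguePoisson π σ) := by
      intro g
      rw [← integral_indicator hA]
      congr 1
      ext1 η
      by_cases hη : η ∈ A <;> simp [hη]
    simpa only [h2] using h1
  have h'0 : ∀ᵐ η ∂(lebesguePoisson π σ), 0 ≤ h' η := by
    refine ae_nonneg_of_forall_setIntegral_nonneg_of_sigmaFinite (fun A _ hA => hint hw.2.1 A hA)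
      fun A hA hAf => ge_of_tendsto' (hset A hA hAf) fun n => ?_
    exact setIntegral_nonneg_of_ae (hn0 n)
  have hpos : ∀ η : FinConfig π, 0 < ζ ^ card π η := fun η => pow_pos hζ _
  let w : FinConfig π → ℝ≥0∞ := fun η => ENNReal.ofReal (ζ ^ card π η * 1)
  have hw0 : ∀ η, w η ≠ 0 := fun η => (ENNReal.ofReal_pos.2 (by simpa using hpos η)).ne'
  have hwt : ∀ η, w η ≠ ∞ := fun η => ENNReal.ofReal_ne_top
  have hwm : Measurable fun η => (w η)⁻¹ := (measurable_weight hσ.cont ζ 1).inv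
  have hρ : ∀ᵐ η ∂(lebesguePoisson π σ),
      correlation π σ μ η * (w η)⁻¹ ≤ ENNReal.ofReal (h' η) := by
    refine ae_le_of_forall_setLIntegral_le_of_sigmaFinite
      ((measurable_correlation hσ μ).mul hwm) fun A hA hAf => ?_
    have hfm : Measurable (A.indicator fun η => (w η)⁻¹) := hwm.indicator hA
    have hcorr : ∀ (m : Measure (Config π)) [IsFiniteMeasure m], LocallyAC π σ m →
        ∫⁻ η, A.indicator (fun η => (w η)⁻¹) η ∂(corrMeasure m) =
          ∫⁻ η in A, correlation π σ m η * (w η)⁻¹ ∂(lebesguePoisson π σ) := by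
      intro m _ hm
      rw [corrMeasure_eq_withDensity hσ hm,
        lintegral_withDensity_eq_lintegral_mul _ (measurable_correlation hσ m) hfm,
        ← lintegral_indicator hA]
      refine lintegral_congr fun η => ?_
      by_cases hη : η ∈ A <;> simp [hη]
    -- The factor `ζ^♯` cancels, leaving `C λ(A)`. This makes the test function admissible for `H`.
    have hfin : ∫⁻ η, A.indicator (fun η => (w η)⁻¹) η ∂(weighted π σ ζ fun _ => C) ≠ ∞ := by
      rw [lintegral_weighted hσ.cont ζ C hfm]
      refine ne_top_of_le_ne_top
        (ENNReal.mul_ne_top (ENNReal.ofReal_ne_top (r := C)) hAf.ne) ?_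
      rw [← lintegral_indicator_const hA]
      refine lintegral_mono fun η => ?_
      by_cases hη : η ∈ A
      · simp only [indicator_of_mem hη]
        rw [ENNReal.ofReal_mul (hpos η).le, mul_comm (ENNReal.ofReal _), mul_assoc]
        simp only [w, mul_one]
        rw [ENNReal.mul_inv_cancel (ENNReal.ofReal_pos.2 (hpos η)).ne' ENNReal.ofReal_ne_top,
          mul_one]
      · simp [hη]
    have ht := H _ hfm hfin
    rw [hcorr μ hacμ] at ht
    have ht2 : Tendsto (fun n => ENNReal.ofReal (∫ η in A, h n η ∂(lebesguePoisson π σ))) atTop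
        (𝓝 (ENNReal.ofReal (∫ η in A, h' η ∂(lebesguePoisson π σ)))) :=
      ENNReal.tendsto_ofReal (hset A hA hAf)
    rw [← ofReal_integral_eq_lintegral_ofReal (hint hw.2.1 A hAf) (ae_restrict_of_ae h'0)]
    refine le_of_tendsto_of_tendsto' ht ht2 fun n => ?_
    rw [hcorr _ (hac n), ofReal_integral_eq_lintegral_ofReal (hint (hw.1 n) A hAf)
      (ae_restrict_of_ae (hn0 n))]
    refine lintegral_mono_ae (ae_restrict_of_ae ?_)
    filter_upwards [hb n] with η hη
    have h1 := (coe_le_coe_real_iff.1 hη).2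
    rw [← div_eq_mul_inv]
    refine ENNReal.div_le_of_le_mul' (h1.trans (le_of_eq ?_))
    simp only [w, mul_one]
    exact ENNReal.ofReal_mul (hpos η).le
  have hbμ : RuelleBound π σ μ ζ h' := by
    filter_upwards [hρ, h'0] with η h1 h2
    refine coe_le_coe_real_iff.2 ⟨mul_nonneg (hpos η).le h2, ?_⟩
    rw [← div_eq_mul_inv] at h1
    have h3 := (ENNReal.div_le_iff_le_mul (Or.inl (hw0 η)) (Or.inl (hwt η))).1 h1
    refine h3.trans (le_of_eq ?_)
    rw [ENNReal.ofReal_mul (hpos η).le, mul_comm]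
    simp only [w, mul_one]
  refine ⟨fun n => isCorrelationFunctional_correlation hσ (hac n),
    ⟨hacμ, isCorrelationFunctional_correlation hσ hacμ, hbμ⟩, ?_⟩
  intro hbar hbm hbn hbl f hf hfi
  exact KConvergence_of_corrTendsto hσ.cont (hasMoments_weighted hσ hζ.le) H hn hμ
    (fun n => (corrMeasure_le_weighted hσ (hac n) (hb n)).trans (weighted_mono hζ.le (hbn n)))
    ((corrMeasure_le_weighted hσ hacμ hbμ).trans (weighted_mono hζ.le hbl)) hf hfi.2.ne

end Conclusions

/-! ### The Lebesgue and Gaussian intensities -/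

section Intensities

variable {d : ℕ} {β : ℝ}

theorem isProbabilityMeasure_gaussian (hβ : 0 < β) : IsProbabilityMeasure (gaussian d β) := by
  have h1 := GaussianFourier.integral_rexp_neg_mul_sq_norm (V := E d) (half_pos hβ)
  have h2 : (Real.pi / (β / 2)) ^ (Module.finrank ℝ (E d) / 2 : ℝ) =
      √(2 * Real.pi / β) ^ d := by
    have h3 : Real.pi / (β / 2) = 2 * Real.pi / β := by field_simp
    rw [h3, finrank_euclideanSpace_fin, Real.sqrt_eq_rpow, ← Real.rpow_natCast, ← Real.rpow_mul]
    · congr 1; ring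
    · have := Real.pi_pos
      positivity
  rw [h2] at h1
  have hpos : 0 < √(2 * Real.pi / β) ^ d := by
    have := Real.pi_pos
    positivity
  -- The integral of a non-integrable function is `0` by convention, which contradicts the positive
  -- value in `h1`.
  have hint : Integrable fun v : E d => Real.exp (-(β / 2) * ‖v‖ ^ 2) := by
    by_contra h
    rw [integral_undef h] at h1
    exact hpos.ne h1
  have h4 : ∀ v : E d, Real.exp (-(β * ‖v‖ ^ 2 / 2)) = Real.exp (-(β / 2) * ‖v‖ ^ 2) := fun v => by
    congr 1; ring
  constructor
  rw [gaussian, withDensity_apply _ MeasurableSet.univ, setLIntegral_univ]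
  simp_rw [h4]
  rw [← ofReal_integral_eq_lintegral_ofReal (hint.const_mul _)
    (ae_of_all _ fun v => by positivity), integral_const_mul, h1, inv_mul_cancel₀ hpos.ne',
    ENNReal.ofReal_one]

theorem intensity_leb (hd : 0 < d) : Intensity (pos d) (leb d) where
  cont := continuous_id
  null p := by
    have : Nonempty (Fin d) := ⟨⟨0, hd⟩⟩
    simp
  fin _ hΛ := hΛ.measure_lt_top

theorem intensity_lebV (hd : 0 < d) [IsProbabilityMeasure (gaussian d β)] :
    Intensity (posV d) (lebV d β) where
  cont := continuous_fst
  null p := by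
    have h : (posV d ⁻¹' {p} : Set (E d × E d)) = {p} ×ˢ univ := by ext; simp
    rw [h, lebV, Measure.prod_prod]
    have := (intensity_leb hd).null p
    simp only [preimage_id_eq, id_eq, leb] at this
    rw [this, zero_mul]
  fin Λ hΛ := by
    have h : (posV d ⁻¹' Λ : Set (E d × E d)) = Λ ×ˢ univ := by ext; simp
    rw [h, lebV, Measure.prod_prod, measure_univ, mul_one]
    exact hΛ.measure_lt_top

instance [IsProbabilityMeasure (gaussian d β)] : SigmaFinite (lebV d β) := by
  rw [lebV]; infer_instance

end Intensities

/-! ### Random velocities on finite configurations -/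

section MarkingFinite

variable {d : ℕ} {β : ℝ}

/-- The law of independent Gaussian velocities at all points of `ℝ^d`. -/
def velLaw (d : ℕ) (β : ℝ) : Measure (E d → E d) := Measure.infinitePi fun _ : E d => gaussian d β

instance [IsProbabilityMeasure (gaussian d β)] : IsProbabilityMeasure (velLaw d β) := by
  rw [velLaw]; infer_instance

/-- Attach the velocity `V x` to every point `x` of a finite configuration. -/
def attachFin (η : FinConfig (pos d)) (V : E d → E d) : FinConfig (posV d) :=
  ⟨(fun x => (x, V x)) '' η.1, by
    rintro _ ⟨x, -, rfl⟩ _ ⟨y, -, rfl⟩ h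
    have h' : x = y := h
    rw [h'], η.2.2.image _⟩

theorem positions_attachFin (η : FinConfig (pos d)) (V : E d → E d) :
    positions (attachFin η V) = η := by
  refine Subtype.ext ?_
  simp [positions, attachFin, image_image]

/-- Attach the velocities `v i` to the points of a tuple. -/
def zipTuple {n : ℕ} (x v : Fin n → E d) : Fin n → E d × E d := fun i => (x i, v i)

theorem zipTuple_mem_offDiag {n : ℕ} {x v : Fin n → E d} :
    zipTuple x v ∈ offDiag (posV d) n ↔ x ∈ offDiag (pos d) n := Iff.rfl

theorem attachFin_tup {n : ℕ} {x : Fin n → E d} (hx : x ∈ offDiag (pos d) n) (V : E d → E d) :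
    attachFin (tup (pos d) n x) V = tup (posV d) n (zipTuple x fun i => V (x i)) := by
  refine Subtype.ext ?_
  rw [tup_val (zipTuple_mem_offDiag.2 hx)]
  simp only [attachFin, tup_val hx]
  rw [← range_comp]
  rfl

theorem positions_tup {n : ℕ} {z : Fin n → E d × E d} (hz : z ∈ offDiag (posV d) n) :
    positions (tup (posV d) n z) = tup (pos d) n fun i => (z i).1 := by
  have hz' : (fun i => (z i).1) ∈ offDiag (pos d) n := hz
  refine Subtype.ext ?_
  rw [tup_val hz']
  simp only [positions, tup_val hz]
  rw [← range_comp]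
  rfl

theorem measurable_positions : Measurable (positions (d := d)) :=
  measurable_finConfig' continuous_fst (fun n z => tup (pos d) n fun i => (z i).1)
    (fun n => (measurable_tup continuous_id n).comp
      (measurable_pi_lambda _ fun i => (measurable_pi_apply i).fst))
    fun _ _ hz => positions_tup hz

theorem card_positions (η : FinConfig (posV d)) : card (pos d) (positions η) = card (posV d) η :=
  η.2.1.ncard_image

theorem measurable_zipTuple {n : ℕ} :
    Measurable fun p : (Fin n → E d) × (Fin n → E d) => zipTuple p.1 p.2 :=
  measurable_pi_lambda _ fun i =>
    ((measurable_pi_apply i).comp measurable_fst).prodMk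
      ((measurable_pi_apply i).comp measurable_snd)

theorem measurable_attachFin (η : FinConfig (pos d)) : Measurable (attachFin η) := by
  obtain ⟨n, x, hx, rfl⟩ := exists_tup_eq η
  have : attachFin (tup (pos d) n x) =
      fun V : E d → E d => tup (posV d) n (zipTuple x fun i => V (x i)) :=
    funext fun V => attachFin_tup hx V
  rw [this]
  refine (measurable_tup continuous_fst n).comp (measurable_zipTuple.comp
    (measurable_const.prodMk (measurable_pi_lambda _ fun i => measurable_pi_apply (x i))))

/-- Velocities are sampled at all points of `ℝ^d`, an uncountable product. Only its finite marginals
at distinct points are ever used. -/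
theorem map_velLaw_tuple [IsProbabilityMeasure (gaussian d β)] {n : ℕ} {x : Fin n → E d}
    (hx : Function.Injective x) :
    (velLaw d β).map (fun V i => V (x i)) = Measure.pi fun _ : Fin n => gaussian d β := by
  classical
  have hm : Measurable fun (V : E d → E d) (i : Fin n) => V (x i) :=
    measurable_pi_lambda _ fun i => measurable_pi_apply (x i)
  refine (Measure.pi_eq fun s hs => ?_).symm
  rw [Measure.map_apply hm (MeasurableSet.univ_pi hs)]
  let t : E d → Set (E d) := Function.extend x s fun _ => univ
  have ht : ∀ i, t (x i) = s i := fun i => hx.extend_apply s _ i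
  have h1 : (fun (V : E d → E d) (i : Fin n) => V (x i)) ⁻¹' (univ.pi s) =
      Set.pi (Finset.univ.image x : Finset (E d)) t := by
    ext V
    simp [Set.mem_pi, ht]
  rw [h1, velLaw, Measure.infinitePi_pi _ (by simpa [ht] using hs),
    Finset.prod_image fun i _ j _ h => hx h]
  simp [ht]

/-- The mean of `f` over the velocities attached to a finite configuration. -/
def markInt (β : ℝ) (f : FinConfig (posV d) → ℝ≥0∞) (η : FinConfig (pos d)) : ℝ≥0∞ :=
  ∫⁻ V, f (attachFin η V) ∂(velLaw d β)

variable [IsProbabilityMeasure (gaussian d β)]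

theorem markInt_tup {f : FinConfig (posV d) → ℝ≥0∞} (hf : Measurable f) {n : ℕ}
    {x : Fin n → E d} (hx : x ∈ offDiag (pos d) n) :
    markInt β f (tup (pos d) n x) =
      ∫⁻ v, f (tup (posV d) n (zipTuple x v)) ∂(Measure.pi fun _ : Fin n => gaussian d β) := by
  rw [← map_velLaw_tuple (β := β) (x := x) hx, lintegral_map]
  · exact lintegral_congr fun V => congrArg f (attachFin_tup hx V)
  · exact hf.comp ((measurable_tup continuous_fst n).comp
      (measurable_zipTuple.comp (measurable_const.prodMk measurable_id)))
  · exact measurable_pi_lambda _ fun i => measurable_pi_apply (x i)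

theorem measurable_lintegral_zipTuple {f : FinConfig (posV d) → ℝ≥0∞} (hf : Measurable f) (n : ℕ) :
    Measurable fun x : Fin n → E d =>
      ∫⁻ v, f (tup (posV d) n (zipTuple x v)) ∂(Measure.pi fun _ : Fin n => gaussian d β) :=
  Measurable.lintegral_prod_right' (f := fun p : (Fin n → E d) × (Fin n → E d) =>
    f (tup (posV d) n (zipTuple p.1 p.2)))
    (hf.comp ((measurable_tup continuous_fst n).comp measurable_zipTuple))

theorem measurable_markInt {f : FinConfig (posV d) → ℝ≥0∞} (hf : Measurable f) :
    Measurable (markInt β f) :=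
  measurable_finConfig' continuous_id _ (measurable_lintegral_zipTuple hf)
    fun _ _ hx => markInt_tup hf hx

theorem markInt_mul_positions {f : FinConfig (posV d) → ℝ≥0∞} (hf : Measurable f)
    (u : FinConfig (pos d) → ℝ≥0∞) (η : FinConfig (pos d)) :
    markInt β (fun η => f η * u (positions η)) η = markInt β f η * u η := by
  simp only [markInt, positions_attachFin]
  exact lintegral_mul_const _ (hf.comp (measurable_attachFin η))

/-- On `n`-tuples this is Fubini for `(dx ⊗ Gaussian)^n`, regrouped as positions followed by
velocities. The factor `1/n!` is the same on both sides. -/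
theorem lintegral_markInt (hd : 0 < d) {f : FinConfig (posV d) → ℝ≥0∞} (hf : Measurable f) :
    ∫⁻ η, markInt β f η ∂(lebesguePoisson (pos d) (leb d)) =
      ∫⁻ η, f η ∂(lebesguePoisson (posV d) (lebV d β)) := by
  rw [lintegral_lebesguePoisson (intensity_leb hd) (measurable_markInt hf),
    lintegral_lebesguePoisson (intensity_lebV hd) hf]
  refine tsum_congr fun n => ?_
  congr 1
  have h1 := measurePreserving_arrowProdEquivProdArrow (E d) (E d) (Fin n)
    (fun _ => leb d) (fun _ => gaussian d β)
  have hm : Measurable fun p : (Fin n → E d) × (Fin n → E d) =>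
      f (tup (posV d) n (zipTuple p.1 p.2)) :=
    hf.comp ((measurable_tup continuous_fst n).comp measurable_zipTuple)
  have h2 : ∫⁻ z, f (tup (posV d) n z) ∂(Measure.pi fun _ : Fin n => lebV d β) =
      ∫⁻ p, f (tup (posV d) n (zipTuple p.1 p.2))
        ∂((Measure.pi fun _ : Fin n => leb d).prod (Measure.pi fun _ : Fin n => gaussian d β)) := by
    rw [← h1.lintegral_comp hm]
    rfl
  rw [h2, lintegral_prod _ hm.aemeasurable]
  refine lintegral_congr_ae ?_
  filter_upwards [ae_mem_offDiag (intensity_leb hd) n] with x hx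
  exact markInt_tup hf hx

theorem lintegral_mul_positions (hd : 0 < d) {f : FinConfig (posV d) → ℝ≥0∞} (hf : Measurable f)
    {u : FinConfig (pos d) → ℝ≥0∞} (hu : Measurable u) :
    ∫⁻ η, f η * u (positions η) ∂(lebesguePoisson (posV d) (lebV d β)) =
      ∫⁻ η, markInt β f η * u η ∂(lebesguePoisson (pos d) (leb d)) := by
  have hm : Measurable fun η => f η * u (positions η) := hf.mul (hu.comp measurable_positions)
  rw [← lintegral_markInt hd hm]
  exact lintegral_congr fun η => markInt_mul_positions hf u η

theorem lintegral_weighted_markInt (hd : 0 < d) (ξ C : ℝ) {f : FinConfig (posV d) → ℝ≥0∞}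
    (hf : Measurable f) :
    ∫⁻ η, markInt β f η ∂(weighted (pos d) (leb d) ξ fun _ => C) =
      ∫⁻ η, f η ∂(weighted (posV d) (lebV d β) ξ fun _ => C) := by
  rw [lintegral_weighted continuous_id ξ C (measurable_markInt hf),
    lintegral_weighted continuous_fst ξ C hf]
  simp_rw [mul_comm (ENNReal.ofReal _), ← card_positions]
  exact (lintegral_mul_positions hd hf (measurable_weight continuous_id ξ C)).symm

theorem markInt_comp_positions (u : FinConfig (pos d) → ℝ≥0∞) (η : FinConfig (pos d)) :
    markInt β (fun η => u (positions η)) η = u η := by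
  simp [markInt, positions_attachFin]

end MarkingFinite

/-! ### Generators of the Borel σ-field of `Γ` -/

section Generators

variable {d : ℕ} {X : Type} {π : X → E d} [MetricSpace X]

/-- A finite configuration as a locally finite one. -/
def FinConfig.toConfig (η : FinConfig π) : Config π :=
  ⟨η.1, η.2.1, fun _ _ => η.2.2.subset inter_subset_left⟩

theorem continuous_toConfig : Continuous (FinConfig.toConfig (π := π)) := by
  refine continuous_iInf_rng.2 fun f => continuous_induced_rng.2 ?_
  refine continuous_finConfig_iff.2 fun n => ?_
  have : (pairing π f.1 ∘ FinConfig.toConfig) ∘ sym π n =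
      fun x : offDiag π n => ∑ i, f.1 (x.1 i) := by
    classical
    ext1 x
    have h := pairing_eq_sum (f := f.1) (sym π n x).toConfig (Finset.univ.image x.1)
      (by simp [FinConfig.toConfig, sym]) fun y hy hyx => by
        obtain ⟨i, rfl⟩ : y ∈ range x.1 := hy
        simp at hyx
    refine h.trans ?_
    exact Finset.sum_image fun i _ j _ h => offDiag.injective x h
  rw [this]
  exact continuous_finsetSum _ fun i _ =>
    f.1.1.continuous.comp ((continuous_apply i).comp continuous_subtype_val)

/-- The restriction to the ball of radius `k`. -/
abbrev ballConfig (π : X → E d) (k : ℕ) : Config π → FinConfig π :=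
  localConfig π (Metric.ball 0 k) Metric.isBounded_ball

theorem exists_pairing_ballConfig (f : X → ℝ) {L : Set (E d)} (hL : IsCompact L)
    (hf : ∀ x, f x ≠ 0 → π x ∈ L) :
    ∃ k : ℕ, ∀ j ≥ k, ∀ γ : Config π, pairing π f γ = pairing π f (ballConfig π j γ).toConfig := by
  obtain ⟨r, hr⟩ := hL.isBounded.subset_ball 0
  obtain ⟨k, hk⟩ := exists_nat_ge r
  refine ⟨k, fun j hj γ => ?_⟩
  rw [pairing_eq_indicator, pairing_eq_indicator]
  refine tsum_congr fun x => ?_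
  by_cases hx : f x = 0
  · have h0 : ∀ s : Set X, s.indicator f x = 0 := fun s => indicator_apply_eq_zero.2 fun _ => hx
    rw [h0, h0]
  · have hxj : π x ∈ Metric.ball (0 : E d) j :=
      Metric.ball_subset_ball (hk.trans (by exact_mod_cast hj)) (hr (hf x hx))
    have : x ∈ γ.1 ↔ x ∈ (ballConfig π j γ).toConfig.1 :=
      ⟨fun h => ⟨h, hxj⟩, fun h => h.1⟩
    by_cases hxγ : x ∈ γ.1
    · rw [indicator_of_mem hxγ, indicator_of_mem (this.1 hxγ)]
    · rw [indicator_of_notMem hxγ, indicator_of_notMem (mt this.2 hxγ)]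

/-- A basic neighbourhood involves finitely many test functions of bounded support, and one ball
contains all of these supports. -/
theorem exists_preimage_ballConfig_subset {γ : Config π} {O : Set (Config π)} (hO : O ∈ 𝓝 γ) :
    ∃ k : ℕ, ∃ Q : Set (FinConfig π), IsOpen Q ∧ ballConfig π k γ ∈ Q ∧
      ballConfig π k ⁻¹' Q ⊆ O := by
  rw [nhds_iInf, Filter.mem_iInf] at hO
  obtain ⟨I, hI, W, hW, rfl⟩ := hO
  have h1 : ∀ i : I, ∃ k : ℕ, ∀ j ≥ k, ∀ γ : Config π,
      pairing π i.1.1 γ = pairing π i.1.1 (ballConfig π j γ).toConfig := fun i => by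
    obtain ⟨L, hL, hf⟩ := i.1.2
    exact exists_pairing_ballConfig _ hL hf
  choose k hk using h1
  have := hI.fintype
  let K := Finset.univ.sup k
  have hK : ∀ i, k i ≤ K := fun i => Finset.le_sup (Finset.mem_univ i)
  have h2 : ∀ i : I, ∃ U : Set ℝ, IsOpen U ∧ pairing π i.1.1 γ ∈ U ∧
      pairing π i.1.1 ⁻¹' U ⊆ W i := fun i => by
    have h3 := hW i
    rw [nhds_induced, mem_comap] at h3
    obtain ⟨t, ht, htW⟩ := h3
    obtain ⟨U, hUt, hU, hγ⟩ := mem_nhds_iff.1 ht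
    exact ⟨U, hU, hγ, (preimage_mono hUt).trans htW⟩
  choose U hU hγU hUW using h2
  refine ⟨K, ⋂ i, (fun η : FinConfig π => pairing π i.1.1 η.toConfig) ⁻¹' U i, ?_, ?_, ?_⟩
  · refine isOpen_iInter_of_finite fun i => (hU i).preimage ?_
    obtain ⟨L, hL, hf⟩ := i.1.2
    exact (continuous_pairing i.1.1 hL hf).comp continuous_toConfig
  · refine mem_iInter.2 fun i => ?_
    rw [mem_preimage, ← hk i K (hK i)]
    exact hγU i
  · intro γ' hγ'
    refine mem_iInter.2 fun i => hUW i ?_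
    have := mem_iInter.1 hγ' i
    rw [mem_preimage, hk i K (hK i)]
    exact this

/-- For each radius, unite all admissible open sets in `Γ₀`. Only the union over integer radii
remains, so it is countable even though second countability of `Γ` has not been established. -/
theorem isOpen_eq_iUnion_ballConfig {O : Set (Config π)} (hO : IsOpen O) :
    ∃ Q : ℕ → Set (FinConfig π), (∀ k, IsOpen (Q k)) ∧ O = ⋃ k, ballConfig π k ⁻¹' Q k := by
  refine ⟨fun k => ⋃₀ {Q | IsOpen Q ∧ ballConfig π k ⁻¹' Q ⊆ O},
    fun k => isOpen_sUnion fun Q hQ => hQ.1, Subset.antisymm (fun γ hγ => ?_) ?_⟩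
  · obtain ⟨k, Q, hQ, hγQ, hQO⟩ := exists_preimage_ballConfig_subset (hO.mem_nhds hγ)
    exact mem_iUnion.2 ⟨k, Q, ⟨hQ, hQO⟩, hγQ⟩
  · refine iUnion_subset fun k γ hγ => ?_
    obtain ⟨Q, ⟨-, hQO⟩, hγQ⟩ := hγ
    exact hQO hγQ

theorem measurable_config {Y : Type*} [MeasurableSpace Y] {g : Y → Config π}
    (hg : ∀ k, Measurable fun y => ballConfig π k (g y)) : Measurable g := by
  refine measurable_of_isOpen fun O hO => ?_
  obtain ⟨Q, hQ, rfl⟩ := isOpen_eq_iUnion_ballConfig hO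
  rw [preimage_iUnion]
  exact MeasurableSet.iUnion fun k => hg k (hQ k).measurableSet

variable [SecondCountableTopology X] [MeasurableSpace X] [BorelSpace X]

/-- The events that depend on the configuration in a ball of integer radius. -/
def ballEvents (π : X → E d) : Set (Set (Config π)) :=
  {s | ∃ k : ℕ, ∃ A : Set (FinConfig π), MeasurableSet A ∧ ballConfig π k ⁻¹' A = s}

theorem generateFrom_ballEvents (hπ : Continuous π) :
    (inferInstance : MeasurableSpace (Config π)) = .generateFrom (ballEvents π) := by
  refine le_antisymm ?_ (MeasurableSpace.generateFrom_le ?_)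
  · refine MeasurableSpace.generateFrom_le fun O hO => ?_
    obtain ⟨Q, hQ, rfl⟩ := isOpen_eq_iUnion_ballConfig (π := π) hO
    exact MeasurableSet.iUnion fun k =>
      MeasurableSpace.measurableSet_generateFrom ⟨k, Q k, (hQ k).measurableSet, rfl⟩
  · rintro _ ⟨k, A, hA, rfl⟩
    exact measurable_localConfig hπ Metric.isOpen_ball Metric.isBounded_ball hA

/-- Two ball events are both events in the larger ball, since restriction to the smaller ball
factors through it. -/
theorem isPiSystem_ballEvents (hπ : Continuous π) : IsPiSystem (ballEvents π) := by
  rintro _ ⟨j, A, hA, rfl⟩ _ ⟨k, B, hB, rfl⟩ -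
  have hm : ∀ i : ℕ, Measurable fun η : FinConfig π => ballConfig π i η.toConfig := fun i =>
    (measurable_localConfig hπ Metric.isOpen_ball Metric.isBounded_ball).comp
      continuous_toConfig.measurable
  have h : ∀ {i l : ℕ}, i ≤ l → ∀ γ : Config π,
      ballConfig π i (ballConfig π l γ).toConfig = ballConfig π i γ := by
    intro i l hil γ
    refine Subtype.ext (Subset.antisymm (fun x hx => ⟨hx.1.1, hx.2⟩) fun x hx => ⟨⟨hx.1, ?_⟩, hx.2⟩)
    exact Metric.ball_subset_ball (by exact_mod_cast hil) hx.2
  refine ⟨max j k, _, (hm j hA).inter (hm k hB), ?_⟩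
  ext γ
  simp only [mem_inter_iff, mem_preimage, h (le_max_left j k) γ, h (le_max_right j k) γ]

end Generators

/-! ### Marked configurations and their correlation measures -/

section Marking

variable {d : ℕ} {β : ℝ}

theorem localConfig_attach {Λ : Set (E d)} (hΛ : Bornology.IsBounded Λ) (γ : Config (pos d))
    (V : E d → E d) :
    localConfig (posV d) Λ hΛ (attach γ V) = attachFin (localConfig (pos d) Λ hΛ γ) V := by
  refine Subtype.ext (Subset.antisymm ?_ ?_)
  · rintro _ ⟨⟨x, hx, rfl⟩, hxΛ⟩
    exact ⟨x, ⟨hx, hxΛ⟩, rfl⟩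
  · rintro _ ⟨x, ⟨hx, hxΛ⟩, rfl⟩
    exact ⟨⟨x, hx, rfl⟩, hxΛ⟩

/-- Within each ball only finitely many velocities are read off, so the product σ-field suffices. -/
theorem measurable_attach (γ : Config (pos d)) : Measurable (attach γ) := by
  refine measurable_config fun k => ?_
  simp_rw [ballConfig, localConfig_attach]
  exact measurable_attachFin _

theorem subSum_attach (f : FinConfig (posV d) → ℝ≥0∞) (γ : Config (pos d)) (V : E d → E d) :
    subSum f (attach γ V).1 = ∑' η : {η : FinConfig (pos d) // η.1 ⊆ γ.1}, f (attachFin η.1 V) := by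
  let e : {η : FinConfig (pos d) // η.1 ⊆ γ.1} ≃
      {η : FinConfig (posV d) // η.1 ⊆ (attach γ V).1} :=
    { toFun := fun η => ⟨attachFin η.1 V, image_mono η.2⟩
      invFun := fun η => ⟨positions η.1, by
        rintro _ ⟨z, hz, rfl⟩
        obtain ⟨x, hx, rfl⟩ := η.2 hz
        exact hx⟩
      left_inv := fun η => Subtype.ext (positions_attachFin η.1 V)
      right_inv := fun η => by
        refine Subtype.ext (Subtype.ext (Subset.antisymm ?_ fun z hz => ?_))
        · rintro _ ⟨_, ⟨z, hz, rfl⟩, rfl⟩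
          obtain ⟨x, hx, rfl⟩ := η.2 hz
          exact hz
        · obtain ⟨x, hx, rfl⟩ := η.2 hz
          exact ⟨x, ⟨_, hz, rfl⟩, rfl⟩ }
  exact (e.tsum_eq fun η => f η.1).symm

/-- Countability permits exchanging the sum over subconfigurations with the integral over
velocities. -/
theorem countable_subconfig (γ : Config (pos d)) :
    Countable {η : FinConfig (pos d) // η.1 ⊆ γ.1} := by
  have hγ : γ.1.Countable := by
    have : γ.1 = ⋃ k : ℕ, γ.1 ∩ Metric.closedBall (0 : E d) k := by
      rw [← inter_iUnion, Metric.iUnion_closedBall_nat, inter_univ]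
    rw [this]
    exact countable_iUnion fun k => (γ.2.2 _ (isCompact_closedBall _ _)).countable
  have h := (countable_ofPred_finite_subset hγ).to_subtype
  exact Function.Injective.countable
    (f := fun η : {η : FinConfig (pos d) // η.1 ⊆ γ.1} =>
      (⟨η.1.1, η.1.2.2, η.2⟩ : {t : Set (E d) | t.Finite ∧ t ⊆ γ.1}))
    fun η η' hη => by
      have h1 : η.1.1 = η'.1.1 := congrArg (fun t => t.1) hη
      exact Subtype.ext (Subtype.ext h1)

variable [IsProbabilityMeasure (gaussian d β)]

instance (γ : Config (pos d)) : IsProbabilityMeasure (markLaw β γ) :=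
  Measure.isProbabilityMeasure_map (μ := velLaw d β) (measurable_attach γ).aemeasurable

theorem lintegral_markLaw (γ : Config (pos d)) {f : Config (posV d) → ℝ≥0∞} (hf : Measurable f) :
    ∫⁻ γ', f γ' ∂(markLaw β γ) = ∫⁻ V, f (attach γ V) ∂(velLaw d β) :=
  lintegral_map (μ := velLaw d β) hf (measurable_attach γ)

theorem markLaw_localConfig {Λ : Set (E d)} (hΛo : IsOpen Λ) (hΛ : Bornology.IsBounded Λ)
    {A : Set (FinConfig (posV d))} (hA : MeasurableSet A) (γ : Config (pos d)) :
    markLaw β γ (localConfig (posV d) Λ hΛ ⁻¹' A) =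
      markInt β (A.indicator 1) (localConfig (pos d) Λ hΛ γ) := by
  have hm := measurable_localConfig (π := posV d) continuous_fst hΛo hΛ
  rw [← lintegral_indicator_one (hm hA), lintegral_markLaw γ (measurable_one.indicator (hm hA))]
  refine lintegral_congr fun V => ?_
  rw [← localConfig_attach]
  rfl

/-- It is enough to test ball events, a generating π-system, on which the probability is `markInt`
of an indicator evaluated at the restricted configuration. -/
theorem measurable_markLaw : Measurable (markLaw (d := d) β) := by
  refine Measurable.measure_of_isPiSystem_of_isProbabilityMeasure
    (generateFrom_ballEvents continuous_fst) (isPiSystem_ballEvents continuous_fst) ?_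
  rintro _ ⟨k, A, hA, rfl⟩
  simp_rw [ballConfig, markLaw_localConfig Metric.isOpen_ball Metric.isBounded_ball hA]
  exact (measurable_markInt (measurable_one.indicator hA)).comp
    (measurable_localConfig continuous_id Metric.isOpen_ball Metric.isBounded_ball)

instance (μ : Measure (Config (pos d))) [IsProbabilityMeasure μ] :
    IsProbabilityMeasure (marked β μ) :=
  isProbabilityMeasure_bind measurable_markLaw.aemeasurable (ae_of_all _ fun _ => inferInstance)

/-- Attaching velocities gives a bijection between the subconfigurations of `γ` and those of its
marked version, so the velocity average can be taken inside the sum, one subconfiguration at a time.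
-/
theorem lintegral_corrMeasure_marked (μ : Measure (Config (pos d)))
    {f : FinConfig (posV d) → ℝ≥0∞} (hf : Measurable f) :
    ∫⁻ η, f η ∂(corrMeasure (marked β μ)) = ∫⁻ η, markInt β f η ∂(corrMeasure μ) := by
  have hs := measurable_subSum_config (π := posV d) continuous_fst hf
  rw [lintegral_corrMeasure continuous_fst _ hf,
    lintegral_corrMeasure continuous_id _ (measurable_markInt hf), marked,
    Measure.lintegral_bind measurable_markLaw.aemeasurable hs.aemeasurable]
  refine lintegral_congr fun γ => ?_
  rw [lintegral_markLaw γ hs]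
  simp_rw [subSum_attach]
  have := countable_subconfig γ
  exact lintegral_tsum fun η => (hf.comp (measurable_attachFin η.1)).aemeasurable

/-- Restriction to `Λ` commutes with attaching velocities. The density of the positions does not see
the velocities, so it factors out of the velocity average. -/
theorem hasMarkedDensities_marked (hd : 0 < d) {μ : Measure (Config (pos d))} [IsFiniteMeasure μ]
    (hμ : LocallyAC (pos d) (leb d) μ) : HasMarkedDensities β μ (marked β μ) := by
  intro Λ hΛ hΛo
  have hm := measurable_localConfig (π := posV d) continuous_fst hΛo hΛ
  have hmV := measurableSet_finConfigIn (π := posV d) continuous_fst hΛo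
  have hmX := measurableSet_finConfigIn (π := pos d) continuous_id hΛo
  have hp : Measurable (localDensity (pos d) (leb d) μ Λ hΛ) := Measure.measurable_rnDeriv _ _
  refine Measure.ext fun A hA => ?_
  have hA1 : Measurable (A.indicator (1 : FinConfig (posV d) → ℝ≥0∞)) := measurable_one.indicator hA
  rw [localLaw, Measure.map_apply hm hA, marked,
    Measure.bind_apply (hm hA) measurable_markLaw.aemeasurable]
  simp_rw [markLaw_localConfig hΛo hΛ hA]
  rw [← lintegral_map (measurable_markInt hA1)
    (measurable_localConfig (π := pos d) continuous_id hΛo hΛ)]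
  change ∫⁻ η, markInt β (A.indicator 1) η ∂(localLaw (pos d) μ Λ hΛ) = _
  rw [localLaw_eq_withDensity (intensity_leb hd) hμ hΛ hΛo,
    lintegral_withDensity_eq_lintegral_mul _ hp (measurable_markInt hA1),
    withDensity_apply _ hA, ← lintegral_indicator hA, ← lintegral_indicator hmV,
    ← lintegral_indicator hmX]
  have hu := hp.indicator hmX
  refine Eq.trans ?_ ((lintegral_mul_positions (β := β) hd hA1 hu).symm.trans ?_)
  · refine lintegral_congr fun η => ?_
    by_cases hη : η ∈ FinConfigIn (pos d) Λ
    · simp [hη, mul_comm]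
    · simp [hη]
  · refine lintegral_congr fun η => ?_
    have hiff : positions η ∈ FinConfigIn (pos d) Λ ↔ η ∈ FinConfigIn (posV d) Λ :=
      image_subset_iff
    by_cases hη : η ∈ FinConfigIn (posV d) Λ
    · by_cases hηA : η ∈ A <;> simp [hη, hηA, hiff]
    · simp [hη, hiff]

theorem corrMeasure_marked_le (hd : 0 < d) {μ : Measure (Config (pos d))} {ξ C : ℝ}
    (h : corrMeasure μ ≤ weighted (pos d) (leb d) ξ fun _ => C) :
    corrMeasure (marked β μ) ≤ weighted (posV d) (lebV d β) ξ fun _ => C := by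
  refine Measure.le_iff.2 fun A hA => ?_
  have hA1 : Measurable (A.indicator (1 : FinConfig (posV d) → ℝ≥0∞)) := measurable_one.indicator hA
  rw [← lintegral_indicator_one hA, ← lintegral_indicator_one hA,
    lintegral_corrMeasure_marked μ hA1, ← lintegral_weighted_markInt hd ξ C hA1]
  exact lintegral_mono' h le_rfl

/-- Test the marked inequality with functions of the positions only; averaging over velocities
leaves them unchanged. -/
theorem corrMeasure_le_of_marked_le (hd : 0 < d) {μ : Measure (Config (pos d))} {ξ C : ℝ}
    (h : corrMeasure (marked β μ) ≤ weighted (posV d) (lebV d β) ξ fun _ => C) :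
    corrMeasure μ ≤ weighted (pos d) (leb d) ξ fun _ => C := by
  refine Measure.le_iff.2 fun A hA => ?_
  have hA1 : Measurable (A.indicator (1 : FinConfig (pos d) → ℝ≥0∞)) := measurable_one.indicator hA
  have hA2 : Measurable fun η => A.indicator (1 : FinConfig (pos d) → ℝ≥0∞) (positions η) :=
    hA1.comp measurable_positions
  have h1 := lintegral_mono' h
    (le_refl fun η => A.indicator (1 : FinConfig (pos d) → ℝ≥0∞) (positions η))
  rw [lintegral_corrMeasure_marked μ hA2, ← lintegral_weighted_markInt hd ξ C hA2] at h1
  simp_rw [markInt_comp_positions] at h1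
  rwa [lintegral_indicator_one hA, lintegral_indicator_one hA] at h1

theorem locallyAC_marked (hd : 0 < d) {μ : Measure (Config (pos d))} [IsFiniteMeasure μ]
    (hμ : LocallyAC (pos d) (leb d) μ) : LocallyAC (posV d) (lebV d β) (marked β μ) := by
  intro Λ hΛ hΛo
  rw [hasMarkedDensities_marked hd hμ Λ hΛ hΛo]
  exact withDensity_absolutelyContinuous _ _

/-- The velocity average of an integrable function is an admissible test function for the positions,
so weak convergence of the marked measures is never needed. -/
theorem CorrTendsto.marked (hd : 0 < d) {μs : ℕ → Measure (Config (pos d))}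
    {μ : Measure (Config (pos d))} {ξ C : ℝ}
    (h : CorrTendsto μs μ (weighted (pos d) (leb d) ξ fun _ => C)) :
    CorrTendsto (fun n => marked β (μs n)) (marked β μ)
      (weighted (posV d) (lebV d β) ξ fun _ => C) := by
  intro f hf hfin
  rw [← lintegral_weighted_markInt hd ξ C hf] at hfin
  simp_rw [lintegral_corrMeasure_marked _ hf]
  exact h _ (measurable_markInt hf) hfin

end Marking

/-! ### Limits in the unmarked case -/

section Limits

variable {d : ℕ} {μs : ℕ → ProbabilityMeasure (Config (pos d))}
  {μ : ProbabilityMeasure (Config (pos d))}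

theorem corrMeasure_le_and_corrTendsto (hd : 0 < d) (hlim : Tendsto μs atTop (𝓝 μ)) {ξ C : ℝ}
    (hξ : 0 ≤ ξ) (hn : ∀ n, corrMeasure (μs n : Measure (Config (pos d))) ≤
      weighted (pos d) (leb d) ξ fun _ => C) :
    corrMeasure (μ : Measure (Config (pos d))) ≤ (weighted (pos d) (leb d) ξ fun _ => C) ∧
      CorrTendsto (fun n => (μs n : Measure (Config (pos d)))) (μ : Measure (Config (pos d)))
        (weighted (pos d) (leb d) ξ fun _ => C) := by
  have hmom := hasMoments_weighted (C := C) (intensity_leb hd) hξ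
  exact ⟨corrMeasure_le_of_tendsto continuous_id hlim (fun k => hmom.measure_lt_top k) hn,
    corrTendsto_of_tendsto continuous_id hlim hmom hn⟩

theorem corrMeasure_le_weighted_const {X : Type} {π : X → E d} [MetricSpace X]
    [SecondCountableTopology X] [MeasurableSpace X] [BorelSpace X] {σ : Measure X} [SigmaFinite σ]
    (hσ : Intensity π σ) {m : Measure (Config π)} [IsFiniteMeasure m] (hac : LocallyAC π σ m)
    {ζ C : ℝ} (hζ : 0 ≤ ζ) {h : FinConfig π → ℝ} (hb : RuelleBound π σ m ζ h)
    (hC : ∀ᵐ η ∂(lebesguePoisson π σ), |h η| ≤ C) :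
    corrMeasure m ≤ weighted π σ ζ fun _ => C :=
  (corrMeasure_le_weighted hσ hac hb).trans
    (weighted_mono hζ (hC.mono fun _ hη => (le_abs_self _).trans hη))

end Limits

end RuelleLimit

end

/-! ### The theorem -/

open RuelleLimit
theorem lemma3p18 {d : ℕ} (hd : 0 < d) {β : ℝ} (hβ : 0 < β)
    (μs : ℕ → ProbabilityMeasure (Config (pos d))) (μ : ProbabilityMeasure (Config (pos d)))
    (hac : ∀ n, LocallyAC (pos d) (leb d) (μs n : Measure (Config (pos d))))
    (hlim : Tendsto μs atTop (𝓝 μ)) :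
    -- the measures `marked β (μs n)` have the densities that define them
    (∀ n, HasMarkedDensities β (μs n : Measure (Config (pos d)))
      (marked β (μs n : Measure (Config (pos d))))) ∧
    -- uniform Ruelle bound: the conclusions in the unmarked and in the velocity marked case
    (∀ ξ : ℝ, 0 < ξ →
      (∀ n, RuelleBound (pos d) (leb d) (μs n : Measure (Config (pos d))) ξ fun _ => 1) →
      RuelleConclusion (pos d) (leb d)
        (fun n => (μs n : Measure (Config (pos d)))) (μ : Measure (Config (pos d))) ξ ∧
      HasMarkedDensities β (μ : Measure (Config (pos d)))
        (marked β (μ : Measure (Config (pos d)))) ∧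
      RuelleConclusion (posV d) (lebV d β)
        (fun n => marked β (μs n : Measure (Config (pos d))))
        (marked β (μ : Measure (Config (pos d)))) ξ) ∧
    -- improved Ruelle bound, unmarked case
    (∀ ζ : ℝ, 1 ≤ ζ →
      ∀ (h : ℕ → FinConfig (pos d) → ℝ) (h' : FinConfig (pos d) → ℝ),
      (∃ C : ℝ, ∀ n, ∀ᵐ η ∂(lebesguePoisson (pos d) (leb d)), |h n η| ≤ C) →
      WeakStarTendsto (lebesguePoisson (pos d) (leb d)) h h' →
      (∀ n, RuelleBound (pos d) (leb d) (μs n : Measure (Config (pos d))) ζ (h n)) →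
      ImprovedRuelleConclusion (pos d) (leb d)
        (fun n => (μs n : Measure (Config (pos d)))) (μ : Measure (Config (pos d))) ζ h h') ∧
    -- improved Ruelle bound, velocity marked case
    (∀ ζ : ℝ, 1 ≤ ζ →
      ∀ (h : ℕ → FinConfig (posV d) → ℝ) (h' : FinConfig (posV d) → ℝ),
      (∃ C : ℝ, ∀ n, ∀ᵐ η ∂(lebesguePoisson (posV d) (lebV d β)), |h n η| ≤ C) →
      WeakStarTendsto (lebesguePoisson (posV d) (lebV d β)) h h' →
      (∀ n, RuelleBound (posV d) (lebV d β)
        (marked β (μs n : Measure (Config (pos d)))) ζ (h n)) →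
      HasMarkedDensities β (μ : Measure (Config (pos d)))
        (marked β (μ : Measure (Config (pos d)))) ∧
      ImprovedRuelleConclusion (posV d) (lebV d β)
        (fun n => marked β (μs n : Measure (Config (pos d))))
        (marked β (μ : Measure (Config (pos d)))) ζ h h') := by
  have := isProbabilityMeasure_gaussian (d := d) hβ
  have hσ := intensity_leb hd
  have hσV := intensity_lebV (β := β) hd
  refine ⟨fun n => hasMarkedDensities_marked hd (hac n), ?_, ?_, ?_⟩
  · intro ξ hξ hb
    have hn : ∀ n, corrMeasure (μs n : Measure (Config (pos d))) ≤
        weighted (pos d) (leb d) ξ fun _ => 1 := fun n => corrMeasure_le_weighted hσ (hac n) (hb n)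
    obtain ⟨hμ, H⟩ := corrMeasure_le_and_corrTendsto hd hlim hξ.le hn
    exact ⟨ruelleConclusion_of_corrTendsto hσ hξ hn hμ H,
      hasMarkedDensities_marked hd (locallyAC_of_le_weighted hσ hμ),
      ruelleConclusion_of_corrTendsto hσV hξ (fun n => corrMeasure_marked_le hd (hn n))
        (corrMeasure_marked_le hd hμ) (H.marked hd)⟩
  · rintro ζ hζ h h' ⟨C, hC⟩ hw hb
    have hζ0 : 0 < ζ := zero_lt_one.trans_le hζ
    have hn : ∀ n, corrMeasure (μs n : Measure (Config (pos d))) ≤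
        weighted (pos d) (leb d) ζ fun _ => C := fun n =>
      corrMeasure_le_weighted_const hσ (hac n) hζ0.le (hb n) (hC n)
    obtain ⟨hμ, H⟩ := corrMeasure_le_and_corrTendsto hd hlim hζ0.le hn
    exact improvedRuelleConclusion_of_corrTendsto hσ hac hζ0 hn hμ H hw hb
  · rintro ζ hζ h h' ⟨C, hC⟩ hw hb
    have hζ0 : 0 < ζ := zero_lt_one.trans_le hζ
    have hacV : ∀ n, LocallyAC (posV d) (lebV d β)
        (marked β (μs n : Measure (Config (pos d)))) := fun n => locallyAC_marked hd (hac n)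
    have hnV : ∀ n, corrMeasure (marked β (μs n : Measure (Config (pos d)))) ≤
        weighted (posV d) (lebV d β) ζ fun _ => C := fun n =>
      corrMeasure_le_weighted_const hσV (hacV n) hζ0.le (hb n) (hC n)
    -- The functions `h n` may depend on the velocities, but their uniform bound `C` does not. The
    -- domination with `C` therefore descends to the positions, where weak convergence is available,
    -- and its consequences are lifted back.
    obtain ⟨hμ, H⟩ := corrMeasure_le_and_corrTendsto hd hlim hζ0.le fun n =>
      corrMeasure_le_of_marked_le hd (hnV n)
    exact ⟨hasMarkedDensities_marked hd (locallyAC_of_le_weighted hσ hμ),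
      improvedRuelleConclusion_of_corrTendsto hσV hacV hζ0 hnV (corrMeasure_marked_le hd hμ)
        (H.marked hd) hw hb⟩
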